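/- For $f\in\mathbb C[x]$ let $\|f\|_\infty$ be the largest modulus of a coefficient, and let $\lg=\log_2$. Bit complexity is measured by the number of gates of Boolean circuits over the full binary basis (one circuit for each choice of the parameters), and $\mu(m)$ denotes the least number of gates of a circuit that multiplies two $m$-bit integers; a real argument of $\mu$ is rounded up. Polynomials are given to a circuit, and returned by it, as lists of complex coefficients whose real and imaginary parts are fixed-point binary numbers. Let $s,t\in\mathbb C[x]$, where $\deg s\le 2n$, $t$ is monic of degree $n$, $\|s\|_\infty\le 2^{\tau_1}$, $\|t\|_\infty\le 2^{\tau_2}$, and all the roots of $t$ have modulus at most $2^\rho$. Let $q$ and $r$ be the quotient and the remainder of the division of $s$ by $t$, that is, $s=tq+r$ with $\deg r<\deg t$. (a) If $n\ge 1$ and $\rho\ge 0$, then $\|q\|_\infty\le 2^{2n+\lg n+1+n\rho+\tau_1}$ and $\|r\|_\infty\le 2^{3n+\lg n+1+2n\rho+\tau_1}$. (b) Let $n\ge 2$, $\ell,\tau_1,\tau_2\ge 0$ and $\rho\ge 1$ be real parameters ($n$ an integer), and put $$\lambda=\ell+\tau_1+12\,\tau_2\lg n+80\lg^2 n+10(\rho+1)\,n\lg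 n+30 .$$ Then $\lambda=O(\ell+\tau_1+\tau_2\lg n+n\rho\lg n)$. Moreover, from any polynomials $\tilde s,\tilde t$ (of degree at most $2n$ and $n$, given as above) with $\|s-\tilde s\|_\infty\le 2^{-\lambda}$ and $\|t-\tilde t\|_\infty\le 2^{-\lambda}$ one can compute polynomials $\tilde q,\tilde r$ with $\|q-\tilde q\|_\infty\le 2^{-\ell}$ and $\|r-\tilde r\|_\infty\le 2^{-\ell}$ by a circuit, depending only on $n,\ell,\tau_1,\tau_2,\rho$ and on the input format, with $$O\bigl(n\,\lg^2 n\;\mu(\ell+\tau_1+(\tau_2+n\rho)\lg n)\bigr)$$ gates, and this number is also $\tilde O(n\ell+n\tau_1+n\tau_2+n^2\rho)$, where $\tilde O(X)$ means $O(X\lg^k X)$ for some fixed $k$. All the implied constants, and $k$, are absolute. -/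

import Mathlib

open Polynomial

/-- A Boolean circuit with inputs indexed by `ι` and exactly `g` gates. Each gate applies an
arbitrary binary Boolean operation (one bit operation) to two wires, each of which is an input
(`Sum.inl`) or an earlier gate (`Sum.inr`). -/
inductive Circuit (ι : Type) : ℕ → Type
  | nil : Circuit ι 0
  | gate {g : ℕ} (c : Circuit ι g) (op : Bool → Bool → Bool) (a b : ι ⊕ Fin g) : Circuit ι (g + 1)

namespace Circuit

/-- The values of all the gates on the input `x`, in the order of their creation. -/
def gateVal {ι : Type} : {g : ℕ} → Circuit ι g → (ι → Bool) → Fin g → Bool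
  | _, nil, _ => Fin.elim0
  | _, gate c op a b, x =>
      Fin.snoc (α := fun _ => Bool) (c.gateVal x)
        (op (Sum.elim x (c.gateVal x) a) (Sum.elim x (c.gateVal x) b))

/-- The value of a wire (an input or a gate) on the input `x`. -/
def wireVal {ι : Type} {g : ℕ} (c : Circuit ι g) (x : ι → Bool) : ι ⊕ Fin g → Bool :=
  Sum.elim x (c.gateVal x)

end Circuit

/-- The Boolean function `F` can be evaluated by a circuit with `g` gates: each output bit of `F`
is read off from a wire of the circuit. -/
def ComputableWithGates {ι κ : Type} (F : (ι → Bool) → κ → Bool) (g : ℕ) : Prop :=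
  ∃ (c : Circuit ι g) (out : κ → ι ⊕ Fin g), ∀ x k, c.wireVal x (out k) = F x k

/-- The multiplication of two `m`-bit integers, as a Boolean function from `2 m` input bits
to `2 m` output bits (least significant bit first). -/
def mulBits (m : ℕ) (x : Fin m ⊕ Fin m → Bool) (k : Fin (2 * m)) : Bool :=
  (Nat.ofBits (fun i => x (Sum.inl i)) * Nat.ofBits (fun i => x (Sum.inr i))).testBit k

/-- `mulCost m` is `μ(m)`, the bit complexity of multiplying two integers of size `m`: the least
number of gates of a Boolean circuit that multiplies two `m`-bit integers. -/
noncomputable def mulCost (m : ℕ) : ℕ :=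
  sInf {g : ℕ | ComputableWithGates (mulBits m) g}

/-- The integer written in two's complement with `w` value bits (least significant bit first) and
one sign bit. -/
def intOfBits {w : ℕ} (b : Fin (w + 1) → Bool) : ℤ :=
  (Nat.ofBits (fun i : Fin w => b i.castSucc) : ℤ) - if b (Fin.last w) then 2 ^ w else 0

/-- The index type of the bits that describe a polynomial with `d` complex coefficients: the
coefficient, its real (`0`) or imaginary (`1`) part, and the position of the bit. -/
abbrev PolyBit (d w : ℕ) : Type := Fin d × Fin 2 × Fin (w + 1)

/-- The polynomial of degree less than `d` whose coefficients have the real and imaginary parts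
described by the bits `b` as fixed-point numbers, that is two's complement integers divided
by `2 ^ p`. -/
noncomputable def polyOfBits (p : ℕ) {d w : ℕ} (b : PolyBit d w → Bool) : ℂ[X] :=
  ∑ j : Fin d, monomial (j : ℕ)
    (((intOfBits (fun i => b (j, 0, i)) : ℂ) + (intOfBits (fun i => b (j, 1, i)) : ℂ) * Complex.I)
      / 2 ^ p)

/-- The binary logarithm. -/
noncomputable def lg (x : ℝ) : ℝ := Real.logb 2 x

/-- The division problem: `s` has degree at most `2 n` and coefficients of modulus at most
`2 ^ τ₁`; `t` is monic of degree `n`, its coefficients have modulus at most `2 ^ τ₂` and its roots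
have modulus at most `2 ^ ρ`; `q` and `r` are the quotient and the remainder of `s` by `t`. -/
structure IsDivision (n : ℕ) (τ₁ τ₂ ρ : ℝ) (s t q r : ℂ[X]) : Prop where
  natDegree_s : s.natDegree ≤ 2 * n
  monic_t : t.Monic
  natDegree_t : t.natDegree = n
  norm_s : s.supNorm ≤ 2 ^ τ₁
  norm_t : t.supNorm ≤ 2 ^ τ₂
  norm_root : ∀ z : ℂ, t.IsRoot z → ‖z‖ ≤ 2 ^ ρ
  eq : s = t * q + r
  degree_r : r.degree < t.degree

/-- The input precision `λ`. -/
noncomputable def divPrecision (n : ℕ) (ℓ τ₁ τ₂ ρ : ℝ) : ℝ :=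
  ℓ + τ₁ + 12 * τ₂ * lg n + 80 * lg n ^ 2 + 10 * (ρ + 1) * n * lg n + 30

/-- The Boolean function `F` solves the approximate division problem for the precision `ℓ`. It
reads the `2 n + 1` coefficients of `s'` and the `n + 1` coefficients of `t'` (with `p` bits after
the binary point) and writes the `n + 1` coefficients of `q'` and the `n` coefficients of `r'`
(with `p'` bits after the binary point). Whenever `s'` and `t'` approximate `s` and `t` to the
precision `λ`, `q'` and `r'` approximate the quotient and the remainder of `s` by `t` to the
precision `ℓ`. -/
def SolvesDivision (n : ℕ) (ℓ τ₁ τ₂ ρ : ℝ) (p w p' w' : ℕ)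
    (F : (PolyBit (2 * n + 1) w ⊕ PolyBit (n + 1) w → Bool) →
      PolyBit (n + 1) w' ⊕ PolyBit n w' → Bool) : Prop :=
  ∀ s t q r : ℂ[X], IsDivision n τ₁ τ₂ ρ s t q r →
    ∀ x : PolyBit (2 * n + 1) w ⊕ PolyBit (n + 1) w → Bool,
      (s - polyOfBits p (fun i => x (Sum.inl i))).supNorm ≤ 2 ^ (-divPrecision n ℓ τ₁ τ₂ ρ) →
      (t - polyOfBits p (fun i => x (Sum.inr i))).supNorm ≤ 2 ^ (-divPrecision n ℓ τ₁ τ₂ ρ) →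
      (q - polyOfBits p' (fun i => F x (Sum.inl i))).supNorm ≤ 2 ^ (-ℓ) ∧
      (r - polyOfBits p' (fun i => F x (Sum.inr i))).supNorm ≤ 2 ^ (-ℓ)

/-! ### Composition of circuits -/

/-! Reversing coefficients turns the division into a statement about power series. With T = x^n
t(1/x) and S = x^(2n) s(1/x), the reversed quotient is S/T modulo x^(n+1). Since T is the product of
1 - zx over the roots z of t, its inverse H is a product of geometric series. Truncated weighted ℓ¹
norms (`tnorm`) are submultiplicative, so T and H have norm at most B = 2^(n(ρ+2))
(`IsDivision.exists_inverse`), and the coefficients of S·H and of s - tq are bounded as in (a)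
(`IsDivision.supNorm_le`).

For (b), H is computed by the Newton iteration V ↦ V(2 - TV) in fixed-point arithmetic with P bits
after the point, P being λ rounded up. A step doubles the number of correct coefficients and
multiplies their error by at most D = 28B²(n+1) (`tnorm_newtonIter_le`). The O(lg n) steps thus lose
O(nρ lg n + lg² n) bits, which λ pays for (`precision_suffices`). The quotient and the remainder
then take one further product each (`DivApprox.err_quot`, `DivApprox.err_rem`).

In the circuit, a Gaussian integer is represented by its images modulo 2^N + 1 under the two
homomorphisms i ↦ ±2^(N/2). The numbers that are rounded or returned have modulus at most 2^(4P), so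
N slightly above 4P suffices to recover them. Polynomials modulo 2^N + 1 are multiplied by the
repeated splitting X^(2m) - a² = (X^m - a)(X^m + a) with a a power of two; this takes additions and
rotations of bits only, until single coefficients remain to be multiplied
(`Computes.fermatPolyMul`). Let M be the argument of μ in the theorem. Then N = O(M), a product of
residues splits into boundedly many products of M-bit integers (`Computes.fermatMul_of_blocks`), and
M ≤ μ(M) (`le_mulCost`) absorbs the linear work. A polynomial product therefore costs O(n lg n μ(M))
gates and the whole division O(n lg² n μ(M)).

The quasi-linear bound needs μ(m) = O(m lg^10 m). It comes from the same polynomial multiplication,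
applied recursively to integers cut into about √m blocks (`MulCircuit.step`,
`exists_mulCircuit_two_pow`).

Circuit constructions are stated with `Computes`, relative to a family Ω of admissible values. A
circuit has to be correct only on codes of these values, and this is how size bounds from the
analysis enter the construction. -/

theorem Circuit.exists_append {ι κ : Type} {g h : ℕ} (c : Circuit ι g) (out : κ → ι ⊕ Fin g)
    (d : Circuit κ h) : ∃ e : Circuit ι (g + h), ∀ x,
      (∀ i, e.gateVal x (Fin.castAdd h i) = c.gateVal x i) ∧
      ∀ j, e.gateVal x (Fin.natAdd g j) = d.gateVal (fun k => c.wireVal x (out k)) j := by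
  induction d with
  | nil => exact ⟨c, fun x => ⟨fun i => rfl, fun j => j.elim0⟩⟩
  | @gate h d op a b ih =>
    obtain ⟨e, he⟩ := ih
    -- Wires of the second circuit are renamed: its inputs become the output wires of the first, and
    -- its gates move up by g.
    let tr : κ ⊕ Fin h → ι ⊕ Fin (g + h) :=
      Sum.elim (fun k => Sum.map id (Fin.castAdd h) (out k)) (fun j => Sum.inr (Fin.natAdd g j))
    have htr : ∀ x a, Sum.elim x (e.gateVal x) (tr a) =
        Sum.elim (fun k => c.wireVal x (out k)) (d.gateVal (fun k => c.wireVal x (out k))) a := by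
      intro x a
      rcases a with k | j
      · simp only [tr, Sum.elim_inl, Circuit.wireVal]
        rcases out k with i | i
        · rfl
        · simpa using (he x).1 i
      · simpa [tr] using (he x).2 j
    refine ⟨e.gate op (tr a) (tr b), fun x => ⟨fun i => ?_, fun j => ?_⟩⟩
    · rw [← (he x).1 i]
      exact Fin.snoc_castSucc (α := fun _ => Bool) _ _ (Fin.castAdd h i)
    · refine Fin.lastCases ?_ (fun j => ?_) j
      · have h1 : Fin.natAdd g (Fin.last h) = Fin.last (g + h) := rfl
        rw [h1]
        simp only [Circuit.gateVal]
        rw [Fin.snoc_last, Fin.snoc_last, htr, htr]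
      · have h1 : Fin.natAdd g (Fin.castSucc j) = Fin.castSucc (Fin.natAdd g j) := rfl
        rw [h1]
        simp only [Circuit.gateVal]
        rw [Fin.snoc_castSucc, Fin.snoc_castSucc]
        exact (he x).2 j

/-- `F` can be evaluated by a circuit with at most `g` gates. -/
def CostLE {ι κ : Type} (F : (ι → Bool) → κ → Bool) (g : ℕ) : Prop :=
  ∃ g' ≤ g, ComputableWithGates F g'

namespace CostLE

variable {ι κ ν : Type}

theorem mono {F : (ι → Bool) → κ → Bool} {g h : ℕ} (hF : CostLE F g) (hgh : g ≤ h) :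
    CostLE F h := by
  obtain ⟨g', hg', H⟩ := hF
  exact ⟨g', hg'.trans hgh, H⟩

theorem comp {F : (ι → Bool) → κ → Bool} {G : (κ → Bool) → ν → Bool} {g h : ℕ}
    (hG : CostLE G h) (hF : CostLE F g) : CostLE (fun x => G (F x)) (g + h) := by
  obtain ⟨g', hg', c, out, hc⟩ := hF
  obtain ⟨h', hh', d, out', hd⟩ := hG
  obtain ⟨e, he⟩ := c.exists_append out d
  refine ⟨g' + h', by omega, e, fun k => Sum.elim
    (fun i => Sum.map id (Fin.castAdd h') (out i)) (fun j => Sum.inr (Fin.natAdd g' j)) (out' k), ?_⟩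
  intro x k
  have hFx : (fun k => c.wireVal x (out k)) = F x := funext (hc x)
  change _ = G (F x) k
  rw [← hd (F x) k, ← hFx]
  dsimp only
  rcases out' k with i | j
  · simp only [Sum.elim_inl, Circuit.wireVal]
    rcases out i with l | l
    · rfl
    · simpa using (he x).1 l
  · simpa [Circuit.wireVal] using (he x).2 j

/-- Outputs may be read from any wires, so selecting, permuting and duplicating bits is free. All
later savings for shifts and truncations rest on this. -/
theorem wiring (f : κ → ι) : CostLE (fun (x : ι → Bool) k => x (f k)) 0 :=
  ⟨0, le_rfl, .nil, fun k => .inl (f k), fun _ _ => rfl⟩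

theorem sum {F : (ι → Bool) → κ → Bool} {G : (ι → Bool) → ν → Bool} {g h : ℕ}
    (hF : CostLE F g) (hG : CostLE G h) : CostLE (fun x => Sum.elim (F x) (G x)) (g + h) := by
  obtain ⟨g', hg', c, out, hc⟩ := hF
  obtain ⟨h', hh', d, out', hd⟩ := hG
  obtain ⟨e, he⟩ := c.exists_append (fun i => Sum.inl i) d
  refine ⟨g' + h', by omega, e, Sum.elim (fun k => Sum.map id (Fin.castAdd h') (out k))
    (fun k => Sum.map id (Fin.natAdd g') (out' k)), ?_⟩
  rintro x (k | k)
  · change _ = F x k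
    rw [Sum.elim_inl, ← hc]
    rcases out k with l | l
    · rfl
    · simpa [Circuit.wireVal] using (he x).1 l
  · change _ = G x k
    rw [Sum.elim_inr, ← hd]
    rcases out' k with l | l
    · rfl
    · simpa [Circuit.wireVal] using (he x).2 l

theorem sigma_fin {n : ℕ} {F : Fin n → (ι → Bool) → κ → Bool} {g : Fin n → ℕ}
    (hF : ∀ i, CostLE (F i) (g i)) :
    CostLE (fun x (p : Fin n × κ) => F p.1 x p.2) (∑ i, g i) := by
  induction n with
  | zero => exact ⟨0, by simp, .nil, fun p => p.1.elim0, fun _ p => p.1.elim0⟩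
  | succ n ih =>
    have h1 := ih (fun i => hF i.castSucc)
    have h2 := (wiring (fun p : Fin (n + 1) × κ =>
      Fin.lastCases (motive := fun _ => Fin n × κ ⊕ κ) (Sum.inr p.2) (fun i => Sum.inl (i, p.2))
        p.1)).comp (h1.sum (hF (Fin.last n)))
    rw [Fin.sum_univ_castSucc]
    refine (congrArg (CostLE · _) ?_).mp h2
    funext x p
    obtain ⟨i, k⟩ := p
    refine Fin.lastCases ?_ (fun i => ?_) i <;> simp

theorem sigma {τ : Type} [Fintype τ] {F : τ → (ι → Bool) → κ → Bool} {g : τ → ℕ}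
    (hF : ∀ i, CostLE (F i) (g i)) :
    CostLE (fun x (p : τ × κ) => F p.1 x p.2) (∑ i, g i) := by
  let e := Fintype.equivFin τ
  have h1 := sigma_fin (fun j => hF (e.symm j))
  have h2 := (wiring (fun p : τ × κ => (e p.1, p.2))).comp h1
  rw [← Equiv.sum_comp e.symm g]
  simpa using h2

theorem gate (op : Bool → Bool → Bool) (a b : ι) :
    CostLE (fun (x : ι → Bool) (_ : Unit) => op (x a) (x b)) 1 := by
  refine ⟨1, le_rfl, Circuit.nil.gate op (.inl a) (.inl b), fun _ => .inr 0, fun x _ => ?_⟩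
  simp only [Circuit.wireVal, Circuit.gateVal, Sum.elim_inr, Sum.elim_inl]
  rfl

/-- Constant bits can be adjoined to the inputs. -/
theorem constants [Nonempty ι] : CostLE (fun (x : ι → Bool) => Sum.elim x (fun b : Bool => b)) 2 := by
  obtain ⟨i⟩ := ‹Nonempty ι›
  have h0 := gate (fun _ _ => false) i i
  have h1 := gate (fun _ _ => true) i i
  have h2 := (wiring (fun p : ι ⊕ Bool => Sum.elim (fun i => Sum.inl (Sum.inl i))
    (fun b => bif b then Sum.inr () else Sum.inl (Sum.inr ())) p)).comp
    (((wiring (id : ι → ι)).sum h0).sum h1)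
  convert h2 using 1
  funext x p
  rcases p with p | b
  · rfl
  · cases b <;> rfl

theorem wiring_const [Nonempty ι] (f : κ → ι ⊕ Bool) :
    CostLE (fun (x : ι → Bool) k => Sum.elim x (fun b : Bool => b) (f k)) 2 :=
  (wiring f).comp constants

end CostLE

/-! ### Encoded types -/

/-- A type together with a decoding of bit strings. -/
structure Enc where
  /-- positions of the bits -/
  κ : Type
  /-- the values -/
  X : Type
  /-- the value of a bit string -/
  dec : (κ → Bool) → X

namespace Enc

/-- Pairs. -/
abbrev prod (A B : Enc) : Enc :=
  ⟨A.κ ⊕ B.κ, A.X × B.X, fun x => (A.dec (fun i => x (.inl i)), B.dec (fun i => x (.inr i)))⟩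

/-- Vectors. -/
abbrev pow (τ : Type) (A : Enc) : Enc :=
  ⟨τ × A.κ, τ → A.X, fun x i => A.dec (fun k => x (i, k))⟩

end Enc

/-- From every code of `y ω` a circuit with at most `g` gates computes a code of `z ω`. -/
def Computes {Ω : Type*} (A B : Enc) (y : Ω → A.X) (z : Ω → B.X) (g : ℕ) : Prop :=
  ∃ F : (A.κ → Bool) → B.κ → Bool, CostLE F g ∧ ∀ ω x, A.dec x = y ω → B.dec (F x) = z ω

namespace Computes

variable {Ω : Type*} {A B C D : Enc} {y : Ω → A.X} {z : Ω → B.X} {u : Ω → C.X} {a b : ℕ}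

theorem mono (h : Computes A B y z a) (hab : a ≤ b) : Computes A B y z b := by
  obtain ⟨F, hF, H⟩ := h
  exact ⟨F, hF.mono hab, H⟩

theorem refl : Computes A A y y 0 := ⟨_, CostLE.wiring id, fun _ _ h => h⟩

theorem trans (h : Computes A B y z a) (h' : Computes B C z u b) : Computes A C y u (a + b) := by
  obtain ⟨F, hF, H⟩ := h
  obtain ⟨G, hG, H'⟩ := h'
  exact ⟨_, hG.comp hF, fun ω x hx => H' ω _ (H ω x hx)⟩

theorem pair (h : Computes A B y z a) (h' : Computes A C y u b) :
    Computes A (B.prod C) y (fun ω => (z ω, u ω)) (a + b) := by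
  obtain ⟨F, hF, H⟩ := h
  obtain ⟨G, hG, H'⟩ := h'
  exact ⟨_, hF.sum hG, fun ω x hx => Prod.ext (H ω x hx) (H' ω x hx)⟩

theorem fst {y : Ω → (A.prod B).X} : Computes (A.prod B) A y (fun ω => (y ω).1) 0 :=
  ⟨_, CostLE.wiring Sum.inl, fun _ _ h => congrArg Prod.fst h⟩

theorem snd {y : Ω → (A.prod B).X} : Computes (A.prod B) B y (fun ω => (y ω).2) 0 :=
  ⟨_, CostLE.wiring Sum.inr, fun _ _ h => congrArg Prod.snd h⟩

theorem pi {τ : Type} [Fintype τ] {z : Ω → τ → B.X} {g : τ → ℕ}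
    (h : ∀ i, Computes A B y (fun ω => z ω i) (g i)) :
    Computes A (B.pow τ) y z (∑ i, g i) := by
  choose F hF H using h
  exact ⟨_, CostLE.sigma hF, fun ω x hx => funext fun i => H i ω x hx⟩

theorem pi_const {τ : Type} [Fintype τ] {z : Ω → τ → B.X} {g : ℕ}
    (h : ∀ i, Computes A B y (fun ω => z ω i) g) :
    Computes A (B.pow τ) y z (Fintype.card τ * g) :=
  (pi h).mono (by simp)

theorem proj {τ : Type} {y : Ω → (A.pow τ).X} (i : τ) :
    Computes (A.pow τ) A y (fun ω => y ω i) 0 :=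
  ⟨_, CostLE.wiring (fun k => (i, k)), fun _ _ h => congrFun h i⟩

/-- A circuit for a function computes that function of every argument. -/
theorem of_id {f : A.X → B.X} (h : Computes A B id f a) : Computes A B y (fun ω => f (y ω)) a := by
  obtain ⟨F, hF, H⟩ := h
  exact ⟨F, hF, fun ω x hx => (H _ x rfl).trans (congrArg f hx)⟩

theorem then_id {f : B.X → C.X} (h : Computes A B y z a) (h' : Computes B C id f b) :
    Computes A C y (fun ω => f (z ω)) (a + b) := h.trans h'.of_id

theorem congr {z' : Ω → B.X} (h : Computes A B y z a) (hz : ∀ ω, z ω = z' ω) :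
    Computes A B y z' a := by
  obtain rfl : z = z' := funext hz
  exact h

theorem const [Nonempty A.κ] (b : B.κ → Bool) : Computes A B y (fun _ => B.dec b) 2 :=
  ⟨_, CostLE.wiring_const (fun k => Sum.inr (b k)), fun _ _ _ => rfl⟩

end Computes

/-! ### Natural numbers in binary -/

theorem CostLE.op {ι κ κ' : Type} {F : (ι → Bool) → κ → Bool} {G : (ι → Bool) → κ' → Bool}
    {k : κ} {k' : κ'} {g h : ℕ}
    (o : Bool → Bool → Bool)
    (hF : CostLE F g) (hG : CostLE G h) :
    CostLE (fun x (_ : Unit) => o (F x k) (G x k')) (g + h + 1) :=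
  (CostLE.gate o (Sum.inl k) (Sum.inr k')).comp (hF.sum hG)

theorem Nat.ofBits_window {K : ℕ} (x : Fin K → Bool) (s m : ℕ) :
    Nat.ofBits (fun i : Fin m => if h : s + i < K then x ⟨s + i, h⟩ else false) =
      Nat.ofBits x / 2 ^ s % 2 ^ m := by
  apply Nat.eq_of_testBit_eq
  intro j
  rw [Nat.testBit_mod_two_pow, Nat.testBit_div_two_pow, Nat.testBit_ofBits, Nat.testBit_ofBits]
  by_cases hj : j < m <;> simp [hj, add_comm]

theorem Nat.ofBits_addCases {a b : ℕ} (x : Fin a → Bool) (y : Fin b → Bool) :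
    Nat.ofBits (fun i : Fin (a + b) => Fin.addCases (motive := fun _ => Bool) x y i) =
      Nat.ofBits x + 2 ^ a * Nat.ofBits y := by
  apply Nat.eq_of_testBit_eq
  intro j
  rw [add_comm (Nat.ofBits x), Nat.testBit_two_pow_mul_add _ (Nat.ofBits_lt_two_pow x),
    Nat.testBit_ofBits]
  by_cases hj : j < a
  · simp only [hj, if_true, Nat.testBit_ofBits_lt]
    rw [dif_pos (by omega)]
    exact Fin.addCases_left (motive := fun _ => Bool) (⟨j, hj⟩ : Fin a)
  · simp only [hj, if_false, Nat.testBit_ofBits]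
    by_cases hj' : j < a + b
    · rw [dif_pos hj', dif_pos (by omega)]
      have : (⟨j, hj'⟩ : Fin (a + b)) = Fin.natAdd a ⟨j - a, by omega⟩ := by
        ext; simp; omega
      rw [this]
      exact Fin.addCases_right (motive := fun _ => Bool) _
    · rw [dif_neg hj', dif_neg (by omega)]

theorem Nat.ofBits_not {n : ℕ} (x : Fin n → Bool) :
    Nat.ofBits (fun i => !x i) = 2 ^ n - 1 - Nat.ofBits x := by
  induction n with
  | zero => simp
  | succ n ih =>
    have h1 := Nat.ofBits_lt_two_pow (x ∘ Fin.succ)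
    have h2 := ih (x ∘ Fin.succ)
    rw [Nat.ofBits_succ, Nat.ofBits_succ x]
    have h3 : ((fun i => !x i) ∘ Fin.succ) = fun i => !(x ∘ Fin.succ) i := rfl
    rw [h3, h2, pow_succ]
    cases x 0 <;> simp <;> omega

theorem Nat.ofBits_eq_sum {n : ℕ} (x : Fin n → Bool) :
    Nat.ofBits x = ∑ i, (x i).toNat * 2 ^ (i : ℕ) := by
  induction n with
  | zero => simp
  | succ n ih =>
    rw [Nat.ofBits_succ, ih, Fin.sum_univ_succ, Finset.mul_sum, add_comm]
    simp only [Fin.val_zero, pow_zero, mul_one, Fin.val_succ, pow_succ, Function.comp]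
    congr 1
    exact Finset.sum_congr rfl fun i _ => by ring

theorem Nat.ofBits_false {n : ℕ} : Nat.ofBits (fun _ : Fin n => false) = 0 := by
  simp [Nat.ofBits_eq_sum]

/-- Natural numbers written with `m` bits. -/
abbrev Enc.nat (m : ℕ) : Enc := ⟨Fin m, ℕ, Nat.ofBits⟩

namespace Computes

variable {Ω : Type*} {A B C D : Enc} {y : Ω → A.X} {z : Ω → B.X} {a b : ℕ}

/-- Only values that possess a code matter, and a code of m bits bounds the number it represents.
Overflow conditions are discharged in this way. -/
theorem congr_of_dec {z' : Ω → B.X} (h : Computes A B y z a)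
    (hz : ∀ ω x, A.dec x = y ω → z ω = z' ω) : Computes A B y z' a := by
  obtain ⟨F, hF, H⟩ := h
  exact ⟨F, hF, fun ω x hx => (H ω x hx).trans (hz ω x hx)⟩

/-- Division by a power of two and reduction modulo one are selections of bits; the two gates supply
constants, of which zero pads beyond the end. -/
theorem natWindow {K : ℕ} [NeZero K] (s m : ℕ) :
    Computes (.nat K) (.nat m) id (fun x : ℕ => (x / 2 ^ s % 2 ^ m : ℕ)) 2 := by
  refine ⟨_, CostLE.wiring_const (κ := Fin m) (ι := Fin K)
    (fun i => if h : s + i < K then .inl ⟨s + i, h⟩ else .inr false), ?_⟩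
  rintro _ x rfl
  refine Eq.trans ?_ (Nat.ofBits_window x s m)
  refine congrArg Nat.ofBits (funext fun i => ?_)
  by_cases h : s + i < K <;> simp [h]

theorem natConcat {m k : ℕ} :
    Computes ((Enc.nat m).prod (.nat k)) (.nat (m + k)) id
      (fun p : ℕ × ℕ => (p.1 + 2 ^ m * p.2 : ℕ)) 0 := by
  refine ⟨_, CostLE.wiring (κ := Fin (m + k)) (ι := Fin m ⊕ Fin k)
    (fun i => Fin.addCases (motive := fun _ => Fin m ⊕ Fin k) .inl .inr i), ?_⟩
  rintro _ x rfl
  refine Eq.trans ?_ (Nat.ofBits_addCases (fun i => x (.inl i)) (fun i => x (.inr i)))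
  refine congrArg Nat.ofBits (funext fun i => ?_)
  refine Fin.addCases (fun i => ?_) (fun i => ?_) i <;> simp

theorem natNot {m : ℕ} :
    Computes (.nat m) (.nat m) id (fun x : ℕ => (2 ^ m - 1 - x : ℕ)) m := by
  have h := CostLE.sigma (fun i : Fin m => CostLE.gate (fun b _ => !b) i i)
  refine ⟨_, ((CostLE.wiring (fun i : Fin m => (i, ()))).comp h).mono (by simp), ?_⟩
  rintro _ x rfl
  exact Nat.ofBits_not x

theorem fullAdder :
    Computes ((Enc.nat 1).prod ((Enc.nat 1).prod (.nat 1))) (.nat 2) id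
      (fun p : ℕ × ℕ × ℕ => (p.1 + p.2.1 + p.2.2 : ℕ)) 7 := by
  let w : Fin 3 → Fin 1 ⊕ Fin 1 ⊕ Fin 1 := ![.inl 0, .inr (.inl 0), .inr (.inr 0)]
  have hw := CostLE.wiring w
  have h1 := CostLE.op (k := 0) (k' := 1) Bool.xor hw hw
  have h2 := CostLE.op (k := ()) (k' := 2) Bool.xor h1 hw
  have h3 := CostLE.op (k := ()) (k' := 2) Bool.and h1 hw
  have h4 := CostLE.op (k := 0) (k' := 1) Bool.and hw hw
  have h5 := CostLE.op (k := ()) (k' := ()) Bool.or h3 h4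
  have h6 := (CostLE.wiring (κ := Fin 2) ![Sum.inl (), Sum.inr ()]).comp (h2.sum h5)
  refine ⟨_, h6.mono (by norm_num), ?_⟩
  rintro _ x rfl
  simp only [Enc.nat, Enc.prod, w, Nat.ofBits_eq_sum, Fin.sum_univ_two, Fin.sum_univ_one]
  simp only [Matrix.cons_val_zero, Matrix.cons_val_one, Sum.elim_inl, Sum.elim_inr, Fin.val_zero,
    Fin.val_one, pow_zero, mul_one, pow_one, Matrix.cons_val]
  generalize x (.inl 0) = u
  generalize x (.inr (.inl 0)) = v
  generalize x (.inr (.inr 0)) = w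
  cases u <;> cases v <;> cases w <;> rfl

theorem natZero [Nonempty A.κ] (m : ℕ) : Computes A (.nat m) y (fun _ => (0 : ℕ)) 2 :=
  (const (B := .nat m) (fun _ : Fin m => false)).congr fun _ => Nat.ofBits_false

theorem natOne [Nonempty A.κ] : Computes A (.nat 1) y (fun _ => (1 : ℕ)) 2 :=
  (const (B := .nat 1) (fun _ : Fin 1 => true)).congr fun _ => rfl

/-- The ripple-carry adder. -/
theorem natAdd (w : ℕ) :
    Computes ((Enc.nat w).prod ((Enc.nat w).prod (.nat 1))) (.nat (w + 1)) id
      (fun p : ℕ × ℕ × ℕ => (p.1 + p.2.1 + p.2.2 : ℕ)) (20 * w) := by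
  induction w with
  | zero =>
    refine (snd.trans snd).congr_of_dec ?_
    rintro ω x rfl
    have h1 : Nat.ofBits (fun i : Fin 0 => x (.inl i)) = 0 := rfl
    have h2 : Nat.ofBits (fun i : Fin 0 => x (.inr (.inl i))) = 0 := rfl
    change _ = Nat.ofBits (fun i : Fin 0 => x (.inl i)) +
      Nat.ofBits (fun i : Fin 0 => x (.inr (.inl i))) + Nat.ofBits (fun i : Fin 1 => x (.inr (.inr i)))
    rw [h1, h2]
    simp
  | succ w ih =>
    let A := (Enc.nat (w + 1)).prod ((Enc.nat (w + 1)).prod (.nat 1))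
    have hx : Computes A (.nat (w + 1)) id (fun p : ℕ × ℕ × ℕ => p.1) 0 := fst
    have hy : Computes A (.nat (w + 1)) id (fun p : ℕ × ℕ × ℕ => p.2.1) 0 := snd.trans fst
    have hc : Computes A (.nat 1) id (fun p : ℕ × ℕ × ℕ => p.2.2) 0 := snd.trans snd
    -- The low w bits are added by the smaller adder; its top output bit is the carry that enters
    -- the full adder for the leading bits.
    have hS := ((hx.then_id (natWindow 0 w)).pair ((hy.then_id (natWindow 0 w)).pair hc)).then_id ih
    have hxy := (hx.then_id (natWindow w 1)).pair (hy.then_id (natWindow w 1))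
    have h1 := hS.pair hxy
    let B := (Enc.nat (w + 1)).prod ((Enc.nat 1).prod (.nat 1))
    have hs : Computes B (.nat (w + 1)) id (fun p : ℕ × ℕ × ℕ => p.1) 0 := fst
    have hx' : Computes B (.nat 1) id (fun p : ℕ × ℕ × ℕ => p.2.1) 0 := snd.trans fst
    have hy' : Computes B (.nat 1) id (fun p : ℕ × ℕ × ℕ => p.2.2) 0 := snd.trans snd
    have h2 := ((hs.then_id (natWindow 0 w)).pair
      ((hx'.pair (hy'.pair (hs.then_id (natWindow w 1)))).then_id fullAdder)).then_id natConcat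
    refine ((h1.then_id h2).mono (by omega)).congr_of_dec ?_
    rintro (⟨x, y, c⟩ : ℕ × ℕ × ℕ) b hb
    have hx1 : x < 2 ^ (w + 1) :=
      lt_of_eq_of_lt (congrArg Prod.fst hb).symm (Nat.ofBits_lt_two_pow _)
    have hy1 : y < 2 ^ (w + 1) :=
      lt_of_eq_of_lt (congrArg (·.2.1) hb).symm (Nat.ofBits_lt_two_pow _)
    have hc1 : c < 2 :=
      lt_of_eq_of_lt (congrArg (·.2.2) hb).symm
        (Nat.ofBits_lt_two_pow (fun i : Fin 1 => b (.inr (.inr i))))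
    simp only [pow_zero, Nat.div_one, pow_one]
    rw [pow_succ] at hx1 hy1
    have hx2 := Nat.div_add_mod x (2 ^ w)
    have hy2 := Nat.div_add_mod y (2 ^ w)
    have hx3 : x / 2 ^ w < 2 := Nat.div_lt_of_lt_mul hx1
    have hy3 : y / 2 ^ w < 2 := Nat.div_lt_of_lt_mul hy1
    have hxm := Nat.mod_lt x (y := 2 ^ w) (by positivity)
    have hym := Nat.mod_lt y (y := 2 ^ w) (by positivity)
    set s := x % 2 ^ w + y % 2 ^ w + c
    have hs2 := Nat.div_add_mod s (2 ^ w)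
    have hs3 : s / 2 ^ w < 2 := Nat.div_lt_of_lt_mul (by omega)
    rw [Nat.mod_eq_of_lt hx3, Nat.mod_eq_of_lt hy3, Nat.mod_eq_of_lt hs3]
    have : s = x % 2 ^ w + y % 2 ^ w + c := rfl
    simp only [mul_add]
    omega

end Computes

/-! ### Arithmetic modulo `2 ^ N + 1`

Residues are written redundantly with `2 N` bits, so that the multiplication by a power of two is a
rotation of the bits. -/

/-- The ring of integers modulo `2 ^ N + 1`. -/
abbrev Fermat (N : ℕ) : Type := ZMod (2 ^ N + 1)

theorem Fermat.two_pow_self (N : ℕ) : (2 : Fermat N) ^ N = -1 := by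
  have h : ((2 ^ N + 1 : ℕ) : Fermat N) = 0 := ZMod.natCast_self _
  push_cast at h
  exact eq_neg_of_add_eq_zero_left h

theorem Fermat.two_pow_two_mul (N : ℕ) : (2 : Fermat N) ^ (2 * N) = 1 := by
  rw [mul_comm, pow_mul, two_pow_self]; norm_num

/-- Residues modulo `2 ^ N + 1` written with `2 N` bits. -/
abbrev Enc.fermat (N : ℕ) : Enc := ⟨Fin (2 * N), Fermat N, fun x => (Nat.ofBits x : Fermat N)⟩

namespace Computes

variable {Ω : Type*} {A B C D : Enc} {y : Ω → A.X} {a b N : ℕ}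

theorem fermat_lift {f : Fermat N → B.X}
    (h : Computes (.nat (2 * N)) B id (fun x : ℕ => f (x : Fermat N)) a) :
    Computes (.fermat N) B id f a := by
  obtain ⟨F, hF, H⟩ := h
  refine ⟨F, hF, ?_⟩
  rintro _ x rfl
  exact H _ x rfl

theorem fermat_lift₂ {f : Fermat N × Fermat N → B.X}
    (h : Computes ((Enc.nat (2 * N)).prod (.nat (2 * N))) B id
      (fun p : ℕ × ℕ => f ((p.1 : Fermat N), (p.2 : Fermat N))) a) :
    Computes ((Enc.fermat N).prod (.fermat N)) B id f a := by
  obtain ⟨F, hF, H⟩ := h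
  refine ⟨F, hF, ?_⟩
  rintro _ x rfl
  exact H _ x rfl

theorem fermatOfNat : Computes (.nat (2 * N)) (.fermat N) id (fun x : ℕ => (x : Fermat N)) 0 := by
  refine ⟨_, CostLE.wiring id, ?_⟩
  rintro _ x rfl
  rfl

theorem fermatOfNat_le {m : ℕ} [NeZero m] (hm : m ≤ 2 * N) :
    Computes (.nat m) (.fermat N) id (fun x : ℕ => (x : Fermat N)) 2 := by
  refine ((natWindow 0 (2 * N)).then_id fermatOfNat).congr_of_dec ?_
  rintro _ x rfl
  have h1 : Nat.ofBits x < 2 ^ (2 * N) :=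
    (Nat.ofBits_lt_two_pow x).trans_le (Nat.pow_le_pow_right (by norm_num) hm)
  change ((Nat.ofBits x / 2 ^ 0 % 2 ^ (2 * N) : ℕ) : Fermat N) = (Nat.ofBits x : ℕ)
  rw [pow_zero, Nat.div_one, Nat.mod_eq_of_lt h1]

theorem fermatConst [Nonempty A.κ] [NeZero N] (c : Fermat N) :
    Computes A (.fermat N) y (fun _ => c) 2 := by
  refine (const (B := .fermat N) (fun i : Fin (2 * N) => c.val.testBit i)).congr fun _ => ?_
  have h1 : c.val < 2 ^ (2 * N) := by
    have h2 := ZMod.val_lt c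
    have h3 : 2 ≤ 2 ^ N := by
      calc 2 = 2 ^ 1 := rfl
        _ ≤ 2 ^ N := Nat.pow_le_pow_right (by norm_num) (NeZero.one_le)
    have : 2 ^ (2 * N) = 2 ^ N * 2 ^ N := by ring
    nlinarith
  simp only [Nat.ofBits_testBit, Nat.mod_eq_of_lt h1]
  simp

/-- Addition with end-around carry. -/
theorem fermatAdd [NeZero N] : Computes ((Enc.fermat N).prod (.fermat N)) (.fermat N) id
    (fun p : Fermat N × Fermat N => p.1 + p.2) (100 * N) := by
  apply fermat_lift₂
  have hN : 1 ≤ N := NeZero.one_le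
  let A := (Enc.nat (2 * N)).prod (.nat (2 * N))
  have hx : Computes A (.nat (2 * N)) id (fun p : ℕ × ℕ => p.1) 0 := fst
  have hy : Computes A (.nat (2 * N)) id (fun p : ℕ × ℕ => p.2) 0 := snd
  have h1 := (hx.pair (hy.pair (natZero 1))).then_id (natAdd (2 * N))
  have h2 := (((natWindow (K := 2 * N + 1) 0 (2 * N)).pair
    ((natZero (2 * N)).pair (natWindow (2 * N) 1))).then_id (natAdd (2 * N))).then_id
    (natWindow 0 (2 * N))
  refine (((h1.then_id h2).then_id fermatOfNat).mono (by omega)).congr_of_dec ?_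
  rintro (⟨x, y⟩ : ℕ × ℕ) b hb
  have hx1 : x < 2 ^ (2 * N) :=
    lt_of_eq_of_lt (congrArg Prod.fst hb).symm (Nat.ofBits_lt_two_pow (fun i : Fin (2 * N) => b (.inl i)))
  have hy1 : y < 2 ^ (2 * N) :=
    lt_of_eq_of_lt (congrArg Prod.snd hb).symm (Nat.ofBits_lt_two_pow (fun i : Fin (2 * N) => b (.inr i)))
  simp only [pow_zero, Nat.div_one, pow_one, add_zero]
  have h3 := Nat.div_add_mod (x + y) (2 ^ (2 * N))
  have h4 : (x + y) / 2 ^ (2 * N) < 2 := Nat.div_lt_of_lt_mul (by omega)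
  have h5 := Nat.mod_lt (x + y) (y := 2 ^ (2 * N)) (by positivity)
  rw [Nat.mod_eq_of_lt h4]
  -- The carry may be added back without a second overflow: if it is 1, the low part is at most
  -- 2^(2N) - 2.
  have h6 : (x + y) % 2 ^ (2 * N) + (x + y) / 2 ^ (2 * N) < 2 ^ (2 * N) := by
    rcases (Nat.le_one_iff_eq_zero_or_eq_one).mp (Nat.lt_succ_iff.mp h4) with h | h
    · rw [h]; omega
    · rw [h] at h3 ⊢; omega
  rw [Nat.mod_eq_of_lt h6]
  have h7 := congrArg (Nat.cast : ℕ → Fermat N) h3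
  push_cast [Fermat.two_pow_two_mul] at h7 ⊢
  rw [← h7]; ring

/-- Multiplication by a power of two is free. -/
theorem fermatShift [NeZero N] (e : ℕ) :
    Computes (.fermat N) (.fermat N) id (fun x : Fermat N => 2 ^ e * x) 0 := by
  have : NeZero (2 * N) := ⟨by have := NeZero.ne N; omega⟩
  refine ⟨_, CostLE.wiring (ι := Fin (2 * N)) (κ := Fin (2 * N))
    (fun i => i - Fin.ofNat (2 * N) e), ?_⟩
  rintro _ x rfl
  simp only [Nat.ofBits_eq_sum]
  push_cast
  rw [Finset.mul_sum, ← Equiv.sum_comp (Equiv.addRight (Fin.ofNat (2 * N) e))]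
  refine Finset.sum_congr rfl fun i _ => ?_
  simp only [Equiv.coe_addRight, add_sub_cancel_right]
  -- The wrap-around of the rotation is invisible because 2^(2N) = 1.
  have h1 : (2 : Fermat N) ^ ((i + Fin.ofNat (2 * N) e : Fin (2 * N)) : ℕ) = 2 ^ (i + e : ℕ) := by
    rw [Fin.val_add]
    simp only [Fin.ofNat, Nat.add_mod_mod]
    conv_rhs => rw [← Nat.div_add_mod (i + e) (2 * N), pow_add, pow_mul, Fermat.two_pow_two_mul,
      one_pow, one_mul]
  rw [h1, pow_add]; ring

theorem fermatNeg [NeZero N] : Computes (.fermat N) (.fermat N) id (fun x : Fermat N => -x) 0 :=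
  (fermatShift N).congr fun x => by rw [Fermat.two_pow_self]; simp

theorem fermat_add [NeZero N] {z z' : Ω → Fermat N} (h : Computes A (.fermat N) y z a)
    (h' : Computes A (.fermat N) y z' b) :
    Computes A (.fermat N) y (fun ω => z ω + z' ω) (a + b + 100 * N) :=
  (h.pair h').then_id fermatAdd

theorem fermat_sub [NeZero N] {z z' : Ω → Fermat N} (h : Computes A (.fermat N) y z a)
    (h' : Computes A (.fermat N) y z' b) :
    Computes A (.fermat N) y (fun ω => z ω - z' ω) (a + b + 100 * N) :=
  (h.fermat_add (h'.then_id fermatNeg)).congr fun ω => by ring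

theorem fermat_sum [NeZero N] [Nonempty A.κ] {τ : Type*} (s : Finset τ) {z : τ → Ω → Fermat N}
    {g : ℕ} (h : ∀ i ∈ s, Computes A (.fermat N) y (z i) g) :
    Computes A (.fermat N) y (fun ω => ∑ i ∈ s, z i ω) (s.card * (g + 100 * N) + 2) := by
  classical
  induction s using Finset.induction_on with
  | empty => simpa using fermatConst 0
  | insert i s hi ih =>
    have h1 := (h i (Finset.mem_insert_self i s)).fermat_add
      (ih fun j hj => h j (Finset.mem_insert_of_mem hj))
    refine (h1.mono ?_).congr fun ω => (Finset.sum_insert (f := fun j => z j ω) hi).symm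
    rw [Finset.card_insert_of_notMem hi]
    ring_nf; omega

/-- The low bits of the least non-negative residue. -/
theorem fermatCanon [NeZero N] :
    Computes (.fermat N) (.nat N) id (fun x : Fermat N => (x.val % 2 ^ N : ℕ)) (100 * N) := by
  apply fermat_lift
  have hN : 1 ≤ N := NeZero.one_le
  have : NeZero (2 * N) := ⟨by omega⟩
  -- The residue of hi·2^N + lo is lo - hi, plus 2^N + 1 if this is negative. Adding lo, the
  -- complement of hi and 1 gives lo - hi + 2^N, whose top bit says that no borrow occurred; the
  -- negation of that bit is the missing 1.
  have h1 := ((natWindow (K := 2 * N) 0 N).pair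
    (((natWindow N N).then_id natNot).pair natOne)).then_id (natAdd N)
  have h2 := (((natWindow (K := N + 1) 0 N).pair ((natZero N).pair
    ((natWindow N 1).then_id natNot))).then_id (natAdd N)).then_id (natWindow 0 N)
  refine ((h1.then_id h2).mono (by omega)).congr_of_dec ?_
  intro (x : ℕ) b hb
  have hx1 : x < 2 ^ (2 * N) := lt_of_eq_of_lt hb.symm (Nat.ofBits_lt_two_pow _)
  simp only [pow_zero, Nat.div_one, pow_one, add_zero, ZMod.val_natCast]
  have h3 := Nat.div_add_mod x (2 ^ N)
  rw [two_mul, pow_add] at hx1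
  have h4 : x / 2 ^ N < 2 ^ N := Nat.div_lt_of_lt_mul hx1
  have h5 := Nat.mod_lt x (y := 2 ^ N) (by positivity)
  rw [Nat.mod_eq_of_lt h4]
  generalize x / 2 ^ N = hi at *
  generalize x % 2 ^ N = lo at *
  obtain rfl := h3
  generalize 2 ^ N = M at *
  by_cases hlt : hi ≤ lo
  · have e1 : lo + (M - 1 - hi) + 1 = (lo - hi) + M := by omega
    have e2 : M * hi + lo = (lo - hi) + (M + 1) * hi := by
      rw [add_mul, one_mul]; omega
    rw [e1, e2, Nat.add_mod_right, Nat.add_div_right _ (by omega),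
      Nat.div_eq_of_lt (show lo - hi < M by omega), Nat.add_mul_mod_self_left,
      Nat.mod_eq_of_lt (show lo - hi < M + 1 by omega)]
    simp
  · have e1 : lo + (M - 1 - hi) + 1 = M - (hi - lo) := by omega
    have e2 : M * hi + lo = (M + 1 - (hi - lo)) + (M + 1) * (hi - 1) := by
      obtain ⟨d, rfl⟩ : ∃ d, hi = d + 1 := ⟨hi - 1, by omega⟩
      rw [Nat.add_sub_cancel, add_mul, one_mul, mul_add]; omega
    rw [e1, e2, Nat.add_mul_mod_self_left, Nat.mod_eq_of_lt (show M + 1 - (hi - lo) < M + 1 by omega),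
      Nat.div_eq_of_lt (show M - (hi - lo) < M by omega),
      Nat.mod_eq_of_lt (show M - (hi - lo) < M by omega)]
    simp only [Nat.zero_mod]
    congr 1
    omega

end Computes

/-! ### Multiplication of residues by blocks -/

theorem Nat.sum_blocks (M c x : ℕ) (hx : x < 2 ^ (M * c)) :
    ∑ i ∈ Finset.range c, 2 ^ (M * i) * (x / 2 ^ (M * i) % 2 ^ M) = x := by
  have key : ∀ c, ∑ i ∈ Finset.range c, 2 ^ (M * i) * (x / 2 ^ (M * i) % 2 ^ M) =
      x % 2 ^ (M * c) := by
    intro c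
    induction c with
    | zero => simp [Nat.mod_one]
    | succ c ih => rw [Finset.sum_range_succ, ih, mul_add, mul_one, pow_add, Nat.mod_mul]
  rw [key, Nat.mod_eq_of_lt hx]

namespace Computes

variable {N : ℕ}

/-- Multiplication modulo `2 ^ N + 1` by splitting the factors into blocks of `M` bits. -/
theorem fermatMul_of_blocks [NeZero N] {M c g : ℕ} [NeZero M] (hMN : M ≤ N) (hc : 2 * N ≤ M * c)
    (h : Computes ((Enc.nat M).prod (.nat M)) (.nat (2 * M)) id
      (fun p : ℕ × ℕ => (p.1 * p.2 : ℕ)) g) :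
    Computes ((Enc.fermat N).prod (.fermat N)) (.fermat N) id
      (fun p : Fermat N × Fermat N => p.1 * p.2) (c * c * (g + 6 + 100 * N) + 2) := by
  apply fermat_lift₂
  have : NeZero (2 * N) := ⟨by have := NeZero.ne N; omega⟩
  have : NeZero (2 * M) := ⟨by have := NeZero.ne M; omega⟩
  let A := (Enc.nat (2 * N)).prod (.nat (2 * N))
  have hx : Computes A (.nat (2 * N)) id (fun p : ℕ × ℕ => p.1) 0 := fst
  have hy : Computes A (.nat (2 * N)) id (fun p : ℕ × ℕ => p.2) 0 := snd
  -- A product of two blocks has 2M ≤ 2N bits, hence is a residue as it stands, and its place value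
  -- is a free rotation.
  have h1 := fun ij : ℕ × ℕ => (((((hx.then_id (natWindow (M * ij.1) M)).pair
    (hy.then_id (natWindow (M * ij.2) M))).then_id h).then_id
    (fermatOfNat_le (N := N) (by omega))).then_id (fermatShift (M * ij.1 + M * ij.2)))
  have h2 := fermat_sum (Finset.range c ×ˢ Finset.range c) fun i _ => h1 i
  refine (h2.mono (le_of_eq ?_)).congr_of_dec ?_
  · rw [Finset.card_product, Finset.card_range]; ring
  rintro (⟨x, y⟩ : ℕ × ℕ) b hb
  have hx1 : x < 2 ^ (M * c) := (lt_of_eq_of_lt (congrArg Prod.fst hb).symm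
    (Nat.ofBits_lt_two_pow (fun i : Fin (2 * N) => b (.inl i)))).trans_le
    (Nat.pow_le_pow_right (by norm_num) hc)
  have hy1 : y < 2 ^ (M * c) := (lt_of_eq_of_lt (congrArg Prod.snd hb).symm
    (Nat.ofBits_lt_two_pow (fun i : Fin (2 * N) => b (.inr i)))).trans_le
    (Nat.pow_le_pow_right (by norm_num) hc)
  dsimp only
  conv_rhs => rw [← Nat.sum_blocks M c x hx1, ← Nat.sum_blocks M c y hy1]
  rw [Finset.sum_product]
  push_cast
  rw [Finset.sum_mul_sum]
  refine Finset.sum_congr rfl fun i _ => Finset.sum_congr rfl fun j _ => ?_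
  rw [pow_add]; ring

end Computes

/-! ### Products of polynomials modulo `X ^ m - 2 ^ e` -/

/-- The polynomial with a given list of coefficients. -/
noncomputable def vecPoly {R : Type*} [CommRing R] {m : ℕ} (v : Fin m → R) : R[X] :=
  ∑ i, C (v i) * X ^ (i : ℕ)

theorem coeff_vecPoly {R : Type*} [CommRing R] {m : ℕ} (v : Fin m → R) (j : ℕ) :
    (vecPoly v).coeff j = if h : j < m then v ⟨j, h⟩ else 0 := by
  simp only [vecPoly, finsetSum_coeff, coeff_C_mul_X_pow]
  split_ifs with h
  · rw [Finset.sum_eq_single ⟨j, h⟩]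
    · simp
    · intro b _ hb
      rw [if_neg]
      rintro rfl
      exact hb rfl
    · simp
  · refine Finset.sum_eq_zero fun i _ => if_neg ?_
    have := i.2
    omega

theorem degree_vecPoly_lt {R : Type*} [CommRing R] {m : ℕ} (v : Fin m → R) :
    (vecPoly v).degree < m := by
  rw [degree_lt_iff_coeff_zero]
  intro j hj
  rw [coeff_vecPoly, dif_neg (by omega)]

theorem vecPoly_coeff {R : Type*} [CommRing R] {m : ℕ} {f : R[X]} (hf : f.degree < m) :
    vecPoly (fun i : Fin m => f.coeff i) = f := by
  ext j
  rw [coeff_vecPoly]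
  split_ifs with h
  · rfl
  · exact ((degree_lt_iff_coeff_zero _ _).mp hf j (by omega)).symm

/-- Products of polynomials modulo `X ^ m - 2 ^ e` over the integers modulo `2 ^ N + 1` can be
computed with at most `g` gates. -/
def MulModCost (N m e g : ℕ) : Prop :=
  ∃ f : (Fin m → Fermat N) × (Fin m → Fermat N) → Fin m → Fermat N,
    Computes (((Enc.fermat N).pow (Fin m)).prod ((Enc.fermat N).pow (Fin m)))
      ((Enc.fermat N).pow (Fin m)) id f g ∧
    ∀ u v, (X ^ m - C (2 ^ e : Fermat N)) ∣ vecPoly u * vecPoly v - vecPoly (f (u, v))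

theorem MulModCost.one {N e g : ℕ}
    (h : Computes ((Enc.fermat N).prod (.fermat N)) (.fermat N) id
      (fun p : Fermat N × Fermat N => p.1 * p.2) g) : MulModCost N 1 e g := by
  refine ⟨fun p _ => p.1 0 * p.2 0, ?_, fun u v => ?_⟩
  · exact (Computes.pi_const (τ := Fin 1) fun i =>
      ((Computes.fst.trans (Computes.proj 0)).pair
        (Computes.snd.trans (Computes.proj 0))).then_id h).mono (by simp)
  · simp [vecPoly]

theorem vecPoly_split {R : Type*} [CommRing R] {m : ℕ} (u : Fin (m + m) → R) : vecPoly u =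
    vecPoly (fun i => u (Fin.castAdd m i)) + X ^ m * vecPoly (fun i => u (Fin.natAdd m i)) := by
  simp only [vecPoly, Fin.sum_univ_add, Fin.val_castAdd, Fin.val_natAdd, pow_add]
  rw [Finset.mul_sum]
  congr 1
  exact Finset.sum_congr rfl fun i _ => by ring

theorem vecPoly_add_mul {R : Type*} [CommRing R] {m : ℕ} (u v : Fin m → R) (a : R) :
    vecPoly (fun i => u i + a * v i) = vecPoly u + C a * vecPoly v := by
  simp only [vecPoly, C_add, C_mul, add_mul, Finset.sum_add_distrib, Finset.mul_sum, mul_assoc]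

theorem vecPoly_mul_add {R : Type*} [CommRing R] {m : ℕ} (u v : Fin m → R) (a : R) :
    vecPoly (fun i => a * (u i + v i)) = C a * (vecPoly u + vecPoly v) := by
  simp only [vecPoly, C_add, C_mul]
  rw [← Finset.sum_add_distrib, Finset.mul_sum]
  exact Finset.sum_congr rfl fun i _ => by ring

theorem vecPoly_mul_sub {R : Type*} [CommRing R] {m : ℕ} (u v : Fin m → R) (a : R) :
    vecPoly (fun i => a * (u i - v i)) = C a * (vecPoly u - vecPoly v) := by
  simp only [vecPoly, C_sub, C_mul]
  rw [← Finset.sum_sub_distrib, Finset.mul_sum]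
  exact Finset.sum_congr rfl fun i _ => by ring

/-- Recombination of the products modulo `X ^ m - a` and modulo `X ^ m + a`. -/
theorem vecPoly_recombine {R : Type*} [CommRing R] {m : ℕ} {a hlf c : R} (hh : hlf * 2 = 1)
    (hca : c * a = hlf) (u v : Fin (m + m) → R) (F G : Fin m → R)
    (hF : X ^ m - C a ∣ vecPoly (fun i => u (Fin.castAdd m i) + a * u (Fin.natAdd m i)) *
      vecPoly (fun i => v (Fin.castAdd m i) + a * v (Fin.natAdd m i)) - vecPoly F)
    (hG : X ^ m - C (-a) ∣ vecPoly (fun i => u (Fin.castAdd m i) + -a * u (Fin.natAdd m i)) *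
      vecPoly (fun i => v (Fin.castAdd m i) + -a * v (Fin.natAdd m i)) - vecPoly G) :
    X ^ (m + m) - C (a * a) ∣ vecPoly u * vecPoly v - vecPoly
      (fun i => Fin.addCases (motive := fun _ => R) (fun i => hlf * (F i + G i))
        (fun i => c * (F i - G i)) i) := by
  obtain ⟨k, hk⟩ := hF
  obtain ⟨k', hk'⟩ := hG
  rw [vecPoly_add_mul, vecPoly_add_mul] at hk hk'
  rw [vecPoly_split u, vecPoly_split v,
    vecPoly_split (fun i => Fin.addCases (motive := fun _ => R) _ _ i)]
  simp only [Fin.addCases_left, Fin.addCases_right]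
  rw [vecPoly_mul_add, vecPoly_mul_sub]
  rw [C_neg, sub_neg_eq_add] at hk'
  have hCh : C hlf * 2 = (1 : R[X]) := by
    rw [← C_1, ← hh, C_mul]; rfl
  have hCc : C c * C a = (C hlf : R[X]) := by rw [← C_mul, hca]
  generalize vecPoly (fun i => u (Fin.castAdd m i)) = U0 at *
  generalize vecPoly (fun i => u (Fin.natAdd m i)) = U1 at *
  generalize vecPoly (fun i => v (Fin.castAdd m i)) = V0 at *
  generalize vecPoly (fun i => v (Fin.natAdd m i)) = V1 at *
  generalize vecPoly F = F at *
  generalize vecPoly G = G at *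
  have hfac : (X ^ (m + m) - C (a * a) : R[X]) = (X ^ m - C a) * (X ^ m + C a) := by
    rw [pow_add, C_mul]; ring
  -- Chinese remaindering: the difference of the two moduli is 2a, a unit with inverse c.
  have hcop : IsCoprime (X ^ m - C a : R[X]) (X ^ m + C a) :=
    ⟨-C c, C c, by linear_combination 2 * hCc + hCh⟩
  rw [hfac]
  refine hcop.mul_dvd ⟨k + U1 * V0 + U0 * V1 + (X ^ m + C a) * U1 * V1 - C c * (F - G), ?_⟩
    ⟨k' + U1 * V0 + U0 * V1 + (X ^ m - C a) * U1 * V1 - C c * (F - G), ?_⟩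
  · linear_combination hk - F * hCh - (F - G) * hCc
  · linear_combination hk' - G * hCh + (F - G) * hCc

theorem MulModCost.double {N m e g g' : ℕ} [NeZero N] (h : MulModCost N m e g)
    (h' : MulModCost N m (e + N) g') : MulModCost N (m + m) (2 * e) (g + g' + 600 * m * N) := by
  obtain ⟨f, hf, H⟩ := h
  obtain ⟨f', hf', H'⟩ := h'
  let R := Fermat N
  let V := (Enc.fermat N).pow (Fin m)
  let V2 := (Enc.fermat N).pow (Fin (m + m))
  -- Both 1/2 and 1/(2·2^e) are powers of two modulo 2^N + 1, so the recombination needs only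
  -- additions and rotations. Likewise -2^e is 2^(e+N), so both factors have the same shape.
  let hlf : R := 2 ^ (2 * N - 1)
  let c : R := 2 ^ ((2 * N - 1) * (e + 1))
  have hN : 1 ≤ N := NeZero.one_le
  have hh : hlf * 2 = 1 := by
    rw [← Fermat.two_pow_two_mul N, ← pow_succ]; congr 1; omega
  have hca : c * 2 ^ e = hlf := by
    change 2 ^ ((2 * N - 1) * (e + 1)) * 2 ^ e = hlf
    rw [pow_mul, pow_succ, mul_right_comm, ← mul_pow]
    change (hlf * 2) ^ e * hlf = hlf
    rw [hh]; simp
  have he : (2 : R) ^ (e + N) = -2 ^ e := by rw [pow_add, Fermat.two_pow_self]; ring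
  let P : (Fin (m + m) → R) → Fin m → R := fun u i => u (Fin.castAdd m i) + 2 ^ e * u (Fin.natAdd m i)
  let Q : (Fin (m + m) → R) → Fin m → R := fun u i =>
    u (Fin.castAdd m i) + 2 ^ (e + N) * u (Fin.natAdd m i)
  have hP : Computes V2 V id P (m * (100 * N)) :=
    (Computes.pi_const (τ := Fin m) (fun i => ((Computes.proj _).fermat_add
      ((Computes.proj _).then_id (Computes.fermatShift e))))).mono (by simp)
  have hQ : Computes V2 V id Q (m * (100 * N)) :=
    (Computes.pi_const (τ := Fin m) (fun i => ((Computes.proj _).fermat_add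
      ((Computes.proj _).then_id (Computes.fermatShift (e + N)))))).mono (by simp)
  let comb : (Fin m → R) × (Fin m → R) → Fin (m + m) → R := fun p i =>
    Fin.addCases (motive := fun _ => R) (fun i => hlf * (p.1 i + p.2 i))
      (fun i => c * (p.1 i - p.2 i)) i
  have hcomb : Computes (V.prod V) V2 id comb (2 * m * (100 * N)) := by
    refine (Computes.pi_const (τ := Fin (m + m)) (g := 100 * N) ?_).mono (by simp; ring_nf; rfl)
    intro i
    have h1 : ∀ i : Fin m, Computes (V.prod V) (.fermat N) id
      (fun p : (Fin m → R) × (Fin m → R) => p.1 i) 0 := fun i => Computes.fst.trans (Computes.proj i)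
    have h2 : ∀ i : Fin m, Computes (V.prod V) (.fermat N) id
      (fun p : (Fin m → R) × (Fin m → R) => p.2 i) 0 := fun i => Computes.snd.trans (Computes.proj i)
    refine Fin.addCases (fun i => ?_) (fun i => ?_) i
    · refine ((((h1 i).fermat_add (h2 i)).then_id
        (Computes.fermatShift (2 * N - 1))).mono (by omega)).congr fun p => ?_
      simp only [comb, Fin.addCases_left]; rfl
    · refine ((((h1 i).fermat_sub (h2 i)).then_id
        (Computes.fermatShift ((2 * N - 1) * (e + 1)))).mono (by omega)).congr fun p => ?_
      simp only [comb, Fin.addCases_right]; rfl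
  refine ⟨fun p => comb (f (P p.1, P p.2), f' (Q p.1, Q p.2)), ?_, fun u v => ?_⟩
  · have h1 : Computes (V2.prod V2) V2 id (fun p : (Fin (m + m) → R) × (Fin (m + m) → R) => p.1) 0 :=
      Computes.fst
    have h2 : Computes (V2.prod V2) V2 id (fun p : (Fin (m + m) → R) × (Fin (m + m) → R) => p.2) 0 :=
      Computes.snd
    refine (((((h1.then_id hP).pair (h2.then_id hP)).then_id hf).pair
      (((h1.then_id hQ).pair (h2.then_id hQ)).then_id hf')).then_id hcomb).mono (le_of_eq ?_)
    ring
  · have h1 := H (P u) (P v)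
    have h2 := H' (Q u) (Q v)
    simp only [Q, he] at h2
    have h3 := vecPoly_recombine hh hca u v _ _ h1 h2
    rw [two_mul, pow_add (2 : Fermat N)]
    simp only [comb, Q, he]
    exact h3

/-- The exponent e is halved k times, giving e/2 and e/2 + N at each level; divisibility of e and N
by 2^k keeps all these exponents integral. Each of the k levels costs 300·2^k·N gates, and 2^k
products of residues remain at the end. -/
theorem MulModCost.two_pow {N g : ℕ} [NeZero N]
    (h : Computes ((Enc.fermat N).prod (.fermat N)) (.fermat N) id
      (fun p : Fermat N × Fermat N => p.1 * p.2) g) (k : ℕ) (hk : 2 ^ k ∣ N) :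
    ∀ e, 2 ^ k ∣ e → MulModCost N (2 ^ k) e (2 ^ k * (g + 300 * k * N)) := by
  induction k with
  | zero =>
    intro e _
    simpa using MulModCost.one h
  | succ k ih =>
    rintro e ⟨d, rfl⟩
    have hk' : 2 ^ k ∣ N := (pow_dvd_pow 2 (Nat.le_succ k)).trans hk
    have h1 := ih hk' (2 ^ k * d) (dvd_mul_right _ _)
    have h2 := ih hk' (2 ^ k * d + N) (dvd_add (dvd_mul_right _ _) hk')
    have h3 := h1.double h2
    have e1 : 2 ^ (k + 1) = 2 ^ k + 2 ^ k := by ring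
    have e2 : 2 ^ (k + 1) * d = 2 * (2 ^ k * d) := by ring
    have e3 : 2 ^ (k + 1) * (g + 300 * (k + 1) * N) = 2 ^ k * (g + 300 * k * N) +
      2 ^ k * (g + 300 * k * N) + 600 * 2 ^ k * N := by ring
    rw [e2, e3, e1]
    exact h3

/-- Products of polynomials of degree less than `2 ^ k` in total. -/
theorem Computes.fermatPolyMul {N g k : ℕ} [NeZero N]
    (h : Computes ((Enc.fermat N).prod (.fermat N)) (.fermat N) id
      (fun p : Fermat N × Fermat N => p.1 * p.2) g) (hk : 2 ^ k ∣ N) {Ω : Type*}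
    {u v : Ω → (Fermat N)[X]} (huv : ∀ ω, (u ω * v ω).degree < (2 ^ k : ℕ))
    (hu : ∀ ω, (u ω).degree < (2 ^ k : ℕ)) (hv : ∀ ω, (v ω).degree < (2 ^ k : ℕ)) :
    Computes (((Enc.fermat N).pow (Fin (2 ^ k))).prod ((Enc.fermat N).pow (Fin (2 ^ k))))
      ((Enc.fermat N).pow (Fin (2 ^ k)))
      (fun ω => (fun i => (u ω).coeff i, fun i => (v ω).coeff i))
      (fun ω i => (u ω * v ω).coeff i) (2 ^ k * (g + 300 * k * N)) := by
  obtain ⟨f, hf, H⟩ := MulModCost.two_pow h k hk 0 (dvd_zero _)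
  refine hf.of_id.congr fun ω => ?_
  have h1 := H (fun i => (u ω).coeff i) (fun i => (v ω).coeff i)
  rw [vecPoly_coeff (hu ω), vecPoly_coeff (hv ω)] at h1
  set w := f (fun i => (u ω).coeff i, fun i => (v ω).coeff i)
  have : Nontrivial (Fermat N) := ZMod.nontrivial_iff.mpr (by simp)
  -- The modulus is X^(2^k) - 1, and both polynomials have smaller degree, so congruence is
  -- equality.
  have h2 : u ω * v ω - vecPoly w = 0 := by
    have hm : (X ^ 2 ^ k - C (2 ^ 0 : Fermat N)).Monic := monic_X_pow_sub_C _ (by positivity)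
    by_contra hne
    have h3 := hm.not_dvd_of_degree_lt hne ?_
    · exact h3 h1
    · rw [degree_X_pow_sub_C (by positivity)]
      exact (degree_sub_le _ _).trans_lt (max_lt (huv ω) (degree_vecPoly_lt w))
  funext i
  rw [sub_eq_zero.mp h2, coeff_vecPoly]
  simp

/-! ### The cost of integer multiplication -/

/-- Integers with `m` bits can be multiplied with at most `g` gates. -/
def MulCircuit (m g : ℕ) : Prop :=
  Computes ((Enc.nat m).prod (.nat m)) (.nat (2 * m)) id (fun p : ℕ × ℕ => (p.1 * p.2 : ℕ)) g

theorem lt_of_dec_nat_prod {m k : ℕ} {x : Fin m ⊕ Fin k → Bool} {p : ℕ × ℕ}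
    (h : ((Enc.nat m).prod (.nat k)).dec x = id p) : p.1 < 2 ^ m ∧ p.2 < 2 ^ k := by
  subst h
  exact ⟨Nat.ofBits_lt_two_pow _, Nat.ofBits_lt_two_pow _⟩

theorem MulCircuit.of_mulBits {m g : ℕ} (h : ComputableWithGates (mulBits m) g) :
    MulCircuit m g := by
  refine ⟨mulBits m, ⟨g, le_rfl, h⟩, ?_⟩
  rintro _ x rfl
  change Nat.ofBits (fun k : Fin (2 * m) => Nat.testBit _ k) = _
  rw [Nat.ofBits_testBit]
  refine Nat.mod_eq_of_lt ?_
  rw [two_mul, pow_add]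
  exact Nat.mul_lt_mul'' (Nat.ofBits_lt_two_pow _) (Nat.ofBits_lt_two_pow _)

theorem MulCircuit.exists_mulBits {m g : ℕ} (h : MulCircuit m g) :
    ∃ g' ≤ g, ComputableWithGates (mulBits m) g' := by
  obtain ⟨F, hF, H⟩ := h
  have : F = mulBits m := by
    funext x k
    have h1 : Nat.ofBits (F x) = _ := H _ x rfl
    have h2 := Nat.testBit_ofBits_lt (F x) k k.2
    rw [h1] at h2
    exact h2.symm
  rwa [this] at hF

theorem MulCircuit.mulCost_le {m g : ℕ} (h : MulCircuit m g) : mulCost m ≤ g := by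
  obtain ⟨g', hg', h'⟩ := h.exists_mulBits
  exact (Nat.sInf_le h').trans hg'

theorem MulCircuit.of_le {m m' g : ℕ} [NeZero m] (hm : m ≤ m') (h : MulCircuit m' g) :
    MulCircuit m (g + 6) := by
  have : NeZero m' := ⟨by have := NeZero.ne m; omega⟩
  have : NeZero (2 * m') := ⟨by have := NeZero.ne m; omega⟩
  let A := (Enc.nat m).prod (.nat m)
  have hx : Computes A (.nat m) id (fun p : ℕ × ℕ => p.1) 0 := Computes.fst
  have hy : Computes A (.nat m) id (fun p : ℕ × ℕ => p.2) 0 := Computes.snd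
  refine ((((((hx.then_id (Computes.natWindow 0 m')).pair
    (hy.then_id (Computes.natWindow 0 m'))).then_id h).then_id
    (Computes.natWindow 0 (2 * m)))).mono (by omega)).congr_of_dec ?_
  rintro (⟨x, y⟩ : ℕ × ℕ) b hb
  obtain ⟨hx1, hy1⟩ := lt_of_dec_nat_prod hb
  have hmm : 2 ^ m ≤ 2 ^ m' := Nat.pow_le_pow_right (by norm_num) hm
  have h1 : x * y < 2 ^ (2 * m) := by
    rw [two_mul, pow_add]
    exact Nat.mul_lt_mul'' hx1 hy1
  dsimp only at hx1 hy1 ⊢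
  rw [pow_zero, Nat.div_one, Nat.div_one, Nat.div_one, Nat.mod_eq_of_lt (hx1.trans_le hmm),
    Nat.mod_eq_of_lt (hy1.trans_le hmm), Nat.mod_eq_of_lt h1]

theorem Fermat.val_natCast_mod {N x : ℕ} (hx : x < 2 ^ N) : (x : Fermat N).val % 2 ^ N = x := by
  rw [ZMod.val_natCast, Nat.mod_eq_of_lt (hx.trans (Nat.lt_succ_self _)), Nat.mod_eq_of_lt hx]

theorem MulCircuit.one : MulCircuit 1 20 := by
  let A := (Enc.nat 1).prod (.nat 1)
  have hx : Computes A (.nat 1) id (fun p : ℕ × ℕ => p.1) 0 := Computes.fst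
  have hy : Computes A (.nat 1) id (fun p : ℕ × ℕ => p.2) 0 := Computes.snd
  refine ((((hx.pair (hy.pair (Computes.natZero 1))).then_id Computes.fullAdder).then_id
    (Computes.natWindow 1 2)).mono (by omega)).congr_of_dec ?_
  rintro (⟨x, y⟩ : ℕ × ℕ) b hb
  obtain ⟨hx1, hy1⟩ := lt_of_dec_nat_prod hb
  dsimp only at hx1 hy1 ⊢
  interval_cases x <;> interval_cases y <;> rfl

/-- Schoolbook multiplication, by blocks of a single bit. It makes the infimum in `mulCost` an
attained minimum and starts the fast recursion. -/
theorem MulCircuit.exists (m : ℕ) : ∃ g, MulCircuit m g := by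
  rcases Nat.eq_zero_or_pos m with rfl | hm
  · refine ⟨0, (Computes.fst (A := .nat 0) (B := .nat 0)).congr_of_dec ?_⟩
    rintro (⟨x, y⟩ : ℕ × ℕ) b hb
    obtain ⟨hx1, hy1⟩ := lt_of_dec_nat_prod hb
    dsimp only at hx1 hy1 ⊢
    interval_cases x
    simp
  have : NeZero m := ⟨hm.ne'⟩
  have : NeZero (2 * m) := ⟨by omega⟩
  have h1 := Computes.fermatMul_of_blocks (N := 2 * m) (M := 1) (c := 2 * (2 * m)) (by omega)
    (by omega) MulCircuit.one
  let A := (Enc.nat m).prod (.nat m)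
  have hx : Computes A (.nat m) id (fun p : ℕ × ℕ => p.1) 0 := Computes.fst
  have hy : Computes A (.nat m) id (fun p : ℕ × ℕ => p.2) 0 := Computes.snd
  refine ⟨_, ((((hx.then_id (Computes.fermatOfNat_le (by omega))).pair
    (hy.then_id (Computes.fermatOfNat_le (by omega)))).then_id h1).then_id
    Computes.fermatCanon).congr_of_dec ?_⟩
  rintro (⟨x, y⟩ : ℕ × ℕ) b hb
  obtain ⟨hx1, hy1⟩ := lt_of_dec_nat_prod hb
  have h1 : x * y < 2 ^ (2 * m) := by
    rw [two_mul, pow_add]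
    exact Nat.mul_lt_mul'' hx1 hy1
  dsimp only at hx1 hy1 ⊢
  rw [← Nat.cast_mul, Fermat.val_natCast_mod h1]

theorem mulCost_spec (m : ℕ) : ComputableWithGates (mulBits m) (mulCost m) := by
  obtain ⟨g, hg⟩ := MulCircuit.exists m
  obtain ⟨g', -, h⟩ := hg.exists_mulBits
  exact Nat.sInf_mem (s := {g : ℕ | ComputableWithGates (mulBits m) g}) ⟨g', h⟩

theorem mulCircuit_mulCost (m : ℕ) : MulCircuit m (mulCost m) :=
  .of_mulBits (mulCost_spec m)

theorem Nat.ofBits_eq_two_pow {m : ℕ} (k : Fin m) :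
    Nat.ofBits (fun i : Fin m => decide (i = k)) = 2 ^ (k : ℕ) := by
  rw [Nat.ofBits_eq_sum, Finset.sum_eq_single k] <;> simp +contextual

/-- The product of two integers has as many gates as bits, since the output bits are different
functions, none of which is an input. -/
theorem le_mulCost (m : ℕ) : m ≤ mulCost m := by
  obtain ⟨c, out, h⟩ := mulCost_spec m
  rcases Nat.eq_zero_or_pos m with rfl | hm
  · exact Nat.zero_le _
  let low : Fin m → Fin (2 * m) := fun k => ⟨k, by omega⟩
  have hz : ∀ x : Fin m ⊕ Fin m → Bool, (Nat.ofBits (fun i => x (.inl i)) = 0 ∨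
      Nat.ofBits (fun i => x (.inr i)) = 0) → ∀ k, mulBits m x k = false := by
    rintro x (hx | hx) k <;> simp [mulBits, hx]
  have hin : ∀ k i, out k ≠ Sum.inl i := by
    -- An output wired to an input bit would be true when that factor is all ones and the other one
    -- is zero, although the product is zero.
    rintro k (i | i) hk
    · have h1 := h (Sum.elim (fun _ => true) (fun _ => false)) k
      rw [hz _ (Or.inr Nat.ofBits_false), hk] at h1
      exact absurd h1 (by simp [Circuit.wireVal])
    · have h1 := h (Sum.elim (fun _ => false) (fun _ => true)) k
      rw [hz _ (Or.inl Nat.ofBits_false), hk] at h1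
      exact absurd h1 (by simp [Circuit.wireVal])
  have hout : ∀ k, ∃ j, out k = Sum.inr j := by
    intro k
    rcases hk : out k with i | j
    · exact absurd hk (hin k i)
    · exact ⟨j, rfl⟩
  choose j hj using hout
  have hinj : Function.Injective (fun k => j (low k)) := by
    intro k k' hkk
    have h1 : out (low k) = out (low k') := by rw [hj, hj]; exact congrArg _ hkk
    -- The product 2^k · 1 separates the low output bits: exactly bit k of it is set.
    have h2 : ∀ l, mulBits m (Sum.elim (fun i => decide (i = k)) (fun i => decide (i = ⟨0, hm⟩)))
        (low l) = decide (k = l) := by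
      intro l
      have e1 := Nat.ofBits_eq_two_pow k
      have e2 := Nat.ofBits_eq_two_pow (⟨0, hm⟩ : Fin m)
      simp only [mulBits, Sum.elim_inl, Sum.elim_inr, e1, e2, low]
      simp [Nat.testBit_two_pow, Fin.ext_iff]
    have h3 := h2 k'
    rw [← h, ← h1, h, h2] at h3
    simpa using h3.symm
  simpa using Fintype.card_le_of_injective _ hinj

/-! ### Fast integer multiplication -/

theorem Computes.natConcatPow {J N : ℕ} :
    Computes ((Enc.nat N).pow (Fin J)) (.nat (J * N)) id
      (fun z : Fin J → ℕ => (∑ j : Fin J, 2 ^ (N * (j : ℕ)) * z j : ℕ)) 0 := by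
  refine ⟨_, CostLE.wiring (finProdFinEquiv (m := J) (n := N)).symm, ?_⟩
  rintro _ x rfl
  change Nat.ofBits (fun k : Fin (J * N) => x (finProdFinEquiv.symm k)) =
    ∑ j : Fin J, 2 ^ (N * j) * Nat.ofBits (fun i : Fin N => x (j, i))
  rw [Nat.ofBits_eq_sum, ← Equiv.sum_comp finProdFinEquiv, Fintype.sum_prod_type]
  refine Finset.sum_congr rfl fun j _ => ?_
  rw [Nat.ofBits_eq_sum, Finset.mul_sum]
  refine Finset.sum_congr rfl fun i _ => ?_
  simp only [Equiv.symm_apply_apply, finProdFinEquiv_apply_val, pow_add]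
  ring

/-- The polynomial whose coefficients are the `h` lowest blocks of `L` bits of `x`. -/
noncomputable def blockPoly (L h x : ℕ) : ℕ[X] :=
  ∑ i ∈ Finset.range h, C (x / 2 ^ (L * i) % 2 ^ L) * X ^ i

theorem coeff_blockPoly {L h x : ℕ} (hx : x < 2 ^ (L * h)) (i : ℕ) :
    (blockPoly L h x).coeff i = x / 2 ^ (L * i) % 2 ^ L := by
  simp only [blockPoly, finsetSum_coeff, coeff_C_mul_X_pow, Finset.sum_ite_eq, Finset.mem_range]
  split_ifs with hi
  · rfl
  · rw [Nat.div_eq_of_lt, Nat.zero_mod]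
    exact hx.trans_le (Nat.pow_le_pow_right (by norm_num) (Nat.mul_le_mul_left _ (by omega)))

theorem degree_blockPoly_lt (L h x : ℕ) : (blockPoly L h x).degree < h := by
  rw [degree_lt_iff_coeff_zero]
  intro i hi
  simp only [blockPoly, finsetSum_coeff, coeff_C_mul_X_pow, Finset.sum_ite_eq, Finset.mem_range]
  rw [if_neg (by omega)]

theorem eval_blockPoly {L h x : ℕ} (hx : x < 2 ^ (L * h)) : (blockPoly L h x).eval (2 ^ L) = x := by
  conv_rhs => rw [← Nat.sum_blocks L h x hx]
  simp only [blockPoly, eval_finsetSum, eval_mul, eval_C, eval_pow, eval_X, ← pow_mul, mul_comm]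

theorem degree_mul_lt_of_lt {R : Type*} [Semiring R] {f g : R[X]} {h : ℕ} (hf : f.degree < h)
    (hg : g.degree < h) : (f * g).degree < (2 * h : ℕ) := by
  rw [degree_lt_iff_coeff_zero] at hf hg ⊢
  intro i hi
  rw [coeff_mul]
  refine Finset.sum_eq_zero fun p hp => ?_
  rw [Finset.HasAntidiagonal.mem_antidiagonal] at hp
  by_cases h1 : h ≤ p.1
  · rw [hf _ h1, zero_mul]
  · rw [hg _ (by omega), mul_zero]

theorem coeff_blockPoly_mul_lt {L h x y : ℕ} (hx : x < 2 ^ (L * h)) (hy : y < 2 ^ (L * h)) {i : ℕ}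
    (hi : i < L) : (blockPoly L h x * blockPoly L h y).coeff i < 2 ^ (4 * L) := by
  rw [coeff_mul]
  have h1 : ∀ p ∈ Finset.HasAntidiagonal.antidiagonal i,
      (blockPoly L h x).coeff p.1 * (blockPoly L h y).coeff p.2
      ≤ 2 ^ L * 2 ^ L := by
    intro p _
    rw [coeff_blockPoly hx, coeff_blockPoly hy]
    exact Nat.mul_le_mul (Nat.mod_lt _ (by positivity)).le (Nat.mod_lt _ (by positivity)).le
  refine (Finset.sum_le_card_nsmul _ _ _ h1).trans_lt ?_
  rw [Finset.Nat.card_antidiagonal, smul_eq_mul]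
  have h2 : i + 1 < 2 ^ L := lt_of_le_of_lt hi Nat.lt_two_pow_self
  calc (i + 1) * (2 ^ L * 2 ^ L) < 2 ^ L * (2 ^ L * 2 ^ L) :=
        Nat.mul_lt_mul_of_pos_right h2 (by positivity)
    _ = 2 ^ (3 * L) := by ring
    _ ≤ 2 ^ (4 * L) := Nat.pow_le_pow_right (by norm_num) (by omega)

/-- One level of the recursion of fast integer multiplication. -/
theorem MulCircuit.step {k g : ℕ} (hk : 2 ≤ k) (h : MulCircuit (2 ^ (k + 2)) g) :
    MulCircuit (2 ^ (2 * k - 1)) (4 * 2 ^ k * g + 6000 * (k + 1) * 2 ^ (2 * k)) := by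
  obtain ⟨k, rfl⟩ : ∃ k', k = k' + 2 := ⟨k - 2, by omega⟩
  -- With the index lowered by 2, the factors have m = L·H bits and are cut into H blocks of L bits.
  -- The product polynomial has fewer than 2H = L coefficients, each below 2^(3L), so residues
  -- modulo 2^N + 1 with N = 4L determine them.
  set J := 2 ^ k with hJ
  have hJ0 : 0 < J := by positivity
  obtain ⟨L, hL⟩ : ∃ L, L = 4 * J := ⟨_, rfl⟩
  have hLk : 2 ^ (k + 2) = L := by rw [pow_add, hL]; ring
  obtain ⟨H, hH⟩ : ∃ H, H = 2 * J := ⟨_, rfl⟩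
  obtain ⟨N, hN⟩ : ∃ N, N = 4 * L := ⟨_, rfl⟩
  obtain ⟨m, hm⟩ : ∃ m, m = L * H := ⟨_, rfl⟩
  have hm' : 2 ^ (2 * (k + 2) - 1) = m := by
    rw [show 2 * (k + 2) - 1 = k + k + 3 by omega, pow_add, pow_add, hm, hL, hH, ← hJ]; ring
  have hg' : 2 ^ (k + 2 + 2) = N := by rw [pow_add, hLk, hN]; ring
  have h2k : 2 ^ (2 * (k + 2)) = L * L := by rw [two_mul, pow_add, hLk]
  rw [hm', hLk, h2k]
  rw [hg'] at h
  have : NeZero L := ⟨by omega⟩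
  have : NeZero N := ⟨by omega⟩
  have hm0 : 0 < m := hm ▸ Nat.mul_pos (by omega) (by omega)
  have : NeZero m := ⟨hm0.ne'⟩
  have : NeZero (2 * m) := ⟨by omega⟩
  -- A residue has 2N bits, that is two blocks; this is the factor 4 in the recursion.
  have hmul := Computes.fermatMul_of_blocks (N := N) (M := N) (c := 2) le_rfl (by omega) h
  let A := (Enc.nat m).prod (.nat m)
  let V := (Enc.fermat N).pow (Fin (2 ^ (k + 2)))
  let Ω := {p : ℕ × ℕ // p.1 < 2 ^ (L * H) ∧ p.2 < 2 ^ (L * H)}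
  suffices hΩ : Computes (Ω := Ω) A (.nat (2 * m)) (fun p => p.1)
      (fun p => p.1.1 * p.1.2) (4 * L * g + 6000 * (k + 2 + 1) * (L * L)) by
    obtain ⟨F, hF, hspec⟩ := hΩ
    refine ⟨F, hF, ?_⟩
    rintro (p : ℕ × ℕ) x hx
    have := lt_of_dec_nat_prod hx
    rw [hm] at this
    exact hspec ⟨p, this⟩ x hx
  have hx : Computes (Ω := Ω) A (.nat m) (fun p => p.1) (fun p => p.1.1) 0 := Computes.fst
  have hy : Computes (Ω := Ω) A (.nat m) (fun p => p.1) (fun p => p.1.2) 0 := Computes.snd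
  let P : ℕ → (Fermat N)[X] := fun x => (blockPoly L H x).map (Nat.castRingHom _)
  have hPx : Computes (Ω := Ω) A V (fun p => p.1) (fun p i => (P p.1.1).coeff i) (L * 4) := by
    refine (Computes.pi_const (τ := Fin (2 ^ (k + 2))) (g := 4) fun i =>
      ((hx.then_id (Computes.natWindow (L * i) L)).then_id
      (Computes.fermatOfNat_le (by omega))).congr fun p => ?_).mono (by simp [hLk])
    simp only [P, coeff_map, coeff_blockPoly p.2.1, eq_natCast]
  have hPy : Computes (Ω := Ω) A V (fun p => p.1) (fun p i => (P p.1.2).coeff i) (L * 4) := by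
    refine (Computes.pi_const (τ := Fin (2 ^ (k + 2))) (g := 4) fun i =>
      ((hy.then_id (Computes.natWindow (L * i) L)).then_id
      (Computes.fermatOfNat_le (by omega))).congr fun p => ?_).mono (by simp [hLk])
    simp only [P, coeff_map, coeff_blockPoly p.2.2, eq_natCast]
  have hPd : ∀ x, (P x).degree < H := fun x => degree_map_le.trans_lt (degree_blockPoly_lt L H x)
  have hHL : (H : WithBot ℕ) ≤ ((2 ^ (k + 2) : ℕ) : WithBot ℕ) := by
    rw [hLk]; exact_mod_cast (show H ≤ L by omega)
  have hprod := (hPx.pair hPy).trans (Computes.fermatPolyMul hmul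
    (k := k + 2) (by rw [hLk, hN]; exact dvd_mul_left _ _)
    (u := fun p : Ω => P p.1.1) (v := fun p : Ω => P p.1.2)
    (fun p => by
      have hL2 : 2 ^ (k + 2) = 2 * H := by omega
      rw [hL2]
      exact degree_mul_lt_of_lt (hPd _) (hPd _))
    (fun p => (hPd _).trans_le hHL) (fun p => (hPd _).trans_le hHL))
  let Z : ℕ × ℕ → ℕ[X] := fun p => blockPoly L H p.1 * blockPoly L H p.2
  have hZ : Computes (Ω := Ω) V ((Enc.nat N).pow (Fin L))
      (fun p i => (P p.1.1 * P p.1.2).coeff i) (fun p i => (Z p.1).coeff i) (L * (100 * N)) := by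
    refine (Computes.pi_const (τ := Fin L) fun i => ((Computes.proj (Fin.cast hLk.symm i)).then_id
      Computes.fermatCanon).congr fun p => ?_).mono (by simp)
    simp only [P, Z, ← Polynomial.map_mul, coeff_map, eq_natCast, Fin.val_cast]
    exact Fermat.val_natCast_mod (hN ▸ coeff_blockPoly_mul_lt p.2.1 p.2.2 i.2)
  -- The coefficients have N = 4L bits but are spaced L bits apart. Those with indices in one class
  -- modulo 4 do not overlap and are concatenated for free, so that only four numbers have to be
  -- added.
  have hsum : ∀ p : Ω, ∑ c : Fin 4, 2 ^ (L * (c : ℕ)) *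
      ∑ j : Fin J, 2 ^ (N * (j : ℕ)) * (Z p.1).coeff (c + 4 * j) = p.1.1 * p.1.2 := by
    intro p
    have h1 : (Z p.1).eval (2 ^ L) = p.1.1 * p.1.2 := by
      rw [eval_mul, eval_blockPoly p.2.1, eval_blockPoly p.2.2]
    have hdeg : (Z p.1).degree < (J * 4 : ℕ) := by
      rw [show J * 4 = 2 * H by omega]
      exact degree_mul_lt_of_lt (degree_blockPoly_lt _ _ _) (degree_blockPoly_lt _ _ _)
    rw [← h1, eval_eq_sum_range' (n := J * 4) (by
      by_cases h0 : Z p.1 = 0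
      · rw [h0]; simp; omega
      · exact (natDegree_lt_iff_degree_lt h0).mpr hdeg),
      ← Fin.sum_univ_eq_sum_range (fun i => (Z p.1).coeff i * (2 ^ L) ^ i),
      ← Equiv.sum_comp finProdFinEquiv, Fintype.sum_prod_type_right]
    refine Finset.sum_congr rfl fun c _ => ?_
    rw [Finset.mul_sum]
    refine Finset.sum_congr rfl fun j _ => ?_
    simp only [finProdFinEquiv_apply_val]
    rw [hN, ← pow_mul, mul_add, pow_add]
    ring
  have hJN : J * N = 2 * m := by rw [hN, hm, hL, hH]; ring
  have : NeZero (J * N) := ⟨by omega⟩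
  have hc : ∀ c : Fin 4, Computes (Ω := Ω) ((Enc.nat N).pow (Fin L)) (.fermat (2 * m))
      (fun p i => (Z p.1).coeff i) (fun p => ((2 ^ (L * (c : ℕ)) *
      ∑ j : Fin J, 2 ^ (N * (j : ℕ)) * (Z p.1).coeff (c + 4 * j) : ℕ) : Fermat (2 * m))) 2 := by
    intro c
    have h1 : Computes (Ω := Ω) ((Enc.nat N).pow (Fin L)) ((Enc.nat N).pow (Fin J))
      (fun p i => (Z p.1).coeff i) (fun p j => (Z p.1).coeff (c + 4 * j)) 0 :=
      (Computes.pi_const (τ := Fin J) fun j =>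
        Computes.proj (⟨c + 4 * j, by omega⟩ : Fin L)).mono (by simp)
    refine (((h1.then_id Computes.natConcatPow).then_id
      (Computes.fermatOfNat_le (N := 2 * m) (by omega))).then_id
      (Computes.fermatShift (L * (c : ℕ)))).congr fun p => ?_
    push_cast
    rfl
  have hfin := (Computes.fermat_sum Finset.univ fun c _ => hc c).then_id Computes.fermatCanon
  refine (((hprod.trans hZ).trans hfin).mono ?_).congr fun p => ?_
  · simp only [Finset.card_univ, Fintype.card_fin]
    have e1 : m + m = L * L := by rw [hm, hL, hH]; ring
    have e2 : L ≤ L * L := Nat.le_mul_self L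
    have e3 : 1 ≤ L := by omega
    rw [hLk, hN]
    have : 2 * m = L * L := by omega
    rw [this]
    nlinarith
  · rw [← Nat.cast_sum, hsum, Fermat.val_natCast_mod]
    rw [two_mul, pow_add, hm]
    exact Nat.mul_lt_mul'' p.2.1 p.2.2

/-- Integer multiplication in quasi-linear time. -/
theorem exists_mulCircuit_two_pow :
    ∃ C : ℕ, ∀ j, MulCircuit (2 ^ j) (C * 2 ^ j * (j + 1) ^ 10) := by
  choose G hG using fun j => MulCircuit.exists (2 ^ j)
  refine ⟨∑ j ∈ Finset.range 40, G j + 60000, fun j => ?_⟩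
  set C := ∑ j ∈ Finset.range 40, G j + 60000 with hC
  induction j using Nat.strong_induction_on with
  | _ j ih =>
    rcases Nat.lt_or_ge j 40 with hj | hj
    · refine (hG j).mono ?_
      have h1 : G j ≤ C := (Finset.single_le_sum (f := G) (fun _ _ => Nat.zero_le _)
        (Finset.mem_range.mpr hj)).trans (Nat.le_add_right _ _)
      calc G j ≤ C := h1
        _ ≤ C * (2 ^ j * (j + 1) ^ 10) := Nat.le_mul_of_pos_right _ (by positivity)
        _ = _ := by ring
    -- A level passes from exponent j to k + 2, about j/2 + 3, and multiplies the cost per bit by up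
    -- to 64.
    · obtain ⟨k, hk⟩ : ∃ k, k = (j + 2) / 2 := ⟨_, rfl⟩
      have h1 := MulCircuit.step (k := k) (by omega) (ih (k + 2) (by omega))
      have h2 := MulCircuit.of_le (m := 2 ^ j) (Nat.pow_le_pow_right (by norm_num)
        (show j ≤ 2 * k - 1 by omega)) h1
      refine h2.mono ?_
      have e1 : 2 ^ (2 * k) ≤ 4 * 2 ^ j := by
        calc 2 ^ (2 * k) ≤ 2 ^ (j + 2) := Nat.pow_le_pow_right (by norm_num) (by omega)
          _ = 4 * 2 ^ j := by ring
      -- This fixes the exponent 10: for j ≥ 40 the ratio of the bases is at least 5/3, and (5/3)^10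
      -- > 128 = 2·64. The spare factor 2 leaves half of the budget for the additive terms.
      have e2 : 128 * (k + 2 + 1) ^ 10 ≤ (j + 1) ^ 10 := by
        have h3 : (5 * (k + 3)) ^ 10 ≤ (3 * (j + 1)) ^ 10 := Nat.pow_le_pow_left (by omega) 10
        rw [mul_pow, mul_pow] at h3
        change 128 * (k + 3) ^ 10 ≤ (j + 1) ^ 10
        norm_num at h3
        omega
      have e3 : k + 1 ≤ (j + 1) ^ 10 :=
        (show k + 1 ≤ j + 1 by omega).trans (Nat.le_self_pow (by norm_num) _)
      have e4 : 4 * 2 ^ k * (C * 2 ^ (k + 2) * (k + 2 + 1) ^ 10) =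
          16 * C * (2 ^ (2 * k)) * (k + 2 + 1) ^ 10 := by ring
      rw [e4]
      have f1 : 16 * C * (2 ^ (2 * k)) * (k + 2 + 1) ^ 10 ≤
          16 * C * (4 * 2 ^ j) * (k + 2 + 1) ^ 10 := by gcongr
      have f2 : 2 * (16 * C * (4 * 2 ^ j) * (k + 2 + 1) ^ 10) ≤ C * 2 ^ j * (j + 1) ^ 10 := by
        calc _ = C * 2 ^ j * (128 * (k + 2 + 1) ^ 10) := by ring
          _ ≤ _ := by gcongr
      have f3 : 6000 * (k + 1) * 2 ^ (2 * k) ≤ 6000 * (j + 1) ^ 10 * (4 * 2 ^ j) := by gcongr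
      have f4 : 60000 * (2 ^ j * (j + 1) ^ 10) ≤ C * (2 ^ j * (j + 1) ^ 10) := by
        gcongr; omega
      have f5 : 1 ≤ 2 ^ j * (j + 1) ^ 10 := Nat.one_le_iff_ne_zero.mpr (by positivity)
      have f6 : 6000 * (j + 1) ^ 10 * (4 * 2 ^ j) = 24000 * (2 ^ j * (j + 1) ^ 10) := by ring
      rw [mul_assoc C] at f2 ⊢
      omega

/-! ### Truncated norms of power series -/

/-- The weighted sum of the moduli of the first `m` coefficients. -/
noncomputable def tnorm (θ : ℝ) (m : ℕ) (f : PowerSeries ℂ) : ℝ :=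
  ∑ i ∈ Finset.range m, ‖PowerSeries.coeff i f‖ * θ ^ i

section tnorm

variable {θ : ℝ} {m : ℕ} {f g : PowerSeries ℂ}

theorem tnorm_nonneg (hθ : 0 ≤ θ) : 0 ≤ tnorm θ m f :=
  Finset.sum_nonneg fun _ _ => by positivity

theorem tnorm_mono (hθ : 0 ≤ θ) {m' : ℕ} (h : m ≤ m') : tnorm θ m f ≤ tnorm θ m' f :=
  Finset.sum_le_sum_of_subset_of_nonneg (Finset.range_mono h) fun _ _ _ => by positivity

theorem tnorm_add_le (hθ : 0 ≤ θ) : tnorm θ m (f + g) ≤ tnorm θ m f + tnorm θ m g := by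
  rw [tnorm, tnorm, tnorm, ← Finset.sum_add_distrib]
  refine Finset.sum_le_sum fun i _ => ?_
  rw [map_add, ← add_mul]
  gcongr
  exact norm_add_le _ _

theorem tnorm_neg : tnorm θ m (-f) = tnorm θ m f := by simp [tnorm]

theorem tnorm_sub_le (hθ : 0 ≤ θ) : tnorm θ m (f - g) ≤ tnorm θ m f + tnorm θ m g := by
  rw [sub_eq_add_neg, ← tnorm_neg (f := g)]
  exact tnorm_add_le hθ

theorem tnorm_mul_le_sum (hθ : 0 ≤ θ) : tnorm θ m (f * g) ≤
    ∑ i ∈ Finset.range m, ∑ j ∈ Finset.range (m - i),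
      (‖PowerSeries.coeff i f‖ * θ ^ i) * (‖PowerSeries.coeff j g‖ * θ ^ j) := by
  rw [← Finset.sum_range_diag_flip m fun i j =>
    (‖PowerSeries.coeff i f‖ * θ ^ i) * (‖PowerSeries.coeff j g‖ * θ ^ j)]
  refine Finset.sum_le_sum fun k _ => ?_
  rw [PowerSeries.coeff_mul, Finset.Nat.sum_antidiagonal_eq_sum_range_succ_mk]
  refine (mul_le_mul_of_nonneg_right (norm_sum_le _ _) (by positivity)).trans ?_
  rw [Finset.sum_mul]
  refine Finset.sum_le_sum fun i hi => ?_
  rw [Finset.mem_range] at hi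
  rw [norm_mul, show θ ^ k = θ ^ i * θ ^ (k - i) by rw [← pow_add]; congr 1; omega]
  exact le_of_eq (by ring)

theorem tnorm_mul_le (hθ : 0 ≤ θ) : tnorm θ m (f * g) ≤ tnorm θ m f * tnorm θ m g := by
  refine (tnorm_mul_le_sum hθ).trans ?_
  rw [tnorm, Finset.sum_mul]
  refine Finset.sum_le_sum fun i _ => ?_
  rw [← Finset.mul_sum]
  exact mul_le_mul_of_nonneg_left (tnorm_mono hθ (Nat.sub_le m i)) (by positivity)

/-- Low order coefficients of a square. -/
theorem tnorm_mul_self_le (hθ : 0 ≤ θ) {m' : ℕ} (h : m' ≤ 2 * m) :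
    tnorm θ m' (f * f) ≤ 2 * tnorm θ m f * tnorm θ m' f := by
  refine (tnorm_mul_le_sum hθ).trans ?_
  -- In a product of coefficients with index sum below 2m, one index is below m. If it is not i, the
  -- other index is below m' - i ≤ m.
  have h1 : ∀ i ∈ Finset.range m', ∑ j ∈ Finset.range (m' - i),
      (‖PowerSeries.coeff i f‖ * θ ^ i) * (‖PowerSeries.coeff j f‖ * θ ^ j) ≤
      (if i ∈ Finset.range m then ‖PowerSeries.coeff i f‖ * θ ^ i else 0) * tnorm θ m' f +
      (‖PowerSeries.coeff i f‖ * θ ^ i) * tnorm θ m f := by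
    intro i _
    rw [← Finset.mul_sum]
    have h2 : 0 ≤ ‖PowerSeries.coeff i f‖ * θ ^ i := by positivity
    have h3 := mul_nonneg h2 (tnorm_nonneg (f := f) (m := m) hθ)
    split_ifs with hi
    · have := mul_le_mul_of_nonneg_left (tnorm_mono (f := f) hθ (Nat.sub_le m' i)) h2
      rw [tnorm] at this
      linarith
    · rw [Finset.mem_range] at hi
      have := mul_le_mul_of_nonneg_left (tnorm_mono (f := f) hθ (show m' - i ≤ m by omega)) h2
      rw [tnorm] at this
      linarith
  refine (Finset.sum_le_sum h1).trans ?_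
  rw [Finset.sum_add_distrib, ← Finset.sum_mul, ← Finset.sum_mul, ← Finset.sum_filter]
  have h4 : ∑ i ∈ Finset.range m' with i ∈ Finset.range m, ‖PowerSeries.coeff i f‖ * θ ^ i ≤
      tnorm θ m f := by
    refine Finset.sum_le_sum_of_subset_of_nonneg ?_ fun _ _ _ => by positivity
    intro i hi
    exact (Finset.mem_filter.mp hi).2
  have h5 := mul_le_mul_of_nonneg_right h4 (tnorm_nonneg (f := f) (m := m') hθ)
  have h6 : (∑ i ∈ Finset.range m', ‖PowerSeries.coeff i f‖ * θ ^ i) * tnorm θ m f =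
    tnorm θ m f * tnorm θ m' f := mul_comm _ _
  linarith

theorem norm_coeff_le_tnorm {i : ℕ} (hi : i < m) : ‖PowerSeries.coeff i f‖ ≤ tnorm 1 m f := by
  have h := Finset.single_le_sum (f := fun i => ‖PowerSeries.coeff i f‖ * (1 : ℝ) ^ i)
    (fun _ _ => by positivity) (Finset.mem_range.mpr hi)
  simpa [tnorm] using h

theorem tnorm_le_of_coeff_le {c : ℝ} (h : ∀ i < m, ‖PowerSeries.coeff i f‖ ≤ c) :
    tnorm 1 m f ≤ m * c := by
  rw [tnorm]
  refine (Finset.sum_le_card_nsmul _ _ c fun i hi => ?_).trans (by simp)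
  simpa using h i (Finset.mem_range.mp hi)

/-- The ℓ^∞–ℓ¹ inequality for convolutions. It transfers coefficientwise bounds without losing a
factor for the number of terms. -/
theorem norm_coeff_mul_le {c : ℝ} {i : ℕ} (h : ∀ j ≤ i, ‖PowerSeries.coeff j f‖ ≤ c) (hi : i < m) :
    ‖PowerSeries.coeff i (f * g)‖ ≤ c * tnorm 1 m g := by
  have hc : 0 ≤ c := (norm_nonneg _).trans (h 0 (Nat.zero_le _))
  rw [mul_comm f, PowerSeries.coeff_mul, Finset.Nat.sum_antidiagonal_eq_sum_range_succ_mk]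
  refine (norm_sum_le _ _).trans ?_
  refine le_trans ?_ (mul_le_mul_of_nonneg_left (tnorm_mono zero_le_one hi) hc)
  rw [tnorm, Finset.mul_sum]
  refine Finset.sum_le_sum fun j _ => ?_
  rw [norm_mul, one_pow, mul_one, mul_comm]
  exact mul_le_mul_of_nonneg_right (h _ (Nat.sub_le _ _)) (norm_nonneg _)

theorem tnorm_C_le (z : ℂ) : tnorm θ m (PowerSeries.C z) ≤ ‖z‖ := by
  rcases m with - | m
  · simp [tnorm]
  rw [tnorm, Finset.sum_range_succ']
  simp [PowerSeries.coeff_C]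

theorem tnorm_X_le : tnorm 1 m (PowerSeries.X) ≤ 1 := by
  have h : tnorm 1 (m + 2) (PowerSeries.X) ≤ 1 := by
    rw [tnorm, Finset.sum_range_succ', Finset.sum_range_succ']
    simp [PowerSeries.coeff_X]
  exact (tnorm_mono zero_le_one (Nat.le_add_right m 2)).trans h

theorem tnorm_one_le : tnorm θ m 1 ≤ 1 := by
  simpa using tnorm_C_le (m := m) (θ := θ) (1 : ℂ)

theorem tnorm_multiset_prod_le (hθ : 0 ≤ θ) {c : ℝ} (hc : 0 ≤ c) (Z : Multiset ℂ)
    (F : ℂ → PowerSeries ℂ) (hF : ∀ z ∈ Z, tnorm θ m (F z) ≤ c) :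
    tnorm θ m (Z.map F).prod ≤ c ^ Z.card := by
  induction Z using Multiset.induction_on with
  | empty => simpa using tnorm_one_le
  | cons z Z ih =>
    rw [Multiset.map_cons, Multiset.prod_cons, Multiset.card_cons, pow_succ']
    exact (tnorm_mul_le hθ).trans (mul_le_mul (hF z (Multiset.mem_cons_self z Z))
      (ih fun w hw => hF w (Multiset.mem_cons_of_mem hw)) (tnorm_nonneg hθ) hc)

end tnorm

theorem one_sub_mul_geom (z : ℂ) :
    (1 - PowerSeries.C z * PowerSeries.X) * PowerSeries.mk (fun i => z ^ i) = 1 := by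
  ext i
  rw [sub_mul, one_mul, mul_assoc, map_sub, PowerSeries.coeff_C_mul]
  rcases i with - | i
  · simp
  · rw [PowerSeries.coeff_succ_X_mul]
    simp [PowerSeries.coeff_one, pow_succ']

theorem tnorm_geom_le {θ : ℝ} (hθ : 0 ≤ θ) {z : ℂ} (hz : ‖z‖ * θ ≤ 1 / 2) (m : ℕ) :
    tnorm θ m (PowerSeries.mk (fun i => z ^ i)) ≤ 2 := by
  have h1 : ∀ i ∈ Finset.range m, ‖PowerSeries.coeff i (PowerSeries.mk (fun i => z ^ i))‖ * θ ^ i ≤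
      (1 / 2 : ℝ) ^ i := by
    intro i _
    rw [PowerSeries.coeff_mk, norm_pow, ← mul_pow]
    exact pow_le_pow_left₀ (by positivity) hz i
  refine (Finset.sum_le_sum h1).trans ?_
  have h2 := summable_geometric_two.sum_le_tsum (Finset.range m) (fun _ _ => by positivity)
  rwa [tsum_geometric_two] at h2

/-- The inverse of a product of `1 - z X`. -/
theorem tnorm_prod_geom_le {r : ℝ} (hr : 1 ≤ r) (Z : Multiset ℂ) (hZ : ∀ z ∈ Z, ‖z‖ ≤ r) (m : ℕ) :
    tnorm 1 (m + 1) (Z.map fun z => PowerSeries.mk (fun i => z ^ i)).prod ≤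
      2 ^ Z.card * (2 * r) ^ m := by
  -- With weight 1/(2r) every geometric series has norm at most 2. Returning to weight 1 costs
  -- (2r)^m only once, and not once for each factor.
  have hθ : (0 : ℝ) ≤ 1 / (2 * r) := by positivity
  have h1 := tnorm_multiset_prod_le (m := m + 1) hθ zero_le_two Z
    (fun z => PowerSeries.mk (fun i => z ^ i)) (fun z hz => tnorm_geom_le hθ (by
      have := hZ z hz
      rw [mul_one_div, div_le_div_iff₀ (by positivity) (by norm_num)]
      linarith) (m + 1))
  refine le_trans ?_ (mul_le_mul_of_nonneg_right h1 (by positivity))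
  rw [tnorm, tnorm, Finset.sum_mul]
  refine Finset.sum_le_sum fun i hi => ?_
  rw [mul_assoc]
  refine mul_le_mul_of_nonneg_left ?_ (norm_nonneg _)
  rw [one_pow, one_div, inv_pow, ← div_eq_inv_mul, le_div_iff₀ (by positivity), one_mul]
  exact pow_le_pow_right₀ (by linarith) (Nat.lt_succ_iff.mp (Finset.mem_range.mp hi))

/-! ### Reversal of the division and the bounds for the exact quotient and remainder -/

theorem reflect_multiset_prod (Z : Multiset ℂ) :
    reflect Z.card (Z.map fun z => X - C z).prod = (Z.map fun z => 1 - C z * X).prod := by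
  induction Z using Multiset.induction_on with
  | empty => simp
  | cons z Z ih =>
    rw [Multiset.map_cons, Multiset.prod_cons, Multiset.card_cons, add_comm, reflect_mul, ih,
      Multiset.map_cons, Multiset.prod_cons]
    · congr 1
      rw [reflect_sub, reflect_one_X, reflect_C, pow_one]
    · exact (natDegree_X_sub_C z).le
    · rw [natDegree_multiset_prod_X_sub_C_eq_card]

/-- The data of a division in terms of the reversed polynomials: the inverse power series `H` of
the reversed divisor, its norm, and the quotient. -/
theorem IsDivision.exists_inverse {n : ℕ} {τ₁ τ₂ ρ : ℝ} {s t q r : ℂ[X]} (hρ : 0 ≤ ρ)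
    (h : IsDivision n τ₁ τ₂ ρ s t q r) :
    ∃ H : PowerSeries ℂ, ((reflect n t : ℂ[X]) : PowerSeries ℂ) * H = 1 ∧
      tnorm 1 (n + 1) H ≤ 2 ^ (n * (ρ + 2)) ∧
      tnorm 1 (n + 1) (reflect n t : ℂ[X]) ≤ 2 ^ (n * (ρ + 1)) ∧
      tnorm 1 (n + 1) t ≤ 2 ^ (n * (ρ + 1)) ∧ q.natDegree ≤ n ∧
      ∀ i ≤ n, (reflect n q).coeff i =
        PowerSeries.coeff i (((reflect (2 * n) s : ℂ[X]) : PowerSeries ℂ) * H) := by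
  have hr : (1 : ℝ) ≤ 2 ^ ρ := Real.one_le_rpow (by norm_num) hρ
  have hsp := IsAlgClosed.splits t
  have ht : (t.roots.map fun z => X - C z).prod = t := by
    conv_rhs => rw [hsp.eq_prod_roots_of_monic h.monic_t]
  have hcard : t.roots.card = n := by
    rw [← hsp.natDegree_eq_card_roots, h.natDegree_t]
  have hz : ∀ z ∈ t.roots, ‖z‖ ≤ 2 ^ ρ := fun z hz => h.norm_root z (isRoot_of_mem_roots hz)
  set Z := t.roots
  have hT : (reflect n t : PowerSeries ℂ) =
      (Z.map fun z => (1 - PowerSeries.C z * PowerSeries.X)).prod := by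
    rw [← ht, ← hcard, reflect_multiset_prod]
    rw [← Polynomial.coeToPowerSeries.ringHom_apply, map_multiset_prod, Multiset.map_map]
    refine congrArg Multiset.prod (Multiset.map_congr rfl fun z _ => ?_)
    simp
  have ht' : (t : PowerSeries ℂ) = (Z.map fun z => (PowerSeries.X - PowerSeries.C z)).prod := by
    conv_lhs => rw [← ht]
    rw [← Polynomial.coeToPowerSeries.ringHom_apply, map_multiset_prod, Multiset.map_map]
    refine congrArg Multiset.prod (Multiset.map_congr rfl fun z _ => ?_)
    simp
  have hpow : (1 + (2 : ℝ) ^ ρ) ^ n ≤ 2 ^ (n * (ρ + 1)) := by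
    rw [mul_comm, Real.rpow_mul_natCast (by norm_num), Real.rpow_add (by norm_num), Real.rpow_one]
    exact pow_le_pow_left₀ (by positivity) (by linarith) n
  let H := (Z.map fun z => PowerSeries.mk (fun i => z ^ i)).prod
  have hTH : (reflect n t : PowerSeries ℂ) * H = 1 := by
    rw [hT, ← Multiset.prod_map_mul]
    refine Multiset.prod_eq_one ?_
    intro x hx
    obtain ⟨z, -, rfl⟩ := Multiset.mem_map.mp hx
    exact one_sub_mul_geom z
  have hqd : q.natDegree ≤ n := by
    by_cases hq : q = 0
    · simp [hq]
    have h1 : t * q = s - r := by rw [h.eq]; ring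
    have h2 : (t * q).natDegree ≤ 2 * n := by
      rw [h1]
      refine (natDegree_sub_le _ _).trans (max_le h.natDegree_s ?_)
      have := natDegree_le_natDegree h.degree_r.le
      rw [h.natDegree_t] at this
      omega
    rw [h.monic_t.natDegree_mul' hq, h.natDegree_t] at h2
    omega
  refine ⟨H, hTH, ?_, ?_, ?_, hqd, ?_⟩
  · refine (tnorm_prod_geom_le hr Z hz n).trans (le_of_eq ?_)
    rw [hcard, ← mul_pow, mul_comm (n : ℝ), Real.rpow_mul_natCast (by norm_num),
      Real.rpow_add (by norm_num)]
    norm_num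
    ring
  · rw [hT]
    refine (tnorm_multiset_prod_le zero_le_one (c := 1 + 2 ^ ρ) (by positivity) Z _ ?_).trans
      (by rw [hcard]; exact hpow)
    intro z hz'
    refine (tnorm_sub_le zero_le_one).trans (add_le_add tnorm_one_le ?_)
    refine (tnorm_mul_le zero_le_one).trans ?_
    calc _ ≤ ‖z‖ * 1 := mul_le_mul (tnorm_C_le z) tnorm_X_le
          (tnorm_nonneg zero_le_one) (norm_nonneg _)
      _ ≤ 2 ^ ρ := by rw [mul_one]; exact hz z hz'
  · rw [ht']
    refine (tnorm_multiset_prod_le zero_le_one (c := 1 + 2 ^ ρ) (by positivity) Z _ ?_).trans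
      (by rw [hcard]; exact hpow)
    intro z hz'
    exact (tnorm_sub_le zero_le_one).trans (add_le_add tnorm_X_le
      ((tnorm_C_le z).trans (hz z hz')))
  · intro i hi
    -- Reversal is multiplicative when the formal degrees add up, here n + n = 2n.
    have h1 : reflect (2 * n) s = reflect n t * reflect n q + reflect (2 * n) r := by
      conv_lhs => rw [h.eq, reflect_add, two_mul, reflect_mul t q h.natDegree_t.le hqd]
      rw [two_mul]
    rw [h1, Polynomial.coe_add, Polynomial.coe_mul, add_mul, mul_right_comm, hTH, one_mul, map_add,
      Polynomial.coeff_coe]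
    -- Since deg r < n, the reversal of r in degree 2n has no terms of degree at most n.
    have h2 : PowerSeries.coeff i (((reflect (2 * n) r : ℂ[X]) : PowerSeries ℂ) * H) = 0 := by
      rw [PowerSeries.coeff_mul]
      refine Finset.sum_eq_zero fun p hp => ?_
      rw [Finset.HasAntidiagonal.mem_antidiagonal] at hp
      rw [Polynomial.coeff_coe, coeff_reflect, revAt_le (by omega),
        coeff_eq_zero_of_degree_lt (h.degree_r.trans_le (degree_le_natDegree.trans ?_)), zero_mul]
      rw [h.natDegree_t]
      exact_mod_cast (by omega)
    rw [h2, add_zero]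

theorem supNorm_le_iff_coeff {f : ℂ[X]} {c : ℝ} : f.supNorm ≤ c ↔ ∀ i, ‖f.coeff i‖ ≤ c := by
  constructor
  · exact fun h i => (le_supNorm f i).trans h
  · intro h
    obtain ⟨i, hi⟩ := f.exists_eq_supNorm
    rw [hi]
    exact h i

theorem IsDivision.norm_q_le {n : ℕ} {τ₁ τ₂ ρ : ℝ} {s t q r : ℂ[X]} (hρ : 0 ≤ ρ)
    (h : IsDivision n τ₁ τ₂ ρ s t q r) (i : ℕ) : ‖q.coeff i‖ ≤ 2 ^ τ₁ * 2 ^ (n * (ρ + 2)) := by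
  obtain ⟨H, -, hH, -, -, hqd, hq⟩ := h.exists_inverse hρ
  by_cases hi : i ≤ n
  · have h1 := hq (n - i) (by omega)
    rw [coeff_reflect, revAt_le (by omega), Nat.sub_sub_self hi] at h1
    rw [h1]
    refine (norm_coeff_mul_le (c := 2 ^ τ₁) (m := n + 1) (i := n - i) ?_ (by omega)).trans ?_
    · intro j _
      rw [Polynomial.coeff_coe, coeff_reflect]
      exact (supNorm_le_iff_coeff.mp h.norm_s) _
    · gcongr
  · rw [coeff_eq_zero_of_natDegree_lt (by omega), norm_zero]
    positivity

/-- Here r = s - tq, and the product combines the coefficient bound for q with the ℓ¹ norm of t,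
which is controlled by the roots. -/
theorem IsDivision.norm_r_le {n : ℕ} {τ₁ τ₂ ρ : ℝ} {s t q r : ℂ[X]} (hρ : 0 ≤ ρ)
    (h : IsDivision n τ₁ τ₂ ρ s t q r) (i : ℕ) :
    ‖r.coeff i‖ ≤ 2 ^ τ₁ + 2 ^ τ₁ * 2 ^ (n * (ρ + 2)) * 2 ^ (n * (ρ + 1)) := by
  obtain ⟨H, -, -, -, ht, -, -⟩ := h.exists_inverse hρ
  by_cases hi : i < n
  · have h1 : r = s - t * q := by rw [h.eq]; ring
    rw [h1, coeff_sub]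
    refine (norm_sub_le _ _).trans (add_le_add ((supNorm_le_iff_coeff.mp h.norm_s) _) ?_)
    rw [mul_comm t q, ← Polynomial.coeff_coe, Polynomial.coe_mul]
    refine (norm_coeff_mul_le (c := 2 ^ τ₁ * 2 ^ (n * (ρ + 2))) (m := n + 1) ?_ (by omega)).trans ?_
    · intro j _
      rw [Polynomial.coeff_coe]
      exact h.norm_q_le hρ j
    · gcongr
  · rw [coeff_eq_zero_of_degree_lt (h.degree_r.trans_le (degree_le_natDegree.trans ?_)), norm_zero]
    · positivity
    · rw [h.natDegree_t]
      exact_mod_cast (by omega)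

/-- The norms of the quotient and the remainder. -/
theorem IsDivision.supNorm_le {n : ℕ} (hn : 1 ≤ n) {τ₁ τ₂ ρ : ℝ} {s t q r : ℂ[X]} (hρ : 0 ≤ ρ)
    (h : IsDivision n τ₁ τ₂ ρ s t q r) :
    q.supNorm ≤ 2 ^ (2 * n + lg n + 1 + n * ρ + τ₁) ∧
      r.supNorm ≤ 2 ^ (3 * n + lg n + 1 + 2 * n * ρ + τ₁) := by
  have hlg : 0 ≤ lg n := Real.logb_nonneg (by norm_num) (by exact_mod_cast hn)
  have hnρ : 0 ≤ n * ρ := by positivity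
  rw [supNorm_le_iff_coeff, supNorm_le_iff_coeff]
  constructor
  · intro i
    refine (h.norm_q_le hρ i).trans ?_
    rw [← Real.rpow_add (by norm_num)]
    exact Real.rpow_le_rpow_of_exponent_le (by norm_num) (by linarith)
  · intro i
    refine (h.norm_r_le hρ i).trans ?_
    rw [← Real.rpow_add (by norm_num), ← Real.rpow_add (by norm_num)]
    calc _ ≤ (2 : ℝ) ^ (3 * n + 2 * n * ρ + τ₁) + 2 ^ (3 * n + 2 * n * ρ + τ₁) := by
          refine add_le_add ?_ ?_ <;>
          exact Real.rpow_le_rpow_of_exponent_le (by norm_num) (by nlinarith)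
      _ = (2 : ℝ) ^ (3 * n + 2 * n * ρ + τ₁ + 1) := by
          rw [Real.rpow_add_one (by norm_num)]; ring
      _ ≤ _ := Real.rpow_le_rpow_of_exponent_le (by norm_num) (by linarith)

/-! ### Newton iteration with rounding -/

/-- The polynomial formed by the first `m` coefficients. -/
noncomputable def ptrunc {R : Type*} [CommRing R] (m : ℕ) (f : R[X]) : R[X] :=
  ∑ i ∈ Finset.range m, C (f.coeff i) * X ^ i

theorem coeff_sum_range_C_mul_X_pow {R : Type*} [CommRing R] (m : ℕ) (c : ℕ → R) (i : ℕ) :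
    (∑ i ∈ Finset.range m, C (c i) * X ^ i : R[X]).coeff i = if i < m then c i else 0 := by
  simp only [finsetSum_coeff, coeff_C_mul_X_pow, Finset.sum_ite_eq, Finset.mem_range]

theorem coeff_ptrunc {R : Type*} [CommRing R] (m : ℕ) (f : R[X]) (i : ℕ) :
    (ptrunc m f).coeff i = if i < m then f.coeff i else 0 :=
  coeff_sum_range_C_mul_X_pow m _ i

/-- Division of a Gaussian integer by `2 ^ e`, rounded down in both parts. -/
def GaussianInt.shr (e : ℕ) (z : GaussianInt) : GaussianInt := ⟨z.re / 2 ^ e, z.im / 2 ^ e⟩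

theorem Int.abs_div_two_pow_sub_le (a : ℤ) (e : ℕ) :
    |((a / 2 ^ e : ℤ) : ℝ) - a / 2 ^ e| ≤ 1 := by
  have h1 : (0 : ℤ) < 2 ^ e := by positivity
  have h2 := Int.mul_ediv_add_emod a (2 ^ e)
  have h3 := Int.emod_nonneg a h1.ne'
  have h4 := Int.emod_lt_of_pos a h1
  have h5 : (a : ℝ) = 2 ^ e * ((a / 2 ^ e : ℤ) : ℝ) + ((a % 2 ^ e : ℤ) : ℝ) := by exact_mod_cast h2.symm
  have h6 : (0 : ℝ) ≤ ((a % 2 ^ e : ℤ) : ℝ) := by exact_mod_cast h3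
  have h7 : ((a % 2 ^ e : ℤ) : ℝ) ≤ 2 ^ e := by exact_mod_cast h4.le
  have h8 : (0 : ℝ) < 2 ^ e := by positivity
  rw [abs_le]
  constructor
  · rw [le_sub_iff_add_le, add_comm, ← sub_eq_add_neg, sub_le_iff_le_add, div_le_iff₀ h8]
    nlinarith
  · rw [sub_le_iff_le_add, ← sub_le_iff_le_add', le_div_iff₀ h8]
    nlinarith

theorem GaussianInt.norm_shr_sub_le (e : ℕ) (z : GaussianInt) :
    ‖(GaussianInt.shr e z).toComplex - z.toComplex / 2 ^ e‖ ≤ 2 := by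
  have h1 : (GaussianInt.shr e z).toComplex - z.toComplex / 2 ^ e =
      ((((z.re / 2 ^ e : ℤ) : ℝ) - z.re / 2 ^ e : ℝ) : ℂ) +
      ((((z.im / 2 ^ e : ℤ) : ℝ) - z.im / 2 ^ e : ℝ) : ℂ) * Complex.I := by
    rw [GaussianInt.toComplex_def, GaussianInt.toComplex_def, GaussianInt.shr]
    push_cast
    ring
  rw [h1]
  refine (norm_add_le _ _).trans ?_
  rw [norm_mul, Complex.norm_I, mul_one, Complex.norm_real, Complex.norm_real]
  have := Int.abs_div_two_pow_sub_le z.re e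
  have := Int.abs_div_two_pow_sub_le z.im e
  simp only [Real.norm_eq_abs]
  linarith

/-- The first `m` coefficients divided by `2 ^ e` and rounded. -/
noncomputable def pround (e m : ℕ) (f : GaussianInt[X]) : GaussianInt[X] :=
  ∑ i ∈ Finset.range m, C (GaussianInt.shr e (f.coeff i)) * X ^ i

theorem coeff_pround (e m : ℕ) (f : GaussianInt[X]) (i : ℕ) :
    (pround e m f).coeff i = if i < m then GaussianInt.shr e (f.coeff i) else 0 :=
  coeff_sum_range_C_mul_X_pow m (fun i => GaussianInt.shr e (f.coeff i)) i

/-- The unrounded Newton step for the inverse of `τ`, in fixed-point arithmetic with `P` bits after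
the point. -/
noncomputable def newtonPre (n P : ℕ) (τ v : GaussianInt[X]) : GaussianInt[X] :=
  v * (C (2 ^ (2 * P + 1)) - ptrunc (n + 1) (τ * v))

/-- The Newton iteration for the inverse of `τ`. -/
noncomputable def newtonIter (n P : ℕ) (τ : GaussianInt[X]) : ℕ → GaussianInt[X]
  | 0 => C (2 ^ P)
  | k + 1 => pround (2 * P) (min (2 ^ (k + 1)) (n + 1)) (newtonPre n P τ (newtonIter n P τ k))

/-- A polynomial with fixed-point coefficients as a complex power series. -/
noncomputable def scaled (P : ℕ) (f : GaussianInt[X]) : PowerSeries ℂ :=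
  PowerSeries.C (((2 : ℂ) ^ P)⁻¹) * ((f.map GaussianInt.toComplex : ℂ[X]) : PowerSeries ℂ)

theorem coeff_scaled (P : ℕ) (f : GaussianInt[X]) (i : ℕ) :
    PowerSeries.coeff i (scaled P f) = (f.coeff i).toComplex / 2 ^ P := by
  rw [scaled, PowerSeries.coeff_C_mul, Polynomial.coeff_coe, coeff_map]
  field_simp

theorem coe_map_eq_scaled (P : ℕ) (f : GaussianInt[X]) :
    ((f.map GaussianInt.toComplex : ℂ[X]) : PowerSeries ℂ) =
      PowerSeries.C ((2 : ℂ) ^ P) * scaled P f := by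
  rw [scaled, ← mul_assoc, ← map_mul, mul_inv_cancel₀ (pow_ne_zero _ two_ne_zero), map_one, one_mul]

theorem coeff_mul_ptrunc {R : Type*} [CommRing R] (m : ℕ) (f g : R[X]) {i : ℕ} (hi : i < m) :
    (f * ptrunc m g).coeff i = (f * g).coeff i := by
  rw [coeff_mul, coeff_mul]
  refine Finset.sum_congr rfl fun p hp => ?_
  rw [Finset.HasAntidiagonal.mem_antidiagonal] at hp
  rw [coeff_ptrunc, if_pos (by omega)]

/-- The bracket in `newtonPre` has 2P bits after the point, so its constant 2 is 2^(2P+1); the outer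
factor contributes P more. The inner truncation does not affect coefficients up to n, and keeps the
degrees small for the circuit. -/
theorem coeff_newtonPre (n P : ℕ) (τ v : GaussianInt[X]) {i : ℕ} (hi : i < n + 1) :
    ((newtonPre n P τ v).coeff i).toComplex = 2 ^ (3 * P) *
      PowerSeries.coeff i (scaled P v * (2 - scaled P τ * scaled P v)) := by
  have h1 : (newtonPre n P τ v).coeff i = (v * (C (2 ^ (2 * P + 1)) - τ * v)).coeff i := by
    rw [newtonPre, mul_sub, mul_sub, coeff_sub, coeff_sub, coeff_mul_ptrunc _ _ _ hi]
  have h2 : (((v * (C (2 ^ (2 * P + 1)) - τ * v)).map GaussianInt.toComplex : ℂ[X]) :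
      PowerSeries ℂ) = PowerSeries.C ((2 : ℂ) ^ (3 * P)) *
        (scaled P v * (2 - scaled P τ * scaled P v)) := by
    have h3 : (((C (2 ^ (2 * P + 1) : GaussianInt)).map GaussianInt.toComplex : ℂ[X]) :
      PowerSeries ℂ) = PowerSeries.C ((2 : ℂ) ^ P) ^ 2 * 2 := by
      rw [Polynomial.map_C, Polynomial.coe_C, map_pow, map_ofNat, pow_succ, mul_comm 2 P, pow_mul,
        map_mul, map_pow _ ((2 : ℂ) ^ P) 2, map_ofNat]
    rw [Polynomial.map_mul, Polynomial.map_sub, Polynomial.map_mul, Polynomial.coe_mul,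
      Polynomial.coe_sub, Polynomial.coe_mul, h3, coe_map_eq_scaled P v, coe_map_eq_scaled P τ,
      mul_comm 3 P, pow_mul, map_pow _ ((2 : ℂ) ^ P) 3]
    ring
  rw [h1, ← coeff_map, ← Polynomial.coeff_coe, h2, PowerSeries.coeff_C_mul]

theorem tnorm_eq_of_support {m m' : ℕ} {f : PowerSeries ℂ} (hm : m ≤ m')
    (hf : ∀ i, m ≤ i → PowerSeries.coeff i f = 0) : tnorm 1 m' f = tnorm 1 m f := by
  refine (Finset.sum_subset (Finset.range_mono hm) fun i _ hi => ?_).symm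
  rw [Finset.mem_range, not_lt] at hi
  rw [hf i hi]; simp

/-- The error of an exact Newton step. -/
theorem tnorm_newton_le {m m' : ℕ} {T T' H V : PowerSeries ℂ} {B ε δ : ℝ} (hTH : T * H = 1)
    (hB : 1 ≤ B) (hmm' : m ≤ m') (hm' : m' ≤ 2 * m) (hT : tnorm 1 m' T ≤ B) (hH : tnorm 1 m' H ≤ B)
    (hT' : tnorm 1 m' (T' - T) ≤ δ) (hV : ∀ i, m ≤ i → PowerSeries.coeff i V = 0)
    (hE : tnorm 1 m (H - V) ≤ ε) (hε : ε ≤ 1) :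
    tnorm 1 m' (H - V * (2 - T' * V)) ≤ 6 * B ^ 2 * ε + 4 * B ^ 2 * δ := by
  have h0 : (0 : ℝ) ≤ 1 := zero_le_one
  have hε0 : 0 ≤ ε := (tnorm_nonneg h0).trans hE
  have hδ0 : 0 ≤ δ := (tnorm_nonneg h0).trans hT'
  have hVn : tnorm 1 m' V ≤ 2 * B := by
    rw [tnorm_eq_of_support hmm' hV]
    have h1 : V = H - (H - V) := by ring
    rw [h1]
    have := tnorm_sub_le (m := m) (f := H) (g := H - V) h0
    have := tnorm_mono (f := H) h0 hmm'
    linarith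
  have hEn : tnorm 1 m' (H - V) ≤ 3 * B := by
    have := tnorm_sub_le (m := m') (f := H) (g := V) h0
    linarith
  -- The first term is the quadratic Newton error. Above degree m the series H - V is merely
  -- bounded, so in degrees below 2m its square is only linear in ε, by `tnorm_mul_self_le`.
  have hid : H - V * (2 - T' * V) = T * ((H - V) * (H - V)) + (T' - T) * (V * V) := by
    linear_combination (-(H - 2 * V)) * hTH
  rw [hid]
  refine (tnorm_add_le h0).trans (add_le_add ?_ ?_)
  · calc _ ≤ tnorm 1 m' T * tnorm 1 m' ((H - V) * (H - V)) := tnorm_mul_le h0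
      _ ≤ B * (2 * ε * (3 * B)) := by
        refine mul_le_mul hT ((tnorm_mul_self_le h0 hm').trans ?_) (tnorm_nonneg h0) (by linarith)
        exact mul_le_mul (by linarith) hEn (tnorm_nonneg h0) (by positivity)
      _ = _ := by ring
  · calc _ ≤ tnorm 1 m' (T' - T) * tnorm 1 m' (V * V) := tnorm_mul_le h0
      _ ≤ δ * (2 * B * (2 * B)) := by
        refine mul_le_mul hT' ((tnorm_mul_le h0).trans ?_) (tnorm_nonneg h0) hδ0
        exact mul_le_mul hVn hVn (tnorm_nonneg h0) (by positivity)
      _ = _ := by ring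

section newton

variable {n P : ℕ} {τ : GaussianInt[X]} {T H : PowerSeries ℂ} {B η : ℝ}

theorem coeff_newtonIter_of_le (k : ℕ) {i : ℕ} (hi : min (2 ^ k) (n + 1) ≤ i) :
    (newtonIter n P τ k).coeff i = 0 := by
  cases k with
  | zero =>
    rw [newtonIter, coeff_C, if_neg]
    rw [pow_zero, min_eq_left (by omega)] at hi
    omega
  | succ k => rw [newtonIter, coeff_pround, if_neg (by omega)]

theorem coeff_scaled_newtonIter_of_le (k : ℕ) {i : ℕ} (hi : min (2 ^ k) (n + 1) ≤ i) :
    PowerSeries.coeff i (scaled P (newtonIter n P τ k)) = 0 := by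
  rw [coeff_scaled, coeff_newtonIter_of_le k hi]; simp

theorem tnorm_newtonPre_le (hTH : T * H = 1) (hB : 1 ≤ B) (hT : tnorm 1 (n + 1) T ≤ B)
    (hH : tnorm 1 (n + 1) H ≤ B)
    (hτ : ∀ i ≤ n, ‖PowerSeries.coeff i (scaled P τ - T)‖ ≤ 3 * η) {k : ℕ} {ε : ℝ}
    (hE : tnorm 1 (min (2 ^ k) (n + 1)) (H - scaled P (newtonIter n P τ k)) ≤ ε) (hε : ε ≤ 1) :
    tnorm 1 (min (2 ^ (k + 1)) (n + 1)) (H - scaled P (newtonIter n P τ k) *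
      (2 - scaled P τ * scaled P (newtonIter n P τ k))) ≤
      6 * B ^ 2 * ε + 12 * B ^ 2 * (n + 1) * η := by
  have h0 : (0 : ℝ) ≤ 1 := zero_le_one
  have hη : 0 ≤ η := by linarith [(norm_nonneg _).trans (hτ 0 (Nat.zero_le _))]
  have hle : min (2 ^ (k + 1)) (n + 1) ≤ n + 1 := min_le_right _ _
  have hpow : 2 ^ (k + 1) = 2 * 2 ^ k := by ring
  have hpos : 0 < 2 ^ k := by positivity
  refine (tnorm_newton_le (T := T) (δ := (n + 1) * (3 * η)) hTH hB (by omega) (by omega)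
    ((tnorm_mono h0 hle).trans hT) ((tnorm_mono h0 hle).trans hH) ?_
    (fun i hi => coeff_scaled_newtonIter_of_le k hi) hE hε).trans (le_of_eq (by ring))
  refine (tnorm_mono h0 hle).trans ?_
  exact_mod_cast tnorm_le_of_coeff_le (m := n + 1) fun i hi => hτ i (by omega)

/-- The error of the Newton iteration. -/
theorem tnorm_newtonIter_le (hTH : T * H = 1) (hH0 : PowerSeries.coeff 0 H = 1) (hB : 1 ≤ B)
    (hT : tnorm 1 (n + 1) T ≤ B) (hH : tnorm 1 (n + 1) H ≤ B)
    (hτ : ∀ i ≤ n, ‖PowerSeries.coeff i (scaled P τ - T)‖ ≤ 3 * η)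
    (hP : ((2 : ℝ) ^ P)⁻¹ ≤ η) {K : ℕ} (hK : (28 * B ^ 2 * (n + 1)) ^ K * η ≤ 1) :
    ∀ k ≤ K, tnorm 1 (min (2 ^ k) (n + 1)) (H - scaled P (newtonIter n P τ k)) ≤
      (28 * B ^ 2 * (n + 1)) ^ k * η := by
  have h0 : (0 : ℝ) ≤ 1 := zero_le_one
  have hη : 0 ≤ η := le_trans (by positivity) hP
  set D : ℝ := 28 * B ^ 2 * (n + 1) with hD
  have hB2 : 1 ≤ B ^ 2 := one_le_pow₀ hB
  have hD1 : 1 ≤ D := by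
    have : (0 : ℝ) ≤ n := Nat.cast_nonneg n
    nlinarith
  intro k hk
  induction k with
  | zero =>
    have h1 : min (2 ^ 0) (n + 1) = 1 := by simp
    rw [h1, tnorm, Finset.sum_range_one]
    -- The iteration starts from 1, which is exactly the constant term of H.
    have h2 : PowerSeries.coeff 0 (H - scaled P (newtonIter n P τ 0)) = 0 := by
      rw [map_sub, hH0, coeff_scaled, newtonIter, coeff_C_zero, map_pow, map_ofNat,
        div_self (pow_ne_zero _ two_ne_zero), sub_self]
    rw [h2]
    simpa using hη
  | succ k ih =>
    have h1 := ih (by omega)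
    have h2 : D ^ k * η ≤ 1 := (mul_le_mul_of_nonneg_right
      (pow_le_pow_right₀ hD1 (by omega)) hη).trans hK
    have h3 := tnorm_newtonPre_le hTH hB hT hH hτ h1 h2
    set W := scaled P (newtonIter n P τ k) * (2 - scaled P τ * scaled P (newtonIter n P τ k)) with hW
    set m' := min (2 ^ (k + 1)) (n + 1) with hm'
    -- Rounding moves each coefficient by at most two units of 2^(-P), one for each of its two
    -- parts.
    have h4 : tnorm 1 m' (W - scaled P (newtonIter n P τ (k + 1))) ≤ m' * (2 * η) := by
      refine tnorm_le_of_coeff_le fun i hi => ?_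
      have h5 := coeff_newtonPre n P τ (newtonIter n P τ k) (i := i) (by omega)
      rw [← hW] at h5
      have h6 := GaussianInt.norm_shr_sub_le (2 * P) ((newtonPre n P τ (newtonIter n P τ k)).coeff i)
      rw [map_sub, coeff_scaled, newtonIter, coeff_pround, if_pos hi]
      rw [h5] at h6
      set z := (GaussianInt.shr (2 * P) ((newtonPre n P τ (newtonIter n P τ k)).coeff i)).toComplex
      set c := PowerSeries.coeff i W
      have h7 : c - z / 2 ^ P = -((z - 2 ^ (3 * P) * c / 2 ^ (2 * P)) * ((2 ^ P : ℂ))⁻¹) := by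
        rw [show 3 * P = P + 2 * P by ring, pow_add]
        field_simp
        ring
      rw [h7, norm_neg, norm_mul, norm_inv, norm_pow, Complex.norm_ofNat]
      exact mul_le_mul h6 hP (by positivity) (by norm_num)
    have h8 : H - scaled P (newtonIter n P τ (k + 1)) =
        (H - W) + (W - scaled P (newtonIter n P τ (k + 1))) := by ring
    have h9 : (m' : ℝ) ≤ n + 1 := by exact_mod_cast min_le_right _ _
    have h10 : 1 ≤ D ^ k := one_le_pow₀ hD1
    have h11 : η ≤ D ^ k * η := by nlinarith
    rw [h8]
    refine (tnorm_add_le h0).trans ((add_le_add h3 h4).trans ?_)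
    have h12 : (m' : ℝ) * (2 * η) ≤ (n + 1) * (2 * η) := by gcongr
    have hn : (0 : ℝ) ≤ n := Nat.cast_nonneg n
    -- The Newton error, the error of the divisor and the rounding contribute 6, 12 and 2 times
    -- B²(n+1)·D^k·η; their sum stays below the 28 in D.
    have h13 : 6 * B ^ 2 * (D ^ k * η) ≤ 6 * (B ^ 2 * (n + 1)) * (D ^ k * η) := by
      have : 0 ≤ B ^ 2 * n * (D ^ k * η) := by positivity
      nlinarith
    have h14 : 12 * B ^ 2 * (n + 1) * η ≤ 12 * (B ^ 2 * (n + 1)) * (D ^ k * η) := by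
      have : 0 ≤ 12 * (B ^ 2 * (n + 1)) := by positivity
      nlinarith [mul_le_mul_of_nonneg_left h11 this]
    have h15 : (n + 1) * (2 * η) ≤ 2 * (B ^ 2 * (n + 1)) * (D ^ k * η) := by
      calc (n + 1) * (2 * η) = 2 * (1 * (n + 1)) * η := by ring
        _ ≤ 2 * (B ^ 2 * (n + 1)) * (D ^ k * η) := by gcongr
    calc _ ≤ 20 * (B ^ 2 * (n + 1)) * (D ^ k * η) := by linarith
      _ ≤ 28 * (B ^ 2 * (n + 1)) * (D ^ k * η) := by gcongr; norm_num
      _ = D ^ (k + 1) * η := by rw [hD]; ring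

end newton

/-! ### Approximate division -/

/-- The reversed approximate quotient, with `2 P` bits after the point. -/
noncomputable def approxRevQuot (n P K : ℕ) (s t : GaussianInt[X]) : GaussianInt[X] :=
  ptrunc (n + 1) (ptrunc (n + 1) (reflect (2 * n) s) * newtonIter n P (reflect n t) K)

/-- The approximate remainder, with `3 P` bits after the point. -/
noncomputable def approxRem (n P K : ℕ) (s t : GaussianInt[X]) : GaussianInt[X] :=
  ptrunc n (C (2 ^ (2 * P)) * s - t * reflect n (approxRevQuot n P K s t))

/-- The parameters of the approximate division of `s` by `t`: the approximations `sI` and `tI`, and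
the bounds `A`, `B`, `η` for the size of `s`, the size of `t` and of its inverse, and the errors. -/
structure DivApprox (n P K : ℕ) (A B η : ℝ) (s t q r : ℂ[X]) (sI tI : GaussianInt[X])
    (H : PowerSeries ℂ) : Prop where
  one_le_A : 1 ≤ A
  one_le_B : 1 ≤ B
  norm_s : ∀ i, ‖s.coeff i‖ ≤ A
  norm_q : ∀ i, ‖q.coeff i‖ ≤ A * B
  norm_r : ∀ i, ‖r.coeff i‖ ≤ A + A * B * B
  natDegree_q : q.natDegree ≤ n
  degree_r : r.degree < n
  eq : s = t * q + r
  mul_inv : ((reflect n t : ℂ[X]) : PowerSeries ℂ) * H = 1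
  inv_zero : PowerSeries.coeff 0 H = 1
  tnorm_inv : tnorm 1 (n + 1) H ≤ B
  tnorm_rev : tnorm 1 (n + 1) (reflect n t : ℂ[X]) ≤ B
  tnorm_t : tnorm 1 (n + 1) t ≤ B
  rev_q : ∀ i ≤ n, (reflect n q).coeff i =
    PowerSeries.coeff i (((reflect (2 * n) s : ℂ[X]) : PowerSeries ℂ) * H)
  -- One η is the error of the given data; the other two pay for rounding them to P bits after the
  -- point.
  err_s : ∀ i, ‖(sI.coeff i).toComplex / 2 ^ P - s.coeff i‖ ≤ 3 * η
  err_t : ∀ i, ‖(tI.coeff i).toComplex / 2 ^ P - t.coeff i‖ ≤ 3 * η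
  inv_two_pow_le : ((2 : ℝ) ^ P)⁻¹ ≤ η
  le_two_pow : n + 1 ≤ 2 ^ K
  -- The left side is the final error bound of the remainder. Together with the next field it keeps
  -- all numbers that are rounded or returned below 2^(4P).
  small : 34 * (n + 1) * A * B ^ 2 * ((28 * B ^ 2 * (n + 1)) ^ K * η) ≤ 1
  large : A + A * B * B + 1 ≤ 2 ^ P

namespace DivApprox

variable {n P K : ℕ} {A B η : ℝ} {s t q r : ℂ[X]} {sI tI : GaussianInt[X]} {H : PowerSeries ℂ}

theorem eta_nonneg (h : DivApprox n P K A B η s t q r sI tI H) : 0 ≤ η :=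
  le_trans (by positivity) h.inv_two_pow_le

theorem one_le_D (h : DivApprox n P K A B η s t q r sI tI H) : 1 ≤ 28 * B ^ 2 * (n + 1) := by
  have hB2 : 1 ≤ B ^ 2 := one_le_pow₀ h.one_le_B
  have : (0 : ℝ) ≤ n := Nat.cast_nonneg n
  nlinarith

theorem eta_le (h : DivApprox n P K A B η s t q r sI tI H) :
    η ≤ (28 * B ^ 2 * (n + 1)) ^ K * η := by
  have h1 := one_le_pow₀ (n := K) h.one_le_D
  nlinarith [h.eta_nonneg]

theorem eps_le_one (h : DivApprox n P K A B η s t q r sI tI H) :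
    (28 * B ^ 2 * (n + 1)) ^ K * η ≤ 1 := by
  refine le_trans ?_ h.small
  have h1 := h.eta_nonneg.trans h.eta_le
  have hB2 : 1 ≤ B ^ 2 := one_le_pow₀ h.one_le_B
  have hn : (0 : ℝ) ≤ n := Nat.cast_nonneg n
  have h2 : (1 : ℝ) ≤ 34 * (n + 1) := by linarith
  have h3 : 1 ≤ 34 * (n + 1) * A * B ^ 2 :=
    one_le_mul_of_one_le_of_one_le (one_le_mul_of_one_le_of_one_le h2 h.one_le_A) hB2
  exact le_mul_of_one_le_left h1 h3

theorem err_rev (h : DivApprox n P K A B η s t q r sI tI H) (i : ℕ) :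
    ‖PowerSeries.coeff i (scaled P (reflect n tI) - ((reflect n t : ℂ[X]) : PowerSeries ℂ))‖ ≤
      3 * η := by
  rw [map_sub, coeff_scaled, Polynomial.coeff_coe, coeff_reflect, coeff_reflect]
  exact h.err_t _

theorem tnorm_newton (h : DivApprox n P K A B η s t q r sI tI H) {k : ℕ} (hk : k ≤ K) :
    tnorm 1 (min (2 ^ k) (n + 1)) (H - scaled P (newtonIter n P (reflect n tI) k)) ≤
      (28 * B ^ 2 * (n + 1)) ^ k * η :=
  tnorm_newtonIter_le h.mul_inv h.inv_zero h.one_le_B h.tnorm_rev h.tnorm_inv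
    (fun i _ => h.err_rev i) h.inv_two_pow_le h.eps_le_one k hk

/-- The numbers to be rounded in the Newton iteration are small. -/
theorem norm_newtonPre_le (h : DivApprox n P K A B η s t q r sI tI H) {k : ℕ} (hk : k < K) {i : ℕ}
    (hi : i < min (2 ^ (k + 1)) (n + 1)) :
    ‖((newtonPre n P (reflect n tI) (newtonIter n P (reflect n tI) k)).coeff i).toComplex‖ ≤
      2 ^ (4 * P) := by
  have hB := h.one_le_B
  have hA := h.one_le_A
  have hn : (0 : ℝ) ≤ n := Nat.cast_nonneg n
  have hD := h.one_le_D
  have hη := h.eta_nonneg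
  have hεK := h.eps_le_one
  have hB2 : 1 ≤ B ^ 2 := one_le_pow₀ hB
  have hk1 := h.tnorm_newton hk.le
  have hlt : (28 * B ^ 2 * (n + 1)) ^ (k + 1) * η ≤ 1 :=
    (mul_le_mul_of_nonneg_right (pow_le_pow_right₀ hD hk) hη).trans hεK
  have hle : (28 * B ^ 2 * (n + 1)) ^ k * η ≤ (28 * B ^ 2 * (n + 1)) ^ (k + 1) * η :=
    mul_le_mul_of_nonneg_right (pow_le_pow_right₀ hD (by omega)) hη
  have h1 := tnorm_newtonPre_le h.mul_inv hB h.tnorm_rev h.tnorm_inv (fun i _ => h.err_rev i)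
    hk1 (hle.trans hlt)
  have hη2 : η ≤ (28 * B ^ 2 * (n + 1)) ^ k * η := by
    have h1 := one_le_pow₀ (n := k) hD
    nlinarith
  -- The unrounded step is within 1 of H, whose coefficients are at most B, and B + 1 ≤ 2^P.
  have h2 : 6 * B ^ 2 * ((28 * B ^ 2 * (n + 1)) ^ k * η) + 12 * B ^ 2 * (n + 1) * η ≤ 1 := by
    refine le_trans ?_ hlt
    rw [pow_succ' (28 * B ^ 2 * (n + 1) : ℝ), mul_assoc (28 * B ^ 2 * (n + 1) : ℝ)]
    set e := (28 * B ^ 2 * (n + 1)) ^ k * η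
    have h3 : 12 * B ^ 2 * (n + 1) * η ≤ 12 * B ^ 2 * (n + 1) * e := by gcongr
    have h4 : 0 ≤ B ^ 2 * n * e := by positivity
    have h5 : 0 ≤ B ^ 2 * e := by positivity
    nlinarith
  have h3 := (norm_coeff_le_tnorm hi).trans (h1.trans h2)
  rw [map_sub] at h3
  have h4 := (norm_coeff_le_tnorm (f := H) (lt_of_lt_of_le hi (min_le_right _ _))).trans h.tnorm_inv
  rw [coeff_newtonPre _ _ _ _ (lt_of_lt_of_le hi (min_le_right _ _)), norm_mul, norm_pow,
    Complex.norm_ofNat, show 4 * P = 3 * P + P by ring, pow_add]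
  gcongr
  refine le_trans ?_ h.large
  set c := PowerSeries.coeff i (scaled P (newtonIter n P (reflect n tI) k) *
      (2 - scaled P (reflect n tI) * scaled P (newtonIter n P (reflect n tI) k)))
  have h5 : ‖c‖ ≤ ‖PowerSeries.coeff i H‖ + ‖PowerSeries.coeff i H - c‖ := by
    have := norm_sub_le (PowerSeries.coeff i H) (PowerSeries.coeff i H - c)
    rwa [sub_sub_cancel] at this
  have h6 : B ≤ A * B * B := by
    have : 1 ≤ A * B := one_le_mul_of_one_le_of_one_le hA hB
    nlinarith
  linarith

theorem coeff_approxRevQuot {i : ℕ} (hi : i ≤ n) :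
    ((approxRevQuot n P K sI tI).coeff i).toComplex / 2 ^ (2 * P) =
      PowerSeries.coeff i (scaled P (reflect (2 * n) sI) *
        scaled P (newtonIter n P (reflect n tI) K)) := by
  have h1 : (approxRevQuot n P K sI tI).coeff i =
      (reflect (2 * n) sI * newtonIter n P (reflect n tI) K).coeff i := by
    rw [approxRevQuot, coeff_ptrunc, if_pos (by omega), mul_comm, coeff_mul_ptrunc _ _ _ (by omega),
      mul_comm]
  rw [h1, ← coeff_map, ← Polynomial.coeff_coe, Polynomial.map_mul, Polynomial.coe_mul,
    coe_map_eq_scaled P, coe_map_eq_scaled P (newtonIter n P (reflect n tI) K),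
    mul_mul_mul_comm, ← map_mul, PowerSeries.coeff_C_mul, ← pow_add,
    ← two_mul]
  field_simp

/-- With V the computed inverse and S' the rounded S, the error is S(H - V) + (S - S')V. The terms
are at most A·ε and 3η·2B, where ε = D^K·η is the final Newton error. -/
theorem err_revQuot (h : DivApprox n P K A B η s t q r sI tI H) {i : ℕ} (hi : i ≤ n) :
    ‖(reflect n q).coeff i - ((approxRevQuot n P K sI tI).coeff i).toComplex / 2 ^ (2 * P)‖ ≤
      7 * A * B * ((28 * B ^ 2 * (n + 1)) ^ K * η) := by
  have hB := h.one_le_B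
  have hA := h.one_le_A
  have hE := h.tnorm_newton le_rfl
  rw [min_eq_right h.le_two_pow] at hE
  have hηε := h.eta_le
  have hη := h.eta_nonneg
  have hε := h.eps_le_one
  set ε := (28 * B ^ 2 * (n + 1)) ^ K * η
  set V := scaled P (newtonIter n P (reflect n tI) K)
  have hV : tnorm 1 (n + 1) V ≤ 2 * B := by
    have h1 : V = H - (H - V) := by ring
    rw [h1]
    have := tnorm_sub_le (m := n + 1) (f := H) (g := H - V) zero_le_one
    have := h.tnorm_inv
    linarith
  rw [coeff_approxRevQuot hi, h.rev_q i hi, ← map_sub]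
  have h1 : ((reflect (2 * n) s : ℂ[X]) : PowerSeries ℂ) * H - scaled P (reflect (2 * n) sI) * V =
      ((reflect (2 * n) s : ℂ[X]) : PowerSeries ℂ) * (H - V) +
      (((reflect (2 * n) s : ℂ[X]) : PowerSeries ℂ) - scaled P (reflect (2 * n) sI)) * V := by ring
  rw [h1, map_add]
  refine (norm_add_le _ _).trans ?_
  have h2 := norm_coeff_mul_le (f := ((reflect (2 * n) s : ℂ[X]) : PowerSeries ℂ)) (g := H - V)
    (c := A) (m := n + 1) (i := i) (fun j _ => by
      rw [Polynomial.coeff_coe, coeff_reflect]; exact h.norm_s _) (by omega)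
  have h3 := norm_coeff_mul_le
    (f := ((reflect (2 * n) s : ℂ[X]) : PowerSeries ℂ) - scaled P (reflect (2 * n) sI)) (g := V)
    (c := 3 * η) (m := n + 1) (i := i) (fun j _ => by
      rw [map_sub, Polynomial.coeff_coe, coeff_scaled, coeff_reflect, coeff_reflect, norm_sub_rev]
      exact h.err_s _) (by omega)
  have h4 : A * tnorm 1 (n + 1) (H - V) ≤ A * B * ε := by
    calc A * tnorm 1 (n + 1) (H - V) ≤ A * ε := by gcongr
      _ ≤ A * B * ε := by
        have : 0 ≤ A * ε := by positivity
        nlinarith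
  have h5 : 3 * η * tnorm 1 (n + 1) V ≤ 6 * A * B * ε := by
    calc 3 * η * tnorm 1 (n + 1) V ≤ 3 * ε * (2 * B) := by
          refine mul_le_mul (by linarith) hV (tnorm_nonneg zero_le_one) (by linarith)
      _ = 6 * (B * ε) := by ring
      _ ≤ 6 * (A * (B * ε)) := by
        have : 0 ≤ B * ε := by positivity
        nlinarith
      _ = _ := by ring
  linarith

theorem err_quot (h : DivApprox n P K A B η s t q r sI tI H) (i : ℕ) :
    ‖q.coeff i - ((reflect n (approxRevQuot n P K sI tI)).coeff i).toComplex / 2 ^ (2 * P)‖ ≤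
      7 * A * B * ((28 * B ^ 2 * (n + 1)) ^ K * η) := by
  have hB := h.one_le_B
  have hA := h.one_le_A
  by_cases hi : i ≤ n
  · have h1 := h.err_revQuot (i := n - i) (by omega)
    rwa [coeff_reflect, revAt_le (by omega), Nat.sub_sub_self hi, ← Nat.sub_sub_self hi,
      ← revAt_le (show n - (n - i) ≤ n by omega), ← coeff_reflect, Nat.sub_sub_self hi] at h1
  · rw [coeff_eq_zero_of_natDegree_lt (by have := h.natDegree_q; omega), coeff_reflect,
      revAt_eq_self_of_lt (by omega), approxRevQuot, coeff_ptrunc, if_neg (by omega)]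
    have := h.eta_nonneg
    simp only [map_zero, zero_div, sub_zero, norm_zero]
    positivity

/-- With the computed quotient Q and the rounded t', the error of s - tq splits into that of s, (q -
Q)t and (t' - t)Q, in units of A·B²·ε at most 3, 7 and 24(n+1). The factor n + 1 arises because Q is
bounded only coefficient by coefficient. -/
theorem err_rem (h : DivApprox n P K A B η s t q r sI tI H) (i : ℕ) :
    ‖r.coeff i - ((approxRem n P K sI tI).coeff i).toComplex / 2 ^ (3 * P)‖ ≤
      34 * (n + 1) * A * B ^ 2 * ((28 * B ^ 2 * (n + 1)) ^ K * η) := by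
  have hB := h.one_le_B
  have hA := h.one_le_A
  have hηε := h.eta_le
  have hη := h.eta_nonneg
  have hε := h.eps_le_one
  have herr := h.err_quot
  have hn : (0 : ℝ) ≤ n := Nat.cast_nonneg n
  set ε := (28 * B ^ 2 * (n + 1)) ^ K * η
  have hε0 : 0 ≤ ε := hη.trans hηε
  by_cases hi : i < n
  swap
  · rw [coeff_eq_zero_of_degree_lt (h.degree_r.trans_le (by exact_mod_cast not_lt.mp hi)),
      approxRem, coeff_ptrunc, if_neg hi]
    simp only [map_zero, zero_div, sub_zero, norm_zero]
    positivity
  set Q := reflect n (approxRevQuot n P K sI tI)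
  have h1 : ((approxRem n P K sI tI).coeff i).toComplex / 2 ^ (3 * P) =
      (sI.coeff i).toComplex / 2 ^ P - PowerSeries.coeff i (scaled P tI * scaled (2 * P) Q) := by
    have h2 : PowerSeries.coeff i (scaled P tI * scaled (2 * P) Q) =
        ((tI * Q).coeff i).toComplex / 2 ^ (3 * P) := by
      rw [← coeff_map, ← Polynomial.coeff_coe, Polynomial.map_mul, Polynomial.coe_mul,
        coe_map_eq_scaled P, coe_map_eq_scaled (2 * P) Q, mul_mul_mul_comm, ← map_mul,
        PowerSeries.coeff_C_mul, ← pow_add, show P + 2 * P = 3 * P by ring]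
      field_simp
    rw [h2, approxRem, coeff_ptrunc, if_pos hi, coeff_sub, coeff_C_mul, map_sub, map_mul, map_pow,
      map_ofNat, sub_div, show 3 * P = 2 * P + P by ring, pow_add (2 : ℂ) (2 * P) P,
      mul_div_mul_left _ _ (pow_ne_zero _ two_ne_zero)]
  have h3 : r.coeff i = s.coeff i - PowerSeries.coeff i ((t : PowerSeries ℂ) * (q : PowerSeries ℂ)) := by
    rw [← Polynomial.coe_mul, Polynomial.coeff_coe]
    conv_rhs => rw [h.eq]
    rw [coeff_add]; ring
  have h4 : r.coeff i - ((approxRem n P K sI tI).coeff i).toComplex / 2 ^ (3 * P) =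
      -((sI.coeff i).toComplex / 2 ^ P - s.coeff i) -
      PowerSeries.coeff i (((q : PowerSeries ℂ) - scaled (2 * P) Q) * (t : PowerSeries ℂ)) +
      PowerSeries.coeff i ((scaled P tI - (t : PowerSeries ℂ)) * scaled (2 * P) Q) := by
    rw [h1, h3, sub_mul, sub_mul, map_sub, map_sub, mul_comm (t : PowerSeries ℂ) q,
      mul_comm (scaled (2 * P) Q) (t : PowerSeries ℂ)]
    ring
  have hqc : ∀ j, ‖PowerSeries.coeff j ((q : PowerSeries ℂ) - scaled (2 * P) Q)‖ ≤ 7 * A * B * ε := by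
    intro j
    rw [map_sub, Polynomial.coeff_coe, coeff_scaled]
    exact herr j
  have h5 := norm_coeff_mul_le (f := (q : PowerSeries ℂ) - scaled (2 * P) Q)
    (g := (t : PowerSeries ℂ)) (c := 7 * A * B * ε) (m := n + 1) (i := i) (fun j _ => hqc j) (by omega)
  have h6 := norm_coeff_mul_le (f := scaled P tI - (t : PowerSeries ℂ)) (g := scaled (2 * P) Q)
    (c := 3 * η) (m := n + 1) (i := i) (fun j _ => by
      rw [map_sub, Polynomial.coeff_coe, coeff_scaled]; exact h.err_t j) (by omega)
  have h7 : tnorm 1 (n + 1) (scaled (2 * P) Q) ≤ (n + 1) * (8 * A * B) := by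
    have := tnorm_le_of_coeff_le (m := n + 1) (f := scaled (2 * P) Q) (c := 8 * A * B) fun j _ => by
      have e1 := hqc j
      have e2 := h.norm_q j
      rw [map_sub, Polynomial.coeff_coe] at e1
      have e3 := norm_sub_le (q.coeff j) (q.coeff j - PowerSeries.coeff j (scaled (2 * P) Q))
      rw [sub_sub_cancel] at e3
      have e4 : 7 * A * B * ε ≤ 7 * A * B * 1 := by gcongr
      linarith
    exact_mod_cast this
  have h8 : 7 * A * B * ε * tnorm 1 (n + 1) (t : PowerSeries ℂ) ≤ 7 * (A * B ^ 2 * ε) := by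
    calc _ ≤ 7 * A * B * ε * B := by gcongr; exact h.tnorm_t
      _ = _ := by ring
  have h9 : 3 * η * tnorm 1 (n + 1) (scaled (2 * P) Q) ≤ 24 * (n + 1) * (A * B ^ 2 * ε) := by
    calc _ ≤ 3 * ε * ((n + 1) * (8 * A * B)) :=
          mul_le_mul (by linarith) h7 (tnorm_nonneg zero_le_one) (by positivity)
      _ = 24 * (n + 1) * (A * B * ε) := by ring
      _ ≤ 24 * (n + 1) * (A * B ^ 2 * ε) := by
          gcongr
          exact le_self_pow₀ hB (by norm_num)
  have h10 := h.err_s i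
  have h11 : ε ≤ A * B ^ 2 * ε := by
    have : 1 ≤ A * B ^ 2 := one_le_mul_of_one_le_of_one_le hA (one_le_pow₀ hB)
    nlinarith
  rw [h4]
  refine (norm_add_le _ _).trans ((add_le_add_left (norm_sub_le _ _) _).trans ?_)
  rw [norm_neg]
  have h12 : 0 ≤ n * (A * B ^ 2 * ε) := by positivity
  have h13 : 34 * (n + 1) * A * B ^ 2 * ε = 34 * (n * (A * B ^ 2 * ε)) + 34 * (A * B ^ 2 * ε) := by
    ring
  rw [h13]
  linarith

theorem quot_eps_le (h : DivApprox n P K A B η s t q r sI tI H) :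
    7 * A * B * ((28 * B ^ 2 * (n + 1)) ^ K * η) ≤
      34 * (n + 1) * A * B ^ 2 * ((28 * B ^ 2 * (n + 1)) ^ K * η) := by
  have hB := h.one_le_B
  have hA := h.one_le_A
  have hε0 := h.eta_nonneg.trans h.eta_le
  have hn : (0 : ℝ) ≤ n := Nat.cast_nonneg n
  set ε := (28 * B ^ 2 * (n + 1)) ^ K * η
  calc 7 * A * B * ε ≤ 7 * A * B ^ 2 * ε := by gcongr; exact le_self_pow₀ hB (by norm_num)
    _ ≤ 34 * (n + 1) * A * B ^ 2 * ε := by gcongr; linarith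

/-- The factor 2^P brings the quotient to the scale 3P of the remainder. The bound ensures that the
residue determines the output integer. -/
theorem norm_approxRevQuot_le (h : DivApprox n P K A B η s t q r sI tI H) (i : ℕ) :
    ‖((reflect n (approxRevQuot n P K sI tI)).coeff i * 2 ^ P).toComplex‖ ≤ 2 ^ (4 * P) := by
  have h1 := (h.err_quot i).trans (h.quot_eps_le.trans h.small)
  have h2 := h.norm_q i
  have h3 := h.large
  have hA := h.one_le_A
  have hB := h.one_le_B
  set z := ((reflect n (approxRevQuot n P K sI tI)).coeff i).toComplex
  have h4 : ‖z / 2 ^ (2 * P)‖ ≤ 2 ^ P := by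
    have e3 := norm_sub_le (q.coeff i) (q.coeff i - z / 2 ^ (2 * P))
    rw [sub_sub_cancel] at e3
    have : A * B ≤ A * B * B := by
      have : 0 ≤ A * B := by positivity
      nlinarith
    linarith
  rw [norm_div, norm_pow, Complex.norm_ofNat, div_le_iff₀ (by positivity)] at h4
  rw [map_mul, map_pow, map_ofNat, norm_mul, norm_pow, Complex.norm_ofNat]
  calc ‖z‖ * 2 ^ P ≤ 2 ^ P * 2 ^ (2 * P) * 2 ^ P := by gcongr
    _ = 2 ^ (4 * P) := by ring

theorem norm_approxRem_le (h : DivApprox n P K A B η s t q r sI tI H) (i : ℕ) :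
    ‖((approxRem n P K sI tI).coeff i).toComplex‖ ≤ 2 ^ (4 * P) := by
  have h1 := (h.err_rem i).trans h.small
  have h2 := h.norm_r i
  have h3 := h.large
  set z := ((approxRem n P K sI tI).coeff i).toComplex
  have h4 : ‖z / 2 ^ (3 * P)‖ ≤ 2 ^ P := by
    have e3 := norm_sub_le (r.coeff i) (r.coeff i - z / 2 ^ (3 * P))
    rw [sub_sub_cancel] at e3
    linarith
  rw [norm_div, norm_pow, Complex.norm_ofNat, div_le_iff₀ (by positivity)] at h4
  calc ‖z‖ ≤ 2 ^ P * 2 ^ (3 * P) := h4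
    _ = 2 ^ (4 * P) := by ring

end DivApprox

/-! ### The choice of the precision -/

theorem one_le_lg {n : ℕ} (hn : 2 ≤ n) : 1 ≤ lg n := by
  rw [lg, Real.le_logb_iff_rpow_le (by norm_num) (by positivity), Real.rpow_one]
  exact_mod_cast hn

theorem two_rpow_lg {n : ℕ} (hn : 1 ≤ n) : (2 : ℝ) ^ lg n = n :=
  Real.rpow_logb (by norm_num) (by norm_num) (by positivity)

theorem clog_succ_le_two_mul_lg {n : ℕ} (hn : 2 ≤ n) : (Nat.clog 2 (n + 1) : ℝ) ≤ 2 * lg n := by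
  have h1 := Nat.pow_pred_clog_lt_self (b := 2) (by norm_num) (x := n + 1) (by omega)
  have h2 : 0 < Nat.clog 2 (n + 1) := Nat.clog_pos (by norm_num) (by omega)
  obtain ⟨k, hk⟩ : ∃ k, Nat.clog 2 (n + 1) = k + 1 := ⟨_, (Nat.succ_pred_eq_of_pos h2).symm⟩
  rw [hk] at h1 ⊢
  have h3 : (k : ℝ) ≤ lg n := by
    rw [lg, Real.le_logb_iff_rpow_le (by norm_num) (by positivity), Real.rpow_natCast]
    exact_mod_cast Nat.lt_succ_iff.mp h1
  have := one_le_lg hn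
  push_cast
  linarith

theorem lg_le_self {n : ℕ} (hn : 1 ≤ n) : lg n ≤ n := by
  rw [lg, Real.logb_le_iff_le_rpow (by norm_num) (by positivity), Real.rpow_natCast]
  exact_mod_cast Nat.lt_two_pow_self.le

/-- In binary logarithms, each of the at most 2 lg n Newton steps loses 5 + 2n(ρ+2) + lg n + 1 bits,
and the last two products lose 6 + lg n + 1 + τ₁ + 2n(ρ+2) more. -/
theorem precision_suffices {n : ℕ} (hn : 2 ≤ n) {ℓ τ₁ τ₂ ρ : ℝ} (hτ₂ : 0 ≤ τ₂) (hρ : 1 ≤ ρ) :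
    34 * (n + 1) * 2 ^ τ₁ * ((2 : ℝ) ^ (n * (ρ + 2))) ^ 2 *
      ((28 * ((2 : ℝ) ^ (n * (ρ + 2))) ^ 2 * (n + 1)) ^ Nat.clog 2 (n + 1) *
        2 ^ (-divPrecision n ℓ τ₁ τ₂ ρ)) ≤ 2 ^ (-ℓ) := by
  have hlg := one_le_lg hn
  have hn1 : (n : ℝ) + 1 ≤ 2 ^ (lg n + 1) := by
    rw [Real.rpow_add_one (by norm_num), two_rpow_lg (by omega)]
    have : (2 : ℝ) ≤ n := by exact_mod_cast hn
    linarith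
  have hB : ((2 : ℝ) ^ (n * (ρ + 2))) ^ 2 = 2 ^ (2 * n * (ρ + 2)) := by
    rw [← Real.rpow_mul_natCast (by norm_num)]; congr 1; push_cast; ring
  have h34 : (34 : ℝ) ≤ 2 ^ (6 : ℝ) := by norm_num
  have h28 : (28 : ℝ) ≤ 2 ^ (5 : ℝ) := by norm_num
  have hK := clog_succ_le_two_mul_lg hn
  rw [hB]
  set K := Nat.clog 2 (n + 1)
  have hD : (28 * (2 : ℝ) ^ (2 * n * (ρ + 2)) * (n + 1)) ^ K ≤
      2 ^ ((5 + 2 * n * (ρ + 2) + (lg n + 1)) * K) := by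
    rw [Real.rpow_mul_natCast (by norm_num), Real.rpow_add (by norm_num),
      Real.rpow_add (by norm_num)]
    gcongr
  calc _ ≤ (2 : ℝ) ^ (6 : ℝ) * 2 ^ (lg n + 1) * 2 ^ τ₁ * 2 ^ (2 * n * (ρ + 2)) *
        (2 ^ ((5 + 2 * n * (ρ + 2) + (lg n + 1)) * K) * 2 ^ (-divPrecision n ℓ τ₁ τ₂ ρ)) := by
        gcongr
    _ = (2 : ℝ) ^ (6 + (lg n + 1) + τ₁ + 2 * n * (ρ + 2) +
        ((5 + 2 * n * (ρ + 2) + (lg n + 1)) * K + -divPrecision n ℓ τ₁ τ₂ ρ)) := by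
        simp only [← Real.rpow_add (show (0 : ℝ) < 2 by norm_num)]
    _ ≤ _ := by
        refine Real.rpow_le_rpow_of_exponent_le (by norm_num) ?_
        have hn2 : (2 : ℝ) ≤ n := by exact_mod_cast hn
        have h1 : (5 + 2 * n * (ρ + 2) + (lg n + 1)) * K ≤
            (5 + 2 * n * (ρ + 2) + (lg n + 1)) * (2 * lg n) := by
          gcongr
        rw [divPrecision]
        have h2 : 0 ≤ τ₂ * lg n := by positivity
        have h3 : lg n ≤ lg n ^ 2 := by nlinarith
        have h4 : n * ρ ≤ n * ρ * lg n := le_mul_of_one_le_right (by positivity) hlg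
        have h5 : (n : ℝ) ≤ n * lg n := le_mul_of_one_le_right (by positivity) hlg
        -- The losses include up to 6nρ lg n + 12n lg n, against 10(ρ+1)n lg n in λ; ρ ≥ 1 moves the
        -- excess 2n lg n to the first term.
        have h6 : n * lg n ≤ n * ρ * lg n := by
          have : (n : ℝ) ≤ n * ρ := le_mul_of_one_le_right (by positivity) hρ
          gcongr
        nlinarith

theorem size_le_precision {n : ℕ} (hn : 2 ≤ n) {ℓ τ₁ τ₂ ρ : ℝ} (hℓ : 0 ≤ ℓ) (hτ₁ : 0 ≤ τ₁)
    (hτ₂ : 0 ≤ τ₂) (hρ : 1 ≤ ρ) :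
    (2 : ℝ) ^ τ₁ + 2 ^ τ₁ * 2 ^ (n * (ρ + 2)) * 2 ^ (n * (ρ + 2)) + 1 ≤
      2 ^ divPrecision n ℓ τ₁ τ₂ ρ := by
  have hlg := one_le_lg hn
  have hn2 : (2 : ℝ) ≤ n := by exact_mod_cast hn
  have h0 : τ₁ + n * (ρ + 2) + n * (ρ + 2) + 2 ≤ divPrecision n ℓ τ₁ τ₂ ρ := by
    rw [divPrecision]
    have h2 : 0 ≤ τ₂ * lg n := by positivity
    have h5 : n * (ρ + 1) ≤ n * (ρ + 1) * lg n := le_mul_of_one_le_right (by positivity) hlg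
    nlinarith
  have hnρ : 0 ≤ n * (ρ + 2) := by positivity
  have h1 : (2 : ℝ) ^ τ₁ ≤ 2 ^ (τ₁ + n * (ρ + 2) + n * (ρ + 2)) :=
    Real.rpow_le_rpow_of_exponent_le (by norm_num) (by linarith)
  have h2 : (1 : ℝ) ≤ 2 ^ (τ₁ + n * (ρ + 2) + n * (ρ + 2)) :=
    Real.one_le_rpow (by norm_num) (by linarith)
  rw [← Real.rpow_add (by norm_num), ← Real.rpow_add (by norm_num)]
  refine le_trans ?_ (Real.rpow_le_rpow_of_exponent_le (by norm_num) h0)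
  rw [Real.rpow_add (by norm_num) _ 2]
  norm_num
  linarith

theorem IsDivision.divApprox {n : ℕ} (hn : 2 ≤ n) {ℓ τ₁ τ₂ ρ : ℝ} (hℓ : 0 ≤ ℓ) (hτ₁ : 0 ≤ τ₁)
    (hτ₂ : 0 ≤ τ₂) (hρ : 1 ≤ ρ) {s t q r : ℂ[X]} (h : IsDivision n τ₁ τ₂ ρ s t q r)
    {sI tI : GaussianInt[X]} {P : ℕ} (hP : divPrecision n ℓ τ₁ τ₂ ρ ≤ P)
    (hs : ∀ i, ‖(sI.coeff i).toComplex / 2 ^ P - s.coeff i‖ ≤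
      3 * 2 ^ (-divPrecision n ℓ τ₁ τ₂ ρ))
    (ht : ∀ i, ‖(tI.coeff i).toComplex / 2 ^ P - t.coeff i‖ ≤
      3 * 2 ^ (-divPrecision n ℓ τ₁ τ₂ ρ)) :
    ∃ H, DivApprox n P (Nat.clog 2 (n + 1)) (2 ^ τ₁) (2 ^ (n * (ρ + 2)))
      (2 ^ (-divPrecision n ℓ τ₁ τ₂ ρ)) s t q r sI tI H := by
  have hρ0 : 0 ≤ ρ := zero_le_one.trans hρ
  obtain ⟨H, h1, h2, h3, h4, h5, h6⟩ := h.exists_inverse hρ0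
  have hle : (2 : ℝ) ^ (n * (ρ + 1)) ≤ 2 ^ (n * (ρ + 2)) :=
    Real.rpow_le_rpow_of_exponent_le (by norm_num) (by gcongr; norm_num)
  refine ⟨H, ⟨Real.one_le_rpow (by norm_num) hτ₁, Real.one_le_rpow (by norm_num) (by positivity),
    supNorm_le_iff_coeff.mp h.norm_s, h.norm_q_le hρ0, fun i => (h.norm_r_le hρ0 i).trans ?_, h5, ?_,
    h.eq, h1, ?_, h2, h3.trans hle, h4.trans hle, h6, hs, ht, ?_, ?_, ?_, ?_⟩⟩
  · gcongr
  · refine h.degree_r.trans_le (degree_le_natDegree.trans ?_)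
    rw [h.natDegree_t]
  -- The constant term of the reversed divisor is the leading coefficient of t, that is 1.
  · have h7 := congrArg (PowerSeries.coeff 0) h1
    rw [PowerSeries.coeff_mul, Finset.Nat.antidiagonal_zero, Finset.sum_singleton,
      Polynomial.coeff_coe, coeff_reflect, revAt_zero] at h7
    have h8 : t.coeff n = 1 := by
      have := h.monic_t.coeff_natDegree
      rwa [h.natDegree_t] at this
    simpa [h8] using h7
  · rw [← Real.rpow_natCast, ← Real.rpow_neg (by norm_num)]
    exact Real.rpow_le_rpow_of_exponent_le (by norm_num) (neg_le_neg hP)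
  · exact Nat.le_pow_clog (by norm_num) _
  · exact (precision_suffices hn hτ₂ hρ).trans
      (Real.rpow_le_one_of_one_le_of_nonpos (by norm_num) (by linarith))
  · refine (size_le_precision hn hℓ hτ₁ hτ₂ hρ).trans ?_
    rw [← Real.rpow_natCast]
    exact Real.rpow_le_rpow_of_exponent_le (by norm_num) hP

/-! ### Circuits for signed integers -/

/-- Integers in two's complement with `w` value bits. -/
abbrev Enc.int (w : ℕ) : Enc := ⟨Fin (w + 1), ℤ, intOfBits⟩

theorem Nat.ofBits_castSucc {w : ℕ} (x : Fin (w + 1) → Bool) :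
    Nat.ofBits x = Nat.ofBits (fun i : Fin w => x i.castSucc) + (x (Fin.last w)).toNat * 2 ^ w := by
  rw [Nat.ofBits_eq_sum, Nat.ofBits_eq_sum, Fin.sum_univ_castSucc]
  simp

/-- A list of wires together with the negation of one of them. -/
theorem CostLE.wiring_not {ι κ : Type} (a : ι) (f : κ → ι ⊕ Unit) :
    CostLE (fun (x : ι → Bool) k => Sum.elim x (fun _ => !x a) (f k)) 1 :=
  ((CostLE.wiring f).comp ((CostLE.wiring id).sum (CostLE.gate (fun b _ => !b) a a))).mono le_rfl

namespace Computes

variable {Ω : Type*} {A B C D : Enc} {y : Ω → A.X} {a b N : ℕ}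

/-- Conversion from the offset representation to two's complement. -/
theorem intOfNat {w : ℕ} :
    Computes (.nat (w + 1)) (.int w) id (fun x : ℕ => ((x : ℤ) - 2 ^ w : ℤ)) 1 := by
  refine ⟨_, CostLE.wiring_not (ι := Fin (w + 1)) (κ := Fin (w + 1)) (Fin.last w)
    (fun i => if i = Fin.last w then .inr () else .inl i), ?_⟩
  rintro _ x rfl
  refine Eq.trans ?_ (congrArg (fun a : ℕ => (a : ℤ) - 2 ^ w) (Nat.ofBits_castSucc x)).symm
  simp only [intOfBits]
  have h1 : ∀ i : Fin w, i.castSucc ≠ Fin.last w := fun i => (Fin.castSucc_lt_last i).ne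
  simp only [h1, if_false, Sum.elim_inl, if_true, Sum.elim_inr]
  cases x (Fin.last w) <;> simp

/-- Conversion from two's complement to the offset representation with additional bits. -/
theorem natOfInt {w : ℕ} (d : ℕ) : Computes (.int w) (.nat (w + d + 1)) id
    (fun x : ℤ => (x + 2 ^ (w + d)).toNat) 1 := by
  -- Sign extension fills the d new positions, and adding 2^(w+d) amounts to negating the sign bit
  -- on top.
  refine ⟨_, CostLE.wiring_not (ι := Fin (w + 1)) (κ := Fin (w + d + 1)) (Fin.last w)
    (fun i => if i = Fin.last (w + d) then .inr () else
      if h : i.val < w then .inl ⟨i, by omega⟩ else .inl (Fin.last w)), ?_⟩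
  rintro _ x rfl
  change Nat.ofBits _ = (intOfBits x + 2 ^ (w + d)).toNat
  rw [Nat.ofBits_castSucc]
  have h1 : ∀ i : Fin (w + d), i.castSucc ≠ Fin.last (w + d) := fun i => (Fin.castSucc_lt_last i).ne
  simp only [h1, if_false, if_true, Sum.elim_inr, Fin.val_castSucc]
  have h2 : Nat.ofBits (fun i : Fin (w + d) => Sum.elim x
      (fun _ : Unit => !x (Fin.last w))
      (if h : i.val < w then (Sum.inl ⟨i, by omega⟩ : Fin (w + 1) ⊕ Unit)
        else Sum.inl (Fin.last w))) =
      Nat.ofBits (fun i : Fin w => x i.castSucc) +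
        2 ^ w * Nat.ofBits (fun _ : Fin d => x (Fin.last w)) := by
    rw [← Nat.ofBits_addCases]
    refine congrArg Nat.ofBits (funext fun i => ?_)
    refine Fin.addCases (fun i => ?_) (fun i => ?_) i
    · simp; rfl
    · simp
  rw [h2, intOfBits]
  have h3 : 2 ^ (w + d) = 2 ^ w * 2 ^ d := pow_add 2 w d
  have h3' : (2 : ℤ) ^ (w + d) = 2 ^ w * 2 ^ d := pow_add 2 w d
  cases x (Fin.last w)
  · rw [Nat.ofBits_false]
    simp only [Bool.not_false, Bool.toNat_true, one_mul, mul_zero, add_zero, Bool.false_eq_true,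
      if_false, sub_zero]
    have : (Nat.ofBits (fun i : Fin w => x i.castSucc) : ℤ) + 2 ^ (w + d) =
      ((Nat.ofBits (fun i : Fin w => x i.castSucc) + 2 ^ (w + d) : ℕ) : ℤ) := by push_cast; rfl
    rw [this, Int.toNat_natCast]
  · have h4 : Nat.ofBits (fun _ : Fin d => true) = 2 ^ d - 1 := by
      have := Nat.ofBits_not (fun _ : Fin d => false)
      rwa [Nat.ofBits_false] at this
    rw [h4]
    simp only [Bool.not_true, Bool.toNat_false, zero_mul, add_zero, if_true]
    have h5 : 1 ≤ 2 ^ d := Nat.one_le_two_pow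
    have : (Nat.ofBits (fun i : Fin w => x i.castSucc) : ℤ) - 2 ^ w + 2 ^ (w + d) =
      ((Nat.ofBits (fun i : Fin w => x i.castSucc) + 2 ^ w * (2 ^ d - 1) : ℕ) : ℤ) := by
      push_cast [h5]; rw [h3']; ring
    rw [this, Int.toNat_natCast]

theorem natConst [Nonempty A.κ] {m : ℕ} (c : ℕ) (hc : c < 2 ^ m) :
    Computes A (.nat m) y (fun _ => c) 2 :=
  (const (B := .nat m) (fun i : Fin m => c.testBit i)).congr fun _ => by
    simp only [Nat.ofBits_testBit, Nat.mod_eq_of_lt hc]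

/-- A fixed-point number is rounded to `P` bits after the point and reduced modulo `2 ^ N + 1`. -/
theorem fermatOfInt [NeZero N] {w p P K : ℕ} (hK : K < N) {x : Ω → ℤ}
    (h1 : ∀ ω, -2 ^ K ≤ x ω * 2 ^ P / 2 ^ p) (h2 : ∀ ω, x ω * 2 ^ P / 2 ^ p < 2 ^ K) :
    Computes (.int w) (.fermat N) x (fun ω => ((x ω * 2 ^ P / 2 ^ p : ℤ) : Fermat N)) (300 * N) := by
  have hN : 1 ≤ N := NeZero.one_le
  have c1 := ((natZero (A := .nat (w + (p + (K + 1)) + 1)) (y := id) P).pair refl).then_id natConcat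
  have : NeZero (P + (w + (p + (K + 1)) + 1)) := ⟨by omega⟩
  have c2 := ((natOfInt (w := w) (p + (K + 1))).then_id c1).then_id (natWindow p (K + 1))
  have c3 := ((refl (A := .nat (K + 1)) (y := id)).pair ((natConst (m := K + 1) (2 ^ K)
    (Nat.pow_lt_pow_right (by norm_num) (by omega))).pair (natZero 1))).then_id (natAdd (K + 1))
  have c4 := ((c3.then_id (natWindow 0 (K + 1))).then_id
    (fermatOfNat_le (N := N) (by omega))).fermat_sub (fermatConst (2 ^ K : Fermat N))
  refine (((c2.then_id c4).of_id (y := x)).mono (b := 300 * N) (by omega)).congr_of_dec ?_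
  intro ω b hb
  have hx : intOfBits b = x ω := hb
  have hlow : -2 ^ w ≤ x ω := by
    rw [← hx, intOfBits]
    have : (0 : ℤ) ≤ 2 ^ w := by positivity
    split_ifs <;> omega
  set Y := x ω * 2 ^ P / 2 ^ p with hY
  have hpos : 0 ≤ x ω + 2 ^ (w + (p + (K + 1))) := by
    have : (2 : ℤ) ^ w ≤ 2 ^ (w + (p + (K + 1))) := pow_le_pow_right₀ (by norm_num) (by omega)
    omega
  simp only [pow_zero, Nat.div_one, zero_add, add_zero, id]
  have key : (((2 ^ P * (x ω + 2 ^ (w + (p + (K + 1)))).toNat / 2 ^ p % 2 ^ (K + 1) + 2 ^ K) %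
      2 ^ (K + 1) : ℕ) : ℤ) = Y + 2 ^ K := by
    push_cast
    rw [Int.toNat_of_nonneg hpos]
    -- The offset carries enough factors 2 to disappear after division by 2^p and reduction modulo
    -- 2^(K+1). Adding 2^K then moves the result into the range of residues.
    have e1 : 2 ^ P * (x ω + 2 ^ (w + (p + (K + 1)))) =
        x ω * 2 ^ P + 2 ^ (P + w) * 2 ^ (K + 1) * 2 ^ p := by ring
    rw [e1, Int.add_mul_ediv_right _ _ (by positivity), ← hY, Int.add_mul_emod_self_right,
      Int.emod_add_emod]
    refine Int.emod_eq_of_lt (by linarith [h1 ω]) ?_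
    rw [pow_succ]
    linarith [h2 ω]
  have key' := congrArg (Int.cast : ℤ → Fermat N) key
  rw [Int.cast_natCast] at key'
  rw [key']
  push_cast
  ring

/-- The offset representation of a small integer, given by its residue. -/
theorem natOfFermat [NeZero N] {x : Ω → ℤ} (h1 : ∀ ω, -2 ^ (N - 1) ≤ x ω)
    (h2 : ∀ ω, x ω < 2 ^ (N - 1)) :
    Computes (.fermat N) (.nat N) (fun ω => (x ω : Fermat N))
      (fun ω => (x ω + 2 ^ (N - 1)).toNat) (300 * N) := by
  have hN : 1 ≤ N := NeZero.one_le
  have : NeZero (2 * N) := ⟨by omega⟩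
  have c1 := ((refl (A := .fermat N) (y := fun ω => (x ω : Fermat N))).fermat_add
    (fermatConst (2 ^ (N - 1) : Fermat N))).then_id fermatCanon
  refine (c1.mono (by omega)).congr fun ω => ?_
  have h3 : 0 ≤ x ω + 2 ^ (N - 1) := by linarith [h1 ω]
  have h4 : (x ω : Fermat N) + 2 ^ (N - 1) = (((x ω + 2 ^ (N - 1)).toNat : ℕ) : Fermat N) := by
    rw [← Int.cast_natCast, Int.toNat_of_nonneg h3]; push_cast; rfl
  rw [h4, Fermat.val_natCast_mod]
  zify
  rw [Int.toNat_of_nonneg h3]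
  have : (2 : ℤ) ^ N = 2 ^ (N - 1) + 2 ^ (N - 1) := by
    rw [← two_mul, ← pow_succ']; congr 1; omega
  linarith [h2 ω]

/-- Division by a power of two with rounding. -/
theorem fermatShr [NeZero N] {e : ℕ} (he : e < N) {x : Ω → ℤ} (h1 : ∀ ω, -2 ^ (N - 1) ≤ x ω)
    (h2 : ∀ ω, x ω < 2 ^ (N - 1)) :
    Computes (.fermat N) (.fermat N) (fun ω => (x ω : Fermat N))
      (fun ω => ((x ω / 2 ^ e : ℤ) : Fermat N)) (500 * N) := by
  have hN : 1 ≤ N := NeZero.one_le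
  have c1 := (((natOfFermat h1 h2).then_id (natWindow e N)).then_id
    (fermatOfNat_le (N := N) (by omega)))
  have : NeZero (2 * N) := ⟨by omega⟩
  refine ((c1.fermat_sub (fermatConst (2 ^ (N - 1 - e) : Fermat N))).mono (by omega)).congr fun ω => ?_
  have h3 : 0 ≤ x ω + 2 ^ (N - 1) := by linarith [h1 ω]
  -- The offset is a multiple of 2^e, so it passes through the floor division as 2^(N-1-e).
  have h4 : (((x ω + 2 ^ (N - 1)).toNat / 2 ^ e % 2 ^ N : ℕ) : ℤ) = x ω / 2 ^ e + 2 ^ (N - 1 - e) := by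
    have h5 : (x ω + 2 ^ (N - 1)).toNat / 2 ^ e < 2 ^ N := by
      refine lt_of_le_of_lt (Nat.div_le_self _ _) ?_
      zify
      rw [Int.toNat_of_nonneg h3]
      have : (2 : ℤ) ^ N = 2 ^ (N - 1) + 2 ^ (N - 1) := by
        rw [← two_mul, ← pow_succ']; congr 1; omega
      linarith [h2 ω]
    rw [Nat.mod_eq_of_lt h5]
    push_cast
    rw [Int.toNat_of_nonneg h3, show (2 : ℤ) ^ (N - 1) = 2 ^ (N - 1 - e) * 2 ^ e by
      rw [← pow_add]; congr 1; omega, Int.add_mul_ediv_right _ _ (by positivity)]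
  rw [← Int.cast_natCast, h4]
  push_cast
  ring

end Computes

/-! ### Circuits for polynomials with Gaussian coefficients -/

/-- The exponents for c = 0 and c = 1 give the square roots ±2^(N/2) of -1, so multiplication by the
image of i is a rotation. -/
theorem Fermat.sq_two_pow_half {N : ℕ} (hN : 2 ∣ N) (c : ℕ) :
    (2 : Fermat N) ^ (N / 2 + c * N) * 2 ^ (N / 2 + c * N) = ((-1 : ℤ) : Fermat N) := by
  rw [← pow_add, show N / 2 + c * N + (N / 2 + c * N) = N + (2 * N) * c by
    have := Nat.div_mul_cancel hN
    nlinarith, pow_add, pow_mul, Fermat.two_pow_two_mul, Fermat.two_pow_self]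
  simp

/-- The two homomorphisms from the Gaussian integers to the integers modulo `2 ^ N + 1`. -/
noncomputable def fermatHom {N : ℕ} (hN : 2 ∣ N) (c : Fin 2) : GaussianInt →+* Fermat N :=
  Zsqrtd.lift ⟨2 ^ (N / 2 + c * N), Fermat.sq_two_pow_half hN c⟩

theorem fermatHom_apply {N : ℕ} (hN : 2 ∣ N) (c : Fin 2) (z : GaussianInt) :
    fermatHom hN c z = (z.re : Fermat N) + 2 ^ (N / 2 + c * N) * (z.im : Fermat N) := by
  simp [fermatHom, mul_comm]

/-- Polynomials with `L` Gaussian coefficients, given by the images of the coefficients. -/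
abbrev Enc.gpoly (N L : ℕ) : Enc := ((Enc.fermat N).pow (Fin L)).pow (Fin 2)

/-- The images of the coefficients of a polynomial. -/
noncomputable def gvec {N : ℕ} (hN : 2 ∣ N) (L : ℕ) (f : GaussianInt[X]) :
    Fin 2 → Fin L → Fermat N :=
  fun c i => fermatHom hN c (f.coeff i)

namespace Computes

variable {Ω : Type*} {A : Enc} {y : Ω → A.X} {a b N L : ℕ}

theorem gpoly_of_coeff (hN : 2 ∣ N) {f : Ω → GaussianInt[X]} {g : ℕ}
    (h : ∀ (c : Fin 2) (i : Fin L),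
      Computes A (.fermat N) y (fun ω => fermatHom hN c ((f ω).coeff i)) g) :
    Computes A (.gpoly N L) y (fun ω => gvec hN L (f ω)) (2 * (L * g)) :=
  (pi_const (τ := Fin 2) fun c => pi_const (τ := Fin L) fun i => h c i).mono (by simp)

theorem gcoeff (hN : 2 ∣ N) {f : Ω → GaussianInt[X]}
    (h : Computes A (.gpoly N L) y (fun ω => gvec hN L (f ω)) a) (c : Fin 2) {i : ℕ} (hi : i < L) :
    Computes A (.fermat N) y (fun ω => fermatHom hN c ((f ω).coeff i)) a :=
  h.trans ((proj c).trans (proj (A := .fermat N) (y := fun ω => gvec hN L (f ω) c) (⟨i, hi⟩ : Fin L)))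

/-- The product of polynomials. -/
theorem gpolyMul [NeZero N] {k g : ℕ}
    (hmul : Computes ((Enc.fermat N).prod (.fermat N)) (.fermat N) id
      (fun p : Fermat N × Fermat N => p.1 * p.2) g) (hN : 2 ∣ N) (hk : 2 ^ k ∣ N) {d : ℕ}
    (hd : 2 * d ≤ 2 ^ k) {f f' : Ω → GaussianInt[X]} (hf : ∀ ω, (f ω).degree < d)
    (hf' : ∀ ω, (f' ω).degree < d)
    (h : Computes A (.gpoly N (2 ^ k)) y (fun ω => gvec hN (2 ^ k) (f ω)) a)
    (h' : Computes A (.gpoly N (2 ^ k)) y (fun ω => gvec hN (2 ^ k) (f' ω)) b) :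
    Computes A (.gpoly N (2 ^ k)) y (fun ω => gvec hN (2 ^ k) (f ω * f' ω))
      (a + b + 2 * (2 ^ k * (g + 300 * k * N))) := by
  refine (h.pair h').trans ?_
  refine (pi_const (τ := Fin 2) (g := 2 ^ k * (g + 300 * k * N)) fun c => ?_).mono (by simp)
  have hd' : (d : WithBot ℕ) ≤ (2 ^ k : ℕ) := by exact_mod_cast (by omega : d ≤ 2 ^ k)
  have hm : ∀ f : GaussianInt[X], f.degree < d → (f.map (fermatHom hN c)).degree < d :=
    fun f hf => degree_map_le.trans_lt hf
  have h1 := fermatPolyMul hmul hk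
    (u := fun ω => (f ω).map (fermatHom hN c)) (v := fun ω => (f' ω).map (fermatHom hN c))
    (fun ω => (degree_mul_lt_of_lt (hm _ (hf ω)) (hm _ (hf' ω))).trans_le (by exact_mod_cast hd))
    (fun ω => (hm _ (hf ω)).trans_le hd') (fun ω => (hm _ (hf' ω)).trans_le hd')
  simp only [← Polynomial.map_mul, coeff_map] at h1
  have h2 : Computes ((Enc.gpoly N (2 ^ k)).prod (.gpoly N (2 ^ k)))
      (((Enc.fermat N).pow (Fin (2 ^ k))).prod ((Enc.fermat N).pow (Fin (2 ^ k))))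
      (fun ω => (gvec hN (2 ^ k) (f ω), gvec hN (2 ^ k) (f' ω)))
      (fun ω => (gvec hN (2 ^ k) (f ω) c, gvec hN (2 ^ k) (f' ω) c)) 0 :=
    ((fst.trans (proj c)).pair (snd.trans (proj c))).mono (by omega)
  exact (h2.trans h1).mono (by omega)

/-- The two images play the role of z and its conjugate: half their sum is the real part, and 1/2 is
the rotation by 2N - 1. The imaginary part comes from the difference. -/
theorem fermatHomRe [NeZero N] (hN : 2 ∣ N) {z : Ω → GaussianInt} :
    Computes ((Enc.fermat N).prod (.fermat N)) (.fermat N)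
      (fun ω => (fermatHom hN 0 (z ω), fermatHom hN 1 (z ω))) (fun ω => ((z ω).re : Fermat N))
      (100 * N) := by
  have e2 : (2 : Fermat N) ^ (2 * N - 1) * 2 = 1 := by
    have hN1 : 1 ≤ N := NeZero.one_le
    rw [← pow_succ, ← Fermat.two_pow_two_mul N]; congr 1; omega
  refine (fermatAdd.then_id (fermatShift (2 * N - 1))).of_id.congr fun ω => ?_
  simp only [fermatHom_apply, Fin.val_zero, Fin.val_one, zero_mul, one_mul, add_zero, pow_add,
    Fermat.two_pow_self]
  linear_combination ((z ω).re : Fermat N) * e2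

theorem fermatHomIm [NeZero N] (hN : 2 ∣ N) {z : Ω → GaussianInt} :
    Computes ((Enc.fermat N).prod (.fermat N)) (.fermat N)
      (fun ω => (fermatHom hN 0 (z ω), fermatHom hN 1 (z ω))) (fun ω => ((z ω).im : Fermat N))
      (100 * N) := by
  have eI : (2 : Fermat N) ^ (2 * N - 1 - N / 2) * 2 * 2 ^ (N / 2) = 1 := by
    have hN1 : 1 ≤ N := NeZero.one_le
    have hN2 := Nat.div_mul_cancel hN
    rw [← pow_succ, ← pow_add, ← Fermat.two_pow_two_mul N]; congr 1; omega
  refine (((fst.fermat_sub snd).then_id (fermatShift (2 * N - 1 - N / 2))).mono (by omega)).congr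
    fun ω => ?_
  simp only [fermatHom_apply, Fin.val_zero, Fin.val_one, zero_mul, one_mul, add_zero, pow_add,
    Fermat.two_pow_self]
  linear_combination ((z ω).im : Fermat N) * eI

/-- Rounding of a Gaussian integer. -/
theorem fermatHomShr [NeZero N] (hN : 2 ∣ N) {e : ℕ} (he : e < N) (c : Fin 2)
    {z : Ω → GaussianInt}
    (hre : ∀ ω, |(z ω).re| < 2 ^ (N - 1)) (him : ∀ ω, |(z ω).im| < 2 ^ (N - 1)) :
    Computes ((Enc.fermat N).prod (.fermat N)) (.fermat N)
      (fun ω => (fermatHom hN 0 (z ω), fermatHom hN 1 (z ω)))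
      (fun ω => fermatHom hN c (GaussianInt.shr e (z ω))) (1500 * N) := by
  have hR := (fermatHomRe hN).trans
    (fermatShr he (fun ω => (abs_lt.mp (hre ω)).1.le) fun ω => (abs_lt.mp (hre ω)).2)
  have hI := (fermatHomIm hN).trans
    (fermatShr he (fun ω => (abs_lt.mp (him ω)).1.le) fun ω => (abs_lt.mp (him ω)).2)
  refine ((hR.fermat_add (hI.then_id (fermatShift (N / 2 + c * N)))).mono (by omega)).congr
    fun ω => ?_
  rw [fermatHom_apply, GaussianInt.shr]

/-- Output of a Gaussian integer in two's complement. -/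
theorem intOfFermatHom {w : ℕ} (hN : 2 ∣ w + 1)
    {z : Ω → GaussianInt} (hre : ∀ ω, |(z ω).re| < 2 ^ w) (him : ∀ ω, |(z ω).im| < 2 ^ w) :
    Computes ((Enc.fermat (w + 1)).prod (.fermat (w + 1))) ((Enc.int w).pow (Fin 2))
      (fun ω => (fermatHom hN 0 (z ω), fermatHom hN 1 (z ω)))
      (fun ω => ![(z ω).re, (z ω).im]) (1000 * (w + 1)) := by
  have out : ∀ {x : Ω → ℤ}, (∀ ω, |x ω| < 2 ^ w) →
      Computes (.fermat (w + 1)) (.int w) (fun ω => (x ω : Fermat (w + 1))) x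
        (300 * (w + 1) + 1) := by
    intro x hx
    refine ((natOfFermat (N := w + 1) (fun ω => (abs_lt.mp (hx ω)).1.le)
      (fun ω => (abs_lt.mp (hx ω)).2)).then_id intOfNat).congr fun ω => ?_
    rw [Nat.add_sub_cancel, Int.toNat_of_nonneg (by linarith [(abs_lt.mp (hx ω)).1])]
    ring
  refine (pi_const (τ := Fin 2) (g := 500 * (w + 1)) fun c => ?_).mono (by simp; omega)
  fin_cases c
  · exact ((fermatHomRe hN).trans (out hre)).mono (by omega)
  · exact ((fermatHomIm hN).trans (out him)).mono (by omega)

end Computes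

/-! ### The circuit for the division -/

theorem Enc.nonempty_prod {A B : Enc} (h : Nonempty A.κ) : Nonempty (A.prod B).κ := h.map Sum.inl

theorem GaussianInt.abs_re_lt {z : GaussianInt} {m k : ℕ} (hz : ‖z.toComplex‖ ≤ 2 ^ m) (hm : m < k) :
    |z.re| < 2 ^ k := by
  have h1 : |(z.re : ℝ)| ≤ 2 ^ m := by
    have := Complex.abs_re_le_norm z.toComplex
    rw [← GaussianInt.intCast_re] at this
    exact this.trans hz
  have h2 : |z.re| ≤ 2 ^ m := by exact_mod_cast h1
  exact h2.trans_lt (pow_lt_pow_right₀ (by norm_num) hm)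

theorem GaussianInt.abs_im_lt {z : GaussianInt} {m k : ℕ} (hz : ‖z.toComplex‖ ≤ 2 ^ m) (hm : m < k) :
    |z.im| < 2 ^ k := by
  have h1 : |(z.im : ℝ)| ≤ 2 ^ m := by
    have := Complex.abs_im_le_norm z.toComplex
    rw [← GaussianInt.intCast_im] at this
    exact this.trans hz
  have h2 : |z.im| ≤ 2 ^ m := by exact_mod_cast h1
  exact h2.trans_lt (pow_lt_pow_right₀ (by norm_num) hm)

theorem coeff_newtonIter_eq_zero (n P : ℕ) (τ : GaussianInt[X]) (k : ℕ) {i : ℕ} (hi : n + 1 ≤ i) :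
    (newtonIter n P τ k).coeff i = 0 := by
  cases k with
  | zero => rw [newtonIter, coeff_C, if_neg (by omega)]
  | succ k => rw [newtonIter, coeff_pround, if_neg (by omega)]

theorem coeff_reflect_eq_zero {R : Type*} [Semiring R] {n : ℕ} {f : R[X]}
    (hf : ∀ i, n + 1 ≤ i → f.coeff i = 0) {i : ℕ} (hi : n + 1 ≤ i) : (reflect n f).coeff i = 0 := by
  rw [coeff_reflect, revAt_eq_self_of_lt (by omega), hf i hi]

theorem coeff_approxRevQuot_eq_zero {n P K : ℕ} {s t : GaussianInt[X]} {i : ℕ} (hi : n + 1 ≤ i) :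
    (approxRevQuot n P K s t).coeff i = 0 := by
  rw [approxRevQuot, coeff_ptrunc, if_neg (by omega)]

namespace Computes

variable {Ω : Type*} {A : Enc} {y : Ω → A.X} {a b N L : ℕ}

theorem gpoly_of_coeff_lt [NeZero N] [Nonempty A.κ] (hN : 2 ∣ N) {f : Ω → GaussianInt[X]} {d g : ℕ}
    (hf : ∀ ω i, d ≤ i → (f ω).coeff i = 0) (hg : 2 ≤ g)
    (h : ∀ (c : Fin 2) (i : ℕ), i < d → i < L →
      Computes A (.fermat N) y (fun ω => fermatHom hN c ((f ω).coeff i)) g) :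
    Computes A (.gpoly N L) y (fun ω => gvec hN L (f ω)) (2 * (L * g)) := by
  refine gpoly_of_coeff hN fun c i => ?_
  by_cases hi : (i : ℕ) < d
  · exact h c i hi i.2
  · refine ((fermatConst 0).mono hg).congr fun ω => ?_
    rw [hf ω i (not_lt.mp hi), map_zero]

theorem gcoeff_pair (hN : 2 ∣ N) {f : Ω → GaussianInt[X]}
    (h : Computes A (.gpoly N L) y (fun ω => gvec hN L (f ω)) a) {i : ℕ} (hi : i < L) :
    Computes A ((Enc.fermat N).prod (.fermat N)) y
      (fun ω => (fermatHom hN 0 ((f ω).coeff i), fermatHom hN 1 ((f ω).coeff i))) a :=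
  h.trans ((gcoeff hN refl 0 hi).pair (gcoeff hN refl 1 hi))

section Division

variable [NeZero N] (hN : 2 ∣ N) {n P K k g : ℕ}

/-- A step of the Newton iteration. -/
theorem newtonStep [Nonempty A.κ]
    (hmul : Computes ((Enc.fermat N).prod (.fermat N)) (.fermat N) id
      (fun p : Fermat N × Fermat N => p.1 * p.2) g) (hk : 2 ^ k ∣ N) (hd : 2 * (n + 1) ≤ 2 ^ k)
    (hPN : 4 * P + 1 < N) {τ : Ω → GaussianInt[X]} (hτ : ∀ ω i, n + 1 ≤ i → (τ ω).coeff i = 0) {j : ℕ}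
    (hsmall : ∀ ω i, i < min (2 ^ (j + 1)) (n + 1) →
      ‖((newtonPre n P (τ ω) (newtonIter n P (τ ω) j)).coeff i).toComplex‖ ≤ 2 ^ (4 * P))
    (h : Computes A (.gpoly N (2 ^ k)) y (fun ω => gvec hN (2 ^ k) (τ ω)) a)
    (h' : Computes A (.gpoly N (2 ^ k)) y (fun ω => gvec hN (2 ^ k) (newtonIter n P (τ ω) j)) 0) :
    Computes A (.gpoly N (2 ^ k)) y (fun ω => gvec hN (2 ^ k) (newtonIter n P (τ ω) (j + 1)))
      (a + 4 * (2 ^ k * (g + 300 * k * N)) + 4000 * (2 ^ k * N)) := by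
  have hN1 : 1 ≤ N := NeZero.one_le
  have : Nonempty (Enc.gpoly N (2 ^ k)).κ := ⟨(0, ⟨0, by positivity⟩, ⟨0, by omega⟩)⟩
  have hτ' : ∀ ω, (τ ω).degree < (n + 1 : ℕ) := fun ω => (degree_lt_iff_coeff_zero _ _).2 (hτ ω)
  have hv' : ∀ ω, (newtonIter n P (τ ω) j).degree < (n + 1 : ℕ) := fun ω =>
    (degree_lt_iff_coeff_zero _ _).2 fun i hi => coeff_newtonIter_eq_zero _ _ _ _ hi
  have h1 := gpolyMul hmul hN hk hd hτ' hv' h h'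
  have hw : ∀ ω i, n + 1 ≤ i → (C (2 ^ (2 * P + 1)) -
      ptrunc (n + 1) (τ ω * newtonIter n P (τ ω) j) : GaussianInt[X]).coeff i = 0 := fun ω i hi => by
    rw [coeff_sub, coeff_C, coeff_ptrunc, if_neg (by omega), if_neg (by omega), sub_zero]
  have h2 := h1.trans (gpoly_of_coeff_lt (N := N) (L := 2 ^ k) (g := 102 * N) hN hw (by omega)
    fun c i hi hiL => by
      refine (((fermatConst (fermatHom hN c ((C (2 ^ (2 * P + 1)) : GaussianInt[X]).coeff i))
        ).fermat_sub (gcoeff hN refl c hiL)).mono (by omega)).congr fun ω => ?_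
      rw [coeff_sub, map_sub, coeff_ptrunc, if_pos hi])
  have h3 := gpolyMul hmul hN hk hd hv' (fun ω => (degree_lt_iff_coeff_zero _ _).2 (hw ω)) h' h2
  have h4 := h3.trans (gpoly_of_coeff_lt (N := N) (L := 2 ^ k) (g := 1500 * N) hN
    (f := fun ω => newtonIter n P (τ ω) (j + 1)) (d := min (2 ^ (j + 1)) (n + 1))
    (fun ω i hi => by rw [newtonIter, coeff_pround, if_neg (by omega)]) (by omega)
    fun c i hi hiL => by
      -- Rounding is not a ring operation; it is possible because the size bound 2^(4P) makes the
      -- integer readable from its residues.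
      have h5 := fermatHomShr hN (e := 2 * P) (by omega) c
        (z := fun ω => (newtonPre n P (τ ω) (newtonIter n P (τ ω) j)).coeff i)
        (fun ω => GaussianInt.abs_re_lt (hsmall ω i hi) (by omega))
        (fun ω => GaussianInt.abs_im_lt (hsmall ω i hi) (by omega))
      refine (((gcoeff_pair hN refl hiL).trans h5).mono (by omega)).congr fun ω => ?_
      rw [newtonIter, coeff_pround, if_pos hi])
  refine h4.mono ?_
  have e1 : 2 ^ k * (102 * N) = 102 * (2 ^ k * N) := by ring
  have e2 : 2 ^ k * (1500 * N) = 1500 * (2 ^ k * N) := by ring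
  rw [e1, e2]
  omega

/-- The Newton iteration. -/
theorem newtonIterate [Nonempty A.κ]
    (hmul : Computes ((Enc.fermat N).prod (.fermat N)) (.fermat N) id
      (fun p : Fermat N × Fermat N => p.1 * p.2) g) (hk : 2 ^ k ∣ N) (hd : 2 * (n + 1) ≤ 2 ^ k)
    (hPN : 4 * P + 1 < N) {τ : Ω → GaussianInt[X]} (hτ : ∀ ω i, n + 1 ≤ i → (τ ω).coeff i = 0)
    (hsmall : ∀ ω j i, j < K → i < min (2 ^ (j + 1)) (n + 1) →
      ‖((newtonPre n P (τ ω) (newtonIter n P (τ ω) j)).coeff i).toComplex‖ ≤ 2 ^ (4 * P))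
    (h : Computes A (.gpoly N (2 ^ k)) y (fun ω => gvec hN (2 ^ k) (τ ω)) a) {j : ℕ} (hj : j ≤ K) :
    Computes A (.gpoly N (2 ^ k)) y (fun ω => gvec hN (2 ^ k) (newtonIter n P (τ ω) j))
      (4 * 2 ^ k + j * (a + 4 * (2 ^ k * (g + 300 * k * N)) + 4000 * (2 ^ k * N))) := by
  induction j with
  | zero =>
    refine (gpoly_of_coeff_lt (g := 2) hN (f := fun ω => newtonIter n P (τ ω) 0)
      (fun ω i hi => coeff_newtonIter_eq_zero n P (τ ω) 0 hi) le_rfl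
      fun c i hi hiL => (fermatConst (fermatHom hN c ((C (2 ^ P) : GaussianInt[X]).coeff i))).congr
        fun ω => by rw [newtonIter]).mono ?_
    omega
  | succ j ih =>
    have : Nonempty (A.prod (.gpoly N (2 ^ k))).κ := Enc.nonempty_prod inferInstance
    -- The step uses the previous iterate twice, so that iterate is adjoined to the inputs at cost
    -- 0. Otherwise its circuit would be duplicated at every step.
    have h1 := newtonStep hN hmul hk hd hPN hτ (fun ω i => hsmall ω j i (by omega))
      ((fst (B := .gpoly N (2 ^ k))
        (y := fun ω => (y ω, gvec hN (2 ^ k) (newtonIter n P (τ ω) j)))).trans h) snd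
    refine ((refl.pair (ih (by omega))).trans h1).mono ?_
    rw [add_mul, zero_add, zero_add]
    omega

end Division

end Computes

namespace Computes

variable {Ω : Type*} {N : ℕ} [NeZero N] (hN : 2 ∣ N) {n P K k g : ℕ} {s t : Ω → GaussianInt[X]}

/-- The quotient with `2 P` bits after the point. -/
theorem approxQuot
    (hmul : Computes ((Enc.fermat N).prod (.fermat N)) (.fermat N) id
      (fun p : Fermat N × Fermat N => p.1 * p.2) g) (hk : 2 ^ k ∣ N) (hd : 2 * (n + 1) ≤ 2 ^ k)
    (hPN : 4 * P + 1 < N) (ht : ∀ ω i, n + 1 ≤ i → (t ω).coeff i = 0)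
    (hsmall : ∀ ω j i, j < K → i < min (2 ^ (j + 1)) (n + 1) →
      ‖((newtonPre n P (reflect n (t ω)) (newtonIter n P (reflect n (t ω)) j)).coeff i).toComplex‖ ≤
        2 ^ (4 * P)) :
    Computes ((Enc.gpoly N (2 * n + 1)).prod (.gpoly N (n + 1))) (.gpoly N (2 ^ k))
      (fun ω => (gvec hN (2 * n + 1) (s ω), gvec hN (n + 1) (t ω)))
      (fun ω => gvec hN (2 ^ k) (reflect n (approxRevQuot n P K (s ω) (t ω))))
      ((12 + 4 * K) * 2 ^ k + (4 * K + 2) * (2 ^ k * (g + 300 * k * N)) +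
        K * (4000 * (2 ^ k * N))) := by
  have hN1 : 1 ≤ N := NeZero.one_le
  have : Nonempty ((Enc.gpoly N (2 * n + 1)).prod (.gpoly N (n + 1))).κ :=
    ⟨.inl (0, 0, ⟨0, by omega⟩)⟩
  have : Nonempty (Enc.gpoly N (2 ^ k)).κ := ⟨(0, ⟨0, by positivity⟩, ⟨0, by omega⟩)⟩
  have h1 : Computes ((Enc.gpoly N (2 * n + 1)).prod (.gpoly N (n + 1))) (.gpoly N (2 ^ k))
      (fun ω => (gvec hN (2 * n + 1) (s ω), gvec hN (n + 1) (t ω)))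
      (fun ω => gvec hN (2 ^ k) (reflect n (t ω))) (2 * (2 ^ k * 2)) :=
    gpoly_of_coeff_lt hN (fun ω i hi => coeff_reflect_eq_zero (ht ω) hi) le_rfl
      fun c i hi _ => ((gcoeff hN (snd (A := .gpoly N (2 * n + 1)) (B := .gpoly N (n + 1))) c
        (show n - i < n + 1 by omega)).mono zero_le_two).congr fun ω => by
          rw [coeff_reflect, revAt_le (by omega)]
  have h2 := newtonIterate hN hmul hk hd hPN (fun ω i hi => coeff_reflect_eq_zero (ht ω) hi)
    hsmall h1 le_rfl
  have h3 : Computes ((Enc.gpoly N (2 * n + 1)).prod (.gpoly N (n + 1))) (.gpoly N (2 ^ k))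
      (fun ω => (gvec hN (2 * n + 1) (s ω), gvec hN (n + 1) (t ω)))
      (fun ω => gvec hN (2 ^ k) (ptrunc (n + 1) (reflect (2 * n) (s ω)))) (2 * (2 ^ k * 2)) :=
    gpoly_of_coeff_lt hN (fun ω i hi => by rw [coeff_ptrunc, if_neg (not_lt.mpr hi)]) le_rfl
      fun c i hi _ => ((gcoeff hN (fst (A := .gpoly N (2 * n + 1)) (B := .gpoly N (n + 1))) c
        (show 2 * n - i < 2 * n + 1 by omega)).mono zero_le_two).congr fun ω => by
          rw [coeff_ptrunc, if_pos hi, coeff_reflect, revAt_le (by omega)]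
  have h4 := gpolyMul hmul hN hk hd (fun ω => (degree_lt_iff_coeff_zero _ _).2
      fun i hi => by rw [coeff_ptrunc, if_neg (not_lt.mpr hi)])
    (fun ω => (degree_lt_iff_coeff_zero _ _).2 fun i hi => coeff_newtonIter_eq_zero _ _ _ _ hi) h3 h2
  have h5 := h4.trans (gpoly_of_coeff_lt (N := N) (L := 2 ^ k) (g := 2) hN
    (f := fun ω => reflect n (approxRevQuot n P K (s ω) (t ω)))
    (fun ω i hi => coeff_reflect_eq_zero (fun _ => coeff_approxRevQuot_eq_zero) hi) le_rfl
    fun c i hi hiL => ((gcoeff hN refl c (show n - i < 2 ^ k by omega)).mono zero_le_two).congr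
      fun ω => by
        rw [coeff_reflect, revAt_le (by omega), approxRevQuot, coeff_ptrunc, if_pos (by omega)])
  refine h5.mono (le_of_eq ?_)
  ring

end Computes

namespace Computes

variable {Ω : Type*} {w n P K k g : ℕ} {s t : Ω → GaussianInt[X]}

/-- The quotient and the remainder with `3 P` bits after the point. -/
theorem approxDivision (hN : 2 ∣ w + 1)
    (hmul : Computes ((Enc.fermat (w + 1)).prod (.fermat (w + 1))) (.fermat (w + 1)) id
      (fun p : Fermat (w + 1) × Fermat (w + 1) => p.1 * p.2) g) (hk : 2 ^ k ∣ w + 1)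
    (hd : 2 * (n + 1) ≤ 2 ^ k)
    (hPw : 4 * P < w) (ht : ∀ ω i, n + 1 ≤ i → (t ω).coeff i = 0)
    (hsmall : ∀ ω j i, j < K → i < min (2 ^ (j + 1)) (n + 1) →
      ‖((newtonPre n P (reflect n (t ω)) (newtonIter n P (reflect n (t ω)) j)).coeff i).toComplex‖ ≤
        2 ^ (4 * P))
    (hq : ∀ ω i, ‖((reflect n (approxRevQuot n P K (s ω) (t ω))).coeff i * 2 ^ P).toComplex‖ ≤
      2 ^ (4 * P))
    (hr : ∀ ω i, ‖((approxRem n P K (s ω) (t ω)).coeff i).toComplex‖ ≤ 2 ^ (4 * P)) :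
    Computes ((Enc.gpoly (w + 1) (2 * n + 1)).prod (.gpoly (w + 1) (n + 1)))
      ((((Enc.int w).pow (Fin 2)).pow (Fin (n + 1))).prod (((Enc.int w).pow (Fin 2)).pow (Fin n)))
      (fun ω => (gvec hN (2 * n + 1) (s ω), gvec hN (n + 1) (t ω)))
      (fun ω => (fun j : Fin (n + 1) =>
          ![((reflect n (approxRevQuot n P K (s ω) (t ω))).coeff j * 2 ^ P).re,
            ((reflect n (approxRevQuot n P K (s ω) (t ω))).coeff j * 2 ^ P).im],
        fun j : Fin n => ![((approxRem n P K (s ω) (t ω)).coeff j).re,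
          ((approxRem n P K (s ω) (t ω)).coeff j).im]))
      ((K + 1) * (4 * (2 ^ k * (g + 300 * k * (w + 1))) + 5000 * (2 ^ k * (w + 1)))) := by
  set Q : Ω → GaussianInt[X] := fun ω => reflect n (approxRevQuot n P K (s ω) (t ω)) with hQdef
  have hQ0 : ∀ ω i, n + 1 ≤ i → (Q ω).coeff i = 0 := fun ω i hi =>
    coeff_reflect_eq_zero (fun _ => coeff_approxRevQuot_eq_zero) hi
  -- Intermediate results are carried along with the inputs: A₁ adjoins the quotient Q and A₂ also
  -- t·Q, so both are computed once and shared by all output coefficients.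
  let A₀ : Enc := (Enc.gpoly (w + 1) (2 * n + 1)).prod (.gpoly (w + 1) (n + 1))
  let A₁ : Enc := A₀.prod (.gpoly (w + 1) (2 ^ k))
  let A₂ : Enc := A₁.prod (.gpoly (w + 1) (2 ^ k))
  let y₀ : Ω → A₀.X := fun ω => (gvec hN (2 * n + 1) (s ω), gvec hN (n + 1) (t ω))
  let y₁ : Ω → A₁.X := fun ω => (y₀ ω, gvec hN (2 ^ k) (Q ω))
  let y₂ : Ω → A₂.X := fun ω => (y₁ ω, gvec hN (2 ^ k) (t ω * Q ω))
  have : Nonempty A₁.κ := ⟨.inl (.inl (0, 0, 0))⟩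
  have h0 : Computes A₀ A₁ y₀ y₁ _ :=
    refl.pair (approxQuot hN hmul hk hd (by omega) ht hsmall)
  have h1 : Computes A₁ (.gpoly (w + 1) (2 ^ k)) y₁ (fun ω => gvec hN (2 ^ k) (t ω))
      (2 * (2 ^ k * 2)) :=
    gpoly_of_coeff_lt hN ht le_rfl fun c i hi _ =>
      (gcoeff hN ((fst (y := y₁)).trans (snd (y := y₀))) c hi).mono zero_le_two
  have h2 : Computes A₁ A₂ y₁ y₂ _ := refl.pair (gpolyMul hmul hN hk hd
    (fun ω => (degree_lt_iff_coeff_zero _ _).2 (ht ω))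
    (fun ω => (degree_lt_iff_coeff_zero _ _).2 (hQ0 ω)) h1 (snd (y := y₁)))
  have hs2 : Computes A₂ (.gpoly (w + 1) (2 * n + 1)) y₂ (fun ω => gvec hN (2 * n + 1) (s ω)) 0 :=
    (fst (y := y₂)).trans ((fst (y := y₁)).trans (fst (y := y₀)))
  have hQ2 : Computes A₂ (.gpoly (w + 1) (2 ^ k)) y₂ (fun ω => gvec hN (2 ^ k) (Q ω)) 0 :=
    (fst (y := y₂)).trans (snd (y := y₁))
  have hm2 : Computes A₂ (.gpoly (w + 1) (2 ^ k)) y₂ (fun ω => gvec hN (2 ^ k) (t ω * Q ω)) 0 :=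
    snd (y := y₂)
  have hout1 : Computes A₂ (((Enc.int w).pow (Fin 2)).pow (Fin (n + 1))) y₂
      (fun ω => (fun j : Fin (n + 1) => ![((Q ω).coeff j * 2 ^ P).re, ((Q ω).coeff j * 2 ^ P).im]))
      ((n + 1) * (1000 * (w + 1))) := by
    refine (pi_const (g := 1000 * (w + 1)) fun j => ?_).mono (by simp)
    have hc : ∀ c, Computes A₂ (.fermat (w + 1)) y₂
        (fun ω => fermatHom hN c ((Q ω).coeff j * 2 ^ P)) 0 := fun c =>
      ((gcoeff hN hQ2 c (show (j : ℕ) < 2 ^ k by omega)).then_id (fermatShift P)).congr fun ω => by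
        rw [map_mul, map_pow, map_ofNat, mul_comm]
    exact (((hc 0).pair (hc 1)).trans (intOfFermatHom hN
      (fun ω => GaussianInt.abs_re_lt (hq ω j) hPw)
      (fun ω => GaussianInt.abs_im_lt (hq ω j) hPw))).mono (by omega)
  have hout2 : Computes A₂ (((Enc.int w).pow (Fin 2)).pow (Fin n)) y₂
      (fun ω => (fun j : Fin n => ![((approxRem n P K (s ω) (t ω)).coeff j).re,
          ((approxRem n P K (s ω) (t ω)).coeff j).im]))
      (n * (1200 * (w + 1))) := by
    refine (pi_const (g := 1200 * (w + 1)) fun j => ?_).mono (by simp)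
    have hc : ∀ c, Computes A₂ (.fermat (w + 1)) y₂
        (fun ω => fermatHom hN c ((approxRem n P K (s ω) (t ω)).coeff j)) (100 * (w + 1)) := by
      intro c
      have e1 := (gcoeff hN hs2 c (show (j : ℕ) < 2 * n + 1 by omega)).then_id (fermatShift (2 * P))
      have e2 := gcoeff hN hm2 c (show (j : ℕ) < 2 ^ k by omega)
      refine ((e1.fermat_sub e2).mono (by omega)).congr fun ω => ?_
      rw [approxRem, coeff_ptrunc, if_pos j.2, coeff_sub, coeff_C_mul, map_sub, map_mul, map_pow,
        map_ofNat]
    exact (((hc 0).pair (hc 1)).trans (intOfFermatHom hN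
      (fun ω => GaussianInt.abs_re_lt (hr ω j) hPw)
      (fun ω => GaussianInt.abs_im_lt (hr ω j) hPw))).mono (by omega)
  refine ((h0.trans h2).trans (hout1.pair hout2)).mono ?_
  have hL : 2 ^ k ≤ 2 ^ k * (w + 1) := Nat.le_mul_of_pos_right _ (by omega)
  have hU : 2 * (n + 1) * (w + 1) ≤ 2 ^ k * (w + 1) := Nat.mul_le_mul_right _ hd
  have hK : K * 2 ^ k ≤ K * (2 ^ k * (w + 1)) := Nat.mul_le_mul_left _ hL
  generalize 2 ^ k * (g + 300 * k * (w + 1)) = G at *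
  generalize 2 ^ k * (w + 1) = U at *
  nlinarith

end Computes

/-! ### Fixed-point input and output, and the assembled division circuit -/

theorem coeff_sum_monomial {R : Type*} [Semiring R] {d : ℕ} (c : Fin d → R) (i : ℕ) :
    (∑ j : Fin d, monomial (j : ℕ) (c j)).coeff i = if h : i < d then c ⟨i, h⟩ else 0 := by
  simp only [finsetSum_coeff, coeff_monomial]
  split_ifs with h
  · rw [Finset.sum_eq_single ⟨i, h⟩ (fun j _ hj => if_neg fun h' => hj (Fin.ext h'))
      (fun h' => absurd (Finset.mem_univ _) h'), if_pos rfl]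
  · exact Finset.sum_eq_zero fun j _ => if_neg fun h' : (j : ℕ) = i => h (h' ▸ j.2)

theorem coeff_polyOfBits (p : ℕ) {d w : ℕ} {b : PolyBit d w → Bool} {c : ℕ → GaussianInt}
    (hc : ∀ i, d ≤ i → c i = 0)
    (hb : ∀ j : Fin d, (fun k => intOfBits fun i => b (j, k, i)) = ![(c j).re, (c j).im]) (i : ℕ) :
    (polyOfBits p b).coeff i = (c i).toComplex / 2 ^ p := by
  rw [polyOfBits, coeff_sum_monomial]
  split_ifs with h
  · have h0 := congrFun (hb ⟨i, h⟩) 0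
    have h1 := congrFun (hb ⟨i, h⟩) 1
    simp only [Matrix.cons_val_zero, Matrix.cons_val_one] at h0 h1
    rw [h0, h1, GaussianInt.toComplex_def]
  · rw [hc i (not_lt.mp h), map_zero, zero_div]

/-- Fixed-point numbers with `p` bits after the point, rounded to `P` bits after the point. -/
noncomputable def roundInput (p P : ℕ) {d : ℕ} (a : Fin d → Fin 2 → ℤ) : GaussianInt[X] :=
  ∑ j : Fin d, monomial (j : ℕ) (GaussianInt.shr p ⟨a j 0 * 2 ^ P, a j 1 * 2 ^ P⟩)

theorem norm_coeff_roundInput_sub_le (p P : ℕ) {d w : ℕ} (b : PolyBit d w → Bool) (i : ℕ) :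
    ‖((roundInput p P fun j k => intOfBits fun i => b (j, k, i)).coeff i).toComplex / 2 ^ P -
      (polyOfBits p b).coeff i‖ ≤ 2 / 2 ^ P := by
  rw [roundInput, polyOfBits, coeff_sum_monomial, coeff_sum_monomial]
  split_ifs with h
  · have h1 := GaussianInt.norm_shr_sub_le p ⟨intOfBits (fun k => b (⟨i, h⟩, 0, k)) * 2 ^ P,
      intOfBits (fun k => b (⟨i, h⟩, 1, k)) * 2 ^ P⟩
    rw [le_div_iff₀ (by positivity)]
    refine le_trans (le_of_eq ?_) h1
    rw [← Complex.norm_ofNat 2, ← norm_pow, ← norm_mul, sub_mul,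
      div_mul_cancel₀ _ (pow_ne_zero _ two_ne_zero),
      GaussianInt.toComplex_def ⟨_ * 2 ^ P, _⟩]
    push_cast
    congr 2
    ring
  · simp only [map_zero, zero_div, sub_zero, norm_zero]
    positivity

namespace Computes

/-- Rounding reads a window of the input bits, and scaling and sign extension are wiring; hence the
gate bound does not depend on p and w. -/
theorem gpoly_roundInput {Ω : Type*} {N d w p P K : ℕ} [NeZero N] (hN : 2 ∣ N) (hK : K < N)
    {y : Ω → Fin d → Fin 2 → ℤ}
    (h : ∀ ω i, ‖((roundInput p P (y ω)).coeff i).toComplex‖ ≤ 2 ^ (K - 1)) (hK0 : 0 < K) :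
    Computes (((Enc.int w).pow (Fin 2)).pow (Fin d)) (.gpoly N d) y
      (fun ω => gvec hN d (roundInput p P (y ω))) (2 * (d * (700 * N))) := by
  refine gpoly_of_coeff hN fun c i => ?_
  have hcoeff : ∀ ω, (roundInput p P (y ω)).coeff i =
      GaussianInt.shr p ⟨y ω i 0 * 2 ^ P, y ω i 1 * 2 ^ P⟩ := fun ω => by
    rw [roundInput, coeff_sum_monomial, dif_pos i.2]
  have hpart : ∀ e : Fin 2, (∀ ω, |y ω i e * 2 ^ P / 2 ^ p| < 2 ^ K) →
      Computes (((Enc.int w).pow (Fin 2)).pow (Fin d)) (.fermat N) y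
        (fun ω => ((y ω i e * 2 ^ P / 2 ^ p : ℤ) : Fermat N)) (300 * N) := fun e he =>
    ((proj (A := (Enc.int w).pow (Fin 2)) i).trans ((proj (A := .int w) e).trans
      (fermatOfInt hK (fun ω => (abs_lt.mp (he ω)).1.le) fun ω => (abs_lt.mp (he ω)).2))).mono
        (by omega)
  have h0 := hpart 0 fun ω => by
    have := GaussianInt.abs_re_lt (h ω i) (show K - 1 < K by omega)
    rwa [hcoeff] at this
  have h1 := hpart 1 fun ω => by
    have := GaussianInt.abs_im_lt (h ω i) (show K - 1 < K by omega)
    rwa [hcoeff] at this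
  refine ((h0.fermat_add (h1.then_id (fermatShift (N / 2 + c * N)))).mono (by omega)).congr
    fun ω => ?_
  rw [hcoeff, fermatHom_apply, GaussianInt.shr]

end Computes

/-- The summand 3 covers the input and rounding error 3·2^(-λ), so the rounded coefficients of both
polynomials have modulus at most 2^P. -/
theorem two_rpow_add_three_le {n : ℕ} (hn : 2 ≤ n) {ℓ τ₁ τ₂ ρ : ℝ} (hℓ : 0 ≤ ℓ) (hτ₁ : 0 ≤ τ₁)
    (hτ₂ : 0 ≤ τ₂) (hρ : 1 ≤ ρ) :
    (2 : ℝ) ^ τ₁ + 3 ≤ 2 ^ divPrecision n ℓ τ₁ τ₂ ρ ∧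
      (2 : ℝ) ^ τ₂ + 3 ≤ 2 ^ divPrecision n ℓ τ₁ τ₂ ρ := by
  have hlg := one_le_lg hn
  have h1 : τ₂ ≤ τ₂ * lg n := le_mul_of_one_le_right hτ₂ hlg
  have h2 : 0 ≤ 80 * lg n ^ 2 + 10 * (ρ + 1) * n * lg n := by positivity
  have key : ∀ τ : ℝ, 0 ≤ τ → τ + 2 ≤ divPrecision n ℓ τ₁ τ₂ ρ →
      (2 : ℝ) ^ τ + 3 ≤ 2 ^ divPrecision n ℓ τ₁ τ₂ ρ := by
    intro τ h0 h
    refine le_trans ?_ (Real.rpow_le_rpow_of_exponent_le (by norm_num) h)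
    have h3 : (1 : ℝ) ≤ 2 ^ τ := Real.one_le_rpow (by norm_num) h0
    have h4 : (2 : ℝ) ^ (τ + 2) = 2 ^ τ * 4 := by
      rw [Real.rpow_add (by norm_num)]; norm_num
    rw [h4]
    linarith
  constructor
  · exact key _ hτ₁ (by rw [divPrecision]; nlinarith)
  · exact key _ hτ₂ (by rw [divPrecision]; nlinarith)

/-- The circuit for the approximate division, for given parameters of the arithmetic. -/
theorem exists_solvesDivision {n : ℕ} (hn : 2 ≤ n) {ℓ τ₁ τ₂ ρ : ℝ} (hℓ : 0 ≤ ℓ) (hτ₁ : 0 ≤ τ₁)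
    (hτ₂ : 0 ≤ τ₂) (hρ : 1 ≤ ρ) {P k g w' : ℕ} (hP : divPrecision n ℓ τ₁ τ₂ ρ ≤ P)
    (hN : 2 ∣ w' + 1)
    (hmul : Computes ((Enc.fermat (w' + 1)).prod (.fermat (w' + 1))) (.fermat (w' + 1)) id
      (fun p : Fermat (w' + 1) × Fermat (w' + 1) => p.1 * p.2) g) (hk : 2 ^ k ∣ w' + 1)
    (hd : 2 * (n + 1) ≤ 2 ^ k) (hPw : 4 * P < w') (p w : ℕ) :
    ∃ F, SolvesDivision n ℓ τ₁ τ₂ ρ p w (3 * P) w' F ∧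
      CostLE F ((Nat.clog 2 (n + 1) + 2) *
        (4 * (2 ^ k * (g + 300 * k * (w' + 1))) + 5000 * (2 ^ k * (w' + 1)))) := by
  set lam := divPrecision n ℓ τ₁ τ₂ ρ with hlam
  let A : Enc := (((Enc.int w).pow (Fin 2)).pow (Fin (2 * n + 1))).prod
    (((Enc.int w).pow (Fin 2)).pow (Fin (n + 1)))
  -- The admissible values are the bit strings that approximate some valid division problem, so all
  -- size bounds are available; other inputs impose no condition.
  let Ω : Type := {x : A.κ → Bool // ∃ s t q r : ℂ[X], IsDivision n τ₁ τ₂ ρ s t q r ∧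
    (s - polyOfBits p (fun i => x (Sum.inl i))).supNorm ≤ 2 ^ (-lam) ∧
    (t - polyOfBits p (fun i => x (Sum.inr i))).supNorm ≤ 2 ^ (-lam)}
  let y : Ω → A.X := fun ω => A.dec ω.1
  let sI : Ω → GaussianInt[X] := fun ω => roundInput p P (y ω).1
  let tI : Ω → GaussianInt[X] := fun ω => roundInput p P (y ω).2
  have hη0 : (0 : ℝ) < 2 ^ (-lam) := by positivity
  have hη1 : (2 : ℝ) ^ (-lam) ≤ 1 := by
    refine Real.rpow_le_one_of_one_le_of_nonpos (by norm_num) ?_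
    have hlg := one_le_lg hn
    rw [hlam, divPrecision, neg_nonpos]
    positivity
  have hPη : 2 / (2 : ℝ) ^ P ≤ 2 * 2 ^ (-lam) := by
    rw [div_eq_mul_inv, Real.rpow_neg (by norm_num), ← Real.rpow_natCast]
    gcongr
    norm_num
  have hclose : ∀ {d : ℕ} (b : PolyBit d w → Bool) (f : ℂ[X]),
      (f - polyOfBits p b).supNorm ≤ 2 ^ (-lam) → ∀ i,
      ‖((roundInput p P fun j k => intOfBits fun i => b (j, k, i)).coeff i).toComplex / 2 ^ P -
        f.coeff i‖ ≤ 3 * 2 ^ (-lam) := by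
    intro d b f hf i
    have h1 := norm_coeff_roundInput_sub_le p P b i
    have h2 := supNorm_le_iff_coeff.mp hf i
    rw [coeff_sub, norm_sub_rev] at h2
    calc _ ≤ _ + _ := norm_sub_le_norm_sub_add_norm_sub _ ((polyOfBits p b).coeff i) _
      _ ≤ 3 * 2 ^ (-lam) := by linarith
  have hlarge : ∀ {d : ℕ} (b : PolyBit d w → Bool) (f : ℂ[X]) (τ : ℝ), f.supNorm ≤ 2 ^ τ →
      (2 : ℝ) ^ τ + 3 ≤ 2 ^ lam → (f - polyOfBits p b).supNorm ≤ 2 ^ (-lam) → ∀ i,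
      ‖((roundInput p P fun j k => intOfBits fun i => b (j, k, i)).coeff i).toComplex‖ ≤
        2 ^ (2 * P + 1 - 1) := by
    intro d b f τ hf hτ hfb i
    have h1 := hclose b f hfb i
    have h2 := supNorm_le_iff_coeff.mp hf i
    set z := ((roundInput p P fun j k => intOfBits fun i => b (j, k, i)).coeff i).toComplex
    have h3 : (2 : ℝ) ^ lam ≤ 2 ^ P := by
      rw [← Real.rpow_natCast]; exact Real.rpow_le_rpow_of_exponent_le (by norm_num) hP
    have h4 : ‖z / 2 ^ P‖ ≤ 2 ^ P := by
      have := norm_le_norm_sub_add (z / 2 ^ P) (f.coeff i)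
      linarith
    rw [norm_div, norm_pow, Complex.norm_ofNat, div_le_iff₀ (by positivity)] at h4
    calc ‖z‖ ≤ 2 ^ P * 2 ^ P := h4
      _ = 2 ^ (2 * P + 1 - 1) := by rw [Nat.add_sub_cancel]; ring
  obtain ⟨hs3, ht3⟩ := two_rpow_add_three_le hn hℓ hτ₁ hτ₂ hρ
  -- The exact problem behind an input is not unique. For the size bounds any choice serves, since
  -- they concern the rounded data only.
  have hA : ∀ ω : Ω, ∃ s t q r H, DivApprox n P (Nat.clog 2 (n + 1)) (2 ^ τ₁) (2 ^ (n * (ρ + 2)))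
      (2 ^ (-lam)) s t q r (sI ω) (tI ω) H := by
    rintro ⟨x, s, t, q, r, h, hs, ht⟩
    exact ⟨s, t, q, r, h.divApprox hn hℓ hτ₁ hτ₂ hρ hP (hclose (fun i => x (.inl i)) s hs)
      (hclose (fun i => x (.inr i)) t ht)⟩
  have c1 : Computes A ((Enc.gpoly (w' + 1) (2 * n + 1)).prod (.gpoly (w' + 1) (n + 1))) y
      (fun ω => (gvec hN (2 * n + 1) (sI ω), gvec hN (n + 1) (tI ω)))
      (2 * ((2 * n + 1) * (700 * (w' + 1))) + 2 * ((n + 1) * (700 * (w' + 1)))) := by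
    have h1 := (Computes.fst (y := y)).trans (Computes.gpoly_roundInput (w := w) (p := p) (P := P) hN
      (K := 2 * P + 1) (by omega) (y := fun ω => (y ω).1) (by
        rintro ⟨x, s, t, q, r, h, hs, ht⟩
        exact hlarge (fun i => x (.inl i)) s τ₁ h.norm_s hs3 hs) (by omega))
    have h2 := (Computes.snd (y := y)).trans (Computes.gpoly_roundInput (w := w) (p := p) (P := P) hN
      (K := 2 * P + 1) (by omega) (y := fun ω => (y ω).2) (by
        rintro ⟨x, s, t, q, r, h, hs, ht⟩
        exact hlarge (fun i => x (.inr i)) t τ₂ h.norm_t ht3 ht) (by omega))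
    exact (h1.pair h2).mono (by omega)
  have c2 := Computes.approxDivision (s := sI) (t := tI) (K := Nat.clog 2 (n + 1)) hN hmul hk hd hPw
    (fun ω i hi => by simp only [tI, roundInput, coeff_sum_monomial, dif_neg (not_lt.mpr hi)])
    (fun ω j i hj hi => by
      obtain ⟨s, t, q, r, H, h⟩ := hA ω
      exact h.norm_newtonPre_le hj hi)
    (fun ω i => by
      obtain ⟨s, t, q, r, H, h⟩ := hA ω
      exact h.norm_approxRevQuot_le i)
    (fun ω i => by
      obtain ⟨s, t, q, r, H, h⟩ := hA ω
      exact h.norm_approxRem_le i)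
  obtain ⟨F, hF, H⟩ := c1.trans c2
  refine ⟨F, ?_, hF.mono ?_⟩
  · intro s t q r h x hs ht
    obtain ⟨h1, h2⟩ := Prod.ext_iff.mp (H ⟨x, s, t, q, r, h, hs, ht⟩ x rfl)
    obtain ⟨H', hD⟩ := h.divApprox hn hℓ hτ₁ hτ₂ hρ hP
      (hclose (fun i => x (.inl i)) s hs) (hclose (fun i => x (.inr i)) t ht)
    have hprec := precision_suffices hn (ℓ := ℓ) (τ₁ := τ₁) hτ₂ hρ
    constructor
    · refine supNorm_le_iff_coeff.mpr fun i => ?_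
      -- The quotient is computed with 2P bits after the point and returned in the common output
      -- format with 3P.
      rw [coeff_sub, coeff_polyOfBits (c := fun i => _ * 2 ^ P) (3 * P) (fun i hi => by
        rw [coeff_reflect_eq_zero (fun _ => coeff_approxRevQuot_eq_zero) hi, zero_mul])
        (fun j => congrFun h1 j)]
      refine le_trans (le_of_eq ?_) ((hD.err_quot i).trans (hD.quot_eps_le.trans hprec))
      rw [map_mul, map_pow, map_ofNat, show 3 * P = 2 * P + P by ring, pow_add,
        mul_div_mul_right _ _ (pow_ne_zero _ two_ne_zero)]
    · refine supNorm_le_iff_coeff.mpr fun i => ?_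
      rw [coeff_sub, coeff_polyOfBits (3 * P) (fun i hi => by
        rw [approxRem, coeff_ptrunc, if_neg (by omega)]) (fun j => congrFun h2 j)]
      exact (hD.err_rem i).trans hprec
  · have hU : 2 * (n + 1) * (w' + 1) ≤ 2 ^ k * (w' + 1) := Nat.mul_le_mul_right _ hd
    generalize 2 ^ k * (g + 300 * k * (w' + 1)) = G at *
    generalize 2 ^ k * (w' + 1) = U at *
    nlinarith

/-! ### The number of gates -/

theorem lg_mono {x y : ℝ} (hx : 0 < x) (hxy : x ≤ y) : lg x ≤ lg y :=
  Real.logb_le_logb_of_le (by norm_num) hx hxy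

/-- The integer multiplication takes quasi-linear time. -/
theorem exists_mulCost_le : ∃ D : ℝ, 1 ≤ D ∧ ∀ m : ℕ, 2 ≤ m →
    (mulCost m : ℝ) ≤ D * (m * lg m ^ 10) := by
  obtain ⟨C, hC⟩ := exists_mulCircuit_two_pow
  refine ⟨2 * 3 ^ 10 * C + 6, by have : (0 : ℝ) ≤ C := C.cast_nonneg; linarith, fun m hm => ?_⟩
  have hlg := one_le_lg hm
  obtain ⟨j, hj⟩ : ∃ j, Nat.clog 2 m = j + 1 :=
    ⟨_, (Nat.succ_pred_eq_of_pos (Nat.clog_pos (by norm_num) hm)).symm⟩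
  have h1 : 2 ^ j ≤ m := by
    have := Nat.pow_pred_clog_lt_self (b := 2) (by norm_num) (x := m) (by omega)
    rw [hj] at this
    exact this.le
  have h2 : m ≤ 2 ^ (j + 1) := hj ▸ Nat.le_pow_clog (by norm_num) m
  have h3 : (j : ℝ) ≤ lg m := by
    rw [lg, Real.le_logb_iff_rpow_le (by norm_num) (by positivity), Real.rpow_natCast]
    exact_mod_cast h1
  have : NeZero m := ⟨by omega⟩
  have h4 : (mulCost m : ℝ) ≤ C * 2 ^ (j + 1) * (j + 1 + 1) ^ 10 + 6 := by
    exact_mod_cast ((hC (j + 1)).of_le h2).mulCost_le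
  have hm2 : (2 : ℝ) ≤ m := by exact_mod_cast hm
  have h5 : (1 : ℝ) ≤ m * lg m ^ 10 :=
    one_le_mul_of_one_le_of_one_le (by linarith) (one_le_pow₀ hlg)
  have h6 : (2 : ℝ) ^ (j + 1) ≤ 2 * m := by
    rw [pow_succ, mul_comm]; gcongr; exact_mod_cast h1
  have h7 : ((j : ℝ) + 1 + 1) ^ 10 ≤ (3 * lg m) ^ 10 := by gcongr; linarith
  calc (mulCost m : ℝ) ≤ C * (2 * m) * (3 * lg m) ^ 10 + 6 := h4.trans (by gcongr)
    _ = 2 * 3 ^ 10 * C * (m * lg m ^ 10) + 6 := by ring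
    _ ≤ (2 * 3 ^ 10 * C + 6) * (m * lg m ^ 10) := by linarith

/-- In multiples of nρ lg n, the terms 80 lg² n, 10(ρ+1)n lg n and 30 contribute 80, 20 and 15,
which gives 115. -/
theorem divPrecision_le {n : ℕ} (hn : 2 ≤ n) {ℓ τ₁ τ₂ ρ : ℝ} (hℓ : 0 ≤ ℓ) (hτ₁ : 0 ≤ τ₁)
    (hτ₂ : 0 ≤ τ₂) (hρ : 1 ≤ ρ) :
    divPrecision n ℓ τ₁ τ₂ ρ ≤ 115 * (ℓ + τ₁ + τ₂ * lg n + n * ρ * lg n) := by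
  have hlg := one_le_lg hn
  have hlgn := lg_le_self (n := n) (by omega)
  have hn2 : (2 : ℝ) ≤ n := by exact_mod_cast hn
  have h1 : 0 ≤ τ₂ * lg n := by positivity
  have h2 : lg n ^ 2 ≤ n * lg n := by nlinarith
  have h3 : n * lg n ≤ n * ρ * lg n := by
    have : 0 ≤ n * lg n := by positivity
    nlinarith
  have h4 : 2 ≤ n * lg n := by nlinarith
  rw [divPrecision]
  linarith

/-- A polynomial product has O(n) coefficient products of cost O(μ) and O(lg n) levels of
linear-size additions, and O(lg n) such products are needed. All lengths are bounded multiples of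
the argument M of μ. -/
theorem exists_divisionGates : ∃ C : ℝ, 0 ≤ C ∧ ∀ n : ℕ, 2 ≤ n → ∀ ℓ τ₁ τ₂ ρ : ℝ,
    0 ≤ ℓ → 0 ≤ τ₁ → 0 ≤ τ₂ → 1 ≤ ρ → ∀ p w : ℕ,
      ∃ (p' w' g : ℕ) (F : (PolyBit (2 * n + 1) w ⊕ PolyBit (n + 1) w → Bool) →
          PolyBit (n + 1) w' ⊕ PolyBit n w' → Bool),
        SolvesDivision n ℓ τ₁ τ₂ ρ p w p' w' F ∧ ComputableWithGates F g ∧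
        (g : ℝ) ≤ C * (n * lg n ^ 2 * mulCost ⌈ℓ + τ₁ + (τ₂ + n * ρ) * lg n⌉₊) := by
  refine ⟨4 * (16 * (940 * 940 * 47007 + 2 + 300 * 3 * 470) + 20000 * 470), by norm_num, ?_⟩
  intro n hn ℓ τ₁ τ₂ ρ hℓ hτ₁ hτ₂ hρ p w
  have hlg := one_le_lg hn
  have hlgn := lg_le_self (n := n) (by omega)
  have hn2 : (2 : ℝ) ≤ n := by exact_mod_cast hn
  set Z := ℓ + τ₁ + (τ₂ + n * ρ) * lg n with hZ
  have hlam := divPrecision_le hn hℓ hτ₁ hτ₂ hρ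
  have hZ' : ℓ + τ₁ + τ₂ * lg n + n * ρ * lg n = Z := by rw [hZ]; ring
  rw [hZ'] at hlam
  have hnρ : (n : ℝ) ≤ n * ρ := le_mul_of_one_le_right (by positivity) hρ
  have hnZ : (n : ℝ) ≤ Z := by
    have h1 : (n : ℝ) * ρ ≤ n * ρ * lg n := le_mul_of_one_le_right (by positivity) hlg
    have h2 : 0 ≤ τ₂ * lg n := by positivity
    linarith
  have hZlam : Z ≤ divPrecision n ℓ τ₁ τ₂ ρ := by
    have h1 : 0 ≤ τ₂ * lg n := by positivity
    have h2 : 0 ≤ n * ρ * lg n := by positivity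
    have h3 : 0 ≤ n * lg n := by positivity
    rw [← hZ', divPrecision]
    nlinarith [sq_nonneg (lg n)]
  set M := ⌈Z⌉₊ with hM
  have hZM : Z ≤ M := Nat.le_ceil Z
  have hnM : n ≤ M := by exact_mod_cast hnZ.trans hZM
  set P := ⌈divPrecision n ℓ τ₁ τ₂ ρ⌉₊ with hP
  have hMP : M ≤ P := Nat.ceil_le_ceil hZlam
  have hPM : P ≤ 116 * M := by
    have h1 : (P : ℝ) < divPrecision n ℓ τ₁ τ₂ ρ + 1 := Nat.ceil_lt_add_one (by linarith)
    have h2 : (P : ℝ) ≤ 116 * M := by linarith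
    exact_mod_cast h2
  obtain ⟨K, hK⟩ : ∃ K, Nat.clog 2 (n + 1) = K + 1 :=
    ⟨_, (Nat.succ_pred_eq_of_pos (Nat.clog_pos (by norm_num) (by omega))).symm⟩
  have hL1 : n + 1 ≤ 2 ^ (K + 1) := hK ▸ Nat.le_pow_clog (by norm_num) _
  have hL2 : 2 ^ K ≤ n := by
    have := Nat.pow_pred_clog_lt_self (b := 2) (by norm_num) (x := n + 1) (by omega)
    rw [hK] at this
    exact Nat.lt_succ_iff.mp this
  have hKlg : ((K + 1 : ℕ) : ℝ) ≤ 2 * lg n := hK ▸ clog_succ_le_two_mul_lg hn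
  set L := 2 ^ (K + 2) with hL
  have hL4 : L = 4 * 2 ^ K := by rw [hL, pow_add]; ring
  have hL4' : L = 2 * 2 ^ (K + 1) := by rw [hL, pow_succ]; ring
  have hL0 : 0 < L := by positivity
  -- N = w' + 1 is the least multiple of L exceeding 4P + 2: divisibility is needed for the roots of
  -- unity, the size for recovering integers. Since P ≤ 116M and L ≤ 4M, it is at most 470M.
  obtain ⟨w', hw'⟩ : ∃ w', w' + 1 = L * ((4 * P + 2) / L + 1) :=
    ⟨_, Nat.sub_add_cancel (Nat.mul_pos hL0 (Nat.succ_pos _))⟩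
  have hN1 : 4 * P + 2 < w' + 1 := hw' ▸ Nat.lt_mul_div_succ _ hL0
  have hN2 : w' + 1 ≤ 4 * P + 2 + L := by
    rw [hw', mul_add, mul_one]
    gcongr
    exact Nat.mul_div_le _ _
  have hNM : w' + 1 ≤ 470 * M := by omega
  have hLN : L ∣ w' + 1 := hw' ▸ dvd_mul_right _ _
  have : NeZero M := ⟨by omega⟩
  -- The 2N bits of a residue fill at most 940 blocks of M bits. The cost is thereby compared with
  -- μ(M) itself, with no assumption on the growth of μ.
  have hmul := Computes.fermatMul_of_blocks (N := w' + 1) (M := M) (c := 940) (by omega) (by omega)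
    (mulCircuit_mulCost M)
  obtain ⟨F, hF, g, hg, hgF⟩ := exists_solvesDivision hn hℓ hτ₁ hτ₂ hρ (Nat.le_ceil _)
    ((dvd_pow_self 2 (by omega)).trans hLN) hmul hLN (by omega) (by omega) p w
  refine ⟨_, _, g, F, hF, hgF, ?_⟩
  -- This turns every term linear in the word length into a multiple of μ(M).
  have hμ : M ≤ mulCost M := le_mulCost M
  set μ := mulCost M
  have hg' : (g : ℝ) ≤ (K + 3) * (4 * (L * (940 * 940 * (μ + 6 + 100 * (w' + 1)) + 2 +
      300 * (K + 2) * (w' + 1))) + 5000 * (L * (w' + 1))) := by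
    rw [hK] at hg
    exact_mod_cast hg
  have hNμ : (w' : ℝ) + 1 ≤ 470 * μ := by
    have : w' + 1 ≤ 470 * μ := by omega
    exact_mod_cast this
  have hμ1 : (1 : ℝ) ≤ μ := by
    have : 1 ≤ μ := by omega
    exact_mod_cast this
  have hLn : (L : ℝ) ≤ 4 * n := by
    have : L ≤ 4 * n := by omega
    exact_mod_cast this
  push_cast at hKlg
  have hK3 : (K : ℝ) + 3 ≤ 4 * lg n := by linarith
  have hK2 : (K : ℝ) + 2 ≤ 3 * lg n := by linarith
  have hμlg : (μ : ℝ) ≤ lg n * μ := le_mul_of_one_le_left (by positivity) hlg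
  refine hg'.trans ?_
  have e1 : (940 * 940 * (μ + 6 + 100 * (w' + 1)) + 2 : ℝ) ≤ (940 * 940 * 47007 + 2) * (lg n * μ) := by
    linarith
  have e2 : (300 * (K + 2) * (w' + 1) : ℝ) ≤ 300 * (3 * lg n) * (470 * μ) := by gcongr
  calc _ ≤ 4 * lg n * (4 * (4 * n * ((940 * 940 * 47007 + 2) * (lg n * μ) +
        300 * (3 * lg n) * (470 * μ))) + 5000 * (4 * n * (470 * (lg n * μ)))) := by
        gcongr
        linarith
    _ = _ := by ring

/-- With Z the real argument of μ and X the target quantity, nZ ≤ X lg n. The exponent 13 collects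
this logarithm, the factor lg² n and the lg^10 in the bound for μ; rounding Z up at most doubles it,
whence 2·2^10 in the constant. -/
theorem exists_gates_le_quasilinear : ∃ D : ℝ, 1 ≤ D ∧ ∀ n : ℕ, 2 ≤ n → ∀ ℓ τ₁ τ₂ ρ : ℝ,
    0 ≤ ℓ → 0 ≤ τ₁ → 0 ≤ τ₂ → 1 ≤ ρ →
      (n * lg n ^ 2 * mulCost ⌈ℓ + τ₁ + (τ₂ + n * ρ) * lg n⌉₊ : ℝ) ≤
        D * ((n * ℓ + n * τ₁ + n * τ₂ + n ^ 2 * ρ) *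
          lg (n * ℓ + n * τ₁ + n * τ₂ + n ^ 2 * ρ) ^ 13) := by
  obtain ⟨D, hD, h⟩ := exists_mulCost_le
  refine ⟨2 ^ 11 * D, by linarith, ?_⟩
  intro n hn ℓ τ₁ τ₂ ρ hℓ hτ₁ hτ₂ hρ
  have hlg := one_le_lg hn
  have hlgn := lg_le_self (n := n) (by omega)
  have hn2 : (2 : ℝ) ≤ n := by exact_mod_cast hn
  set Z := ℓ + τ₁ + (τ₂ + n * ρ) * lg n with hZ
  set X := n * ℓ + n * τ₁ + n * τ₂ + n ^ 2 * ρ with hX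
  have hZ2 : 2 ≤ Z := by
    have h1 : (n : ℝ) ≤ n * ρ := le_mul_of_one_le_right (by positivity) hρ
    have h2 : τ₂ + n * ρ ≤ (τ₂ + n * ρ) * lg n := le_mul_of_one_le_right (by positivity) hlg
    linarith
  have hnX : (n : ℝ) ^ 2 ≤ X := by
    have h1 : (n : ℝ) ^ 2 ≤ n ^ 2 * ρ := le_mul_of_one_le_right (by positivity) hρ
    have : 0 ≤ n * ℓ + n * τ₁ + n * τ₂ := by positivity
    linarith
  have hX4 : 4 ≤ X := by nlinarith
  have hnZX : n * Z ≤ X * lg n := by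
    have h1 : n * ℓ ≤ n * ℓ * lg n := le_mul_of_one_le_right (by positivity) hlg
    have h2 : n * τ₁ ≤ n * τ₁ * lg n := le_mul_of_one_le_right (by positivity) hlg
    rw [hZ, hX]
    nlinarith
  have hZX : Z ≤ X := by
    have h1 : X * lg n ≤ X * n := by gcongr
    nlinarith
  have hM : (⌈Z⌉₊ : ℝ) ≤ 2 * Z := by
    have := Nat.ceil_lt_add_one (a := Z) (by linarith)
    linarith
  have hM2 : 2 ≤ ⌈Z⌉₊ := by
    have : (2 : ℝ) ≤ ⌈Z⌉₊ := hZ2.trans (Nat.le_ceil Z)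
    exact_mod_cast this
  have hlgX : lg n ≤ lg X := lg_mono (by linarith) (by nlinarith)
  have hlgM : lg ⌈Z⌉₊ ≤ 2 * lg X := by
    have h1 : lg ⌈Z⌉₊ ≤ lg (2 * X) := lg_mono (by positivity) (by linarith)
    have h2 : lg (2 * X) = 1 + lg X := by
      rw [lg, Real.logb_mul (by norm_num) (by positivity), Real.logb_self_eq_one (by norm_num), lg]
    linarith
  have hlgM1 := one_le_lg hM2
  calc (n * lg n ^ 2 * mulCost ⌈Z⌉₊ : ℝ) ≤ n * lg n ^ 2 * (D * (⌈Z⌉₊ * lg ⌈Z⌉₊ ^ 10)) := by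
        gcongr; exact h _ hM2
    _ ≤ n * lg n ^ 2 * (D * (2 * Z * (2 * lg X) ^ 10)) := by gcongr
    _ = 2 ^ 11 * D * ((n * Z) * lg n ^ 2 * lg X ^ 10) := by ring
    _ ≤ 2 ^ 11 * D * ((X * lg X) * lg X ^ 2 * lg X ^ 10) := by
        have h1 : n * Z ≤ X * lg X := hnZX.trans (by gcongr)
        have h2 : 0 ≤ X * lg X := le_trans (by positivity) h1
        gcongr
    _ = 2 ^ 11 * D * (X * lg X ^ 13) := by ring

theorem mainTheorem2 :
    -- the size of the input precision
    (∃ C : ℝ, ∀ n : ℕ, 2 ≤ n → ∀ ℓ τ₁ τ₂ ρ : ℝ, 0 ≤ ℓ → 0 ≤ τ₁ → 0 ≤ τ₂ → 1 ≤ ρ →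
      divPrecision n ℓ τ₁ τ₂ ρ ≤ C * (ℓ + τ₁ + τ₂ * lg n + n * ρ * lg n)) ∧
    -- the norms of the quotient and the remainder
    (∀ n : ℕ, 1 ≤ n → ∀ τ₁ τ₂ ρ : ℝ, 0 ≤ ρ → ∀ s t q r : Polynomial ℂ,
      IsDivision n τ₁ τ₂ ρ s t q r →
        q.supNorm ≤ 2 ^ (2 * n + lg n + 1 + n * ρ + τ₁) ∧
        r.supNorm ≤ 2 ^ (3 * n + lg n + 1 + 2 * n * ρ + τ₁)) ∧
    -- the approximate division and its Boolean cost
    (∃ (C : ℝ) (k : ℕ), ∀ n : ℕ, 2 ≤ n → ∀ ℓ τ₁ τ₂ ρ : ℝ,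
      0 ≤ ℓ → 0 ≤ τ₁ → 0 ≤ τ₂ → 1 ≤ ρ → ∀ p w : ℕ,
        ∃ (p' w' g : ℕ) (F : (PolyBit (2 * n + 1) w ⊕ PolyBit (n + 1) w → Bool) →
            PolyBit (n + 1) w' ⊕ PolyBit n w' → Bool),
          SolvesDivision n ℓ τ₁ τ₂ ρ p w p' w' F ∧
          ComputableWithGates F g ∧
          (g : ℝ) ≤ C * (n * lg n ^ 2 * mulCost ⌈ℓ + τ₁ + (τ₂ + n * ρ) * lg n⌉₊) ∧
          (g : ℝ) ≤ C * ((n * ℓ + n * τ₁ + n * τ₂ + n ^ 2 * ρ) *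
            lg (n * ℓ + n * τ₁ + n * τ₂ + n ^ 2 * ρ) ^ k)) := by
  obtain ⟨C, hC0, hC⟩ := exists_divisionGates
  obtain ⟨D, hD, hD'⟩ := exists_gates_le_quasilinear
  refine ⟨⟨115, fun n hn ℓ τ₁ τ₂ ρ hℓ hτ₁ hτ₂ hρ => divPrecision_le hn hℓ hτ₁ hτ₂ hρ⟩,
    fun n hn τ₁ τ₂ ρ hρ s t q r h => h.supNorm_le hn hρ, C * D, 13, ?_⟩
  intro n hn ℓ τ₁ τ₂ ρ hℓ hτ₁ hτ₂ hρ p w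
  obtain ⟨p', w', g, F, hF, hg, hle⟩ := hC n hn ℓ τ₁ τ₂ ρ hℓ hτ₁ hτ₂ hρ p w
  refine ⟨p', w', g, F, hF, hg, hle.trans ?_, hle.trans ?_⟩
  · gcongr
    exact le_mul_of_one_le_right hC0 hD
  · rw [mul_assoc C D]
    refine mul_le_mul_of_nonneg_left ?_ hC0
    exact hD' n hn ℓ τ₁ τ₂ ρ hℓ hτ₁ hτ₂ hρ
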